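/- Let $n\ge 0$ be an integer. Let $(M_0,\xi_0)$ and $(M_1,\xi_1)$ be two smooth $(2n+1)$-dimensional contact manifolds without boundary; that is, $\xi_j\subset TM_j$ is a field of hyperplanes which near every point of $M_j$ is the kernel of a smooth nowhere vanishing $1$-form $\alpha$ such that $d\alpha$ is nondegenerate on $\ker\alpha$ ($\xi_j$ is not required to be coorientable). Let $\Sigma$ be a smooth $2n$-dimensional manifold without boundary, not necessarily compact, and let $$\iota_0\colon \Sigma\hookrightarrow M_0,\qquad \iota_1\colon\Sigma\hookrightarrow M_1$$ be two smooth embeddings (immersions that are homeomorphisms onto their images, which need not be closed subsets) such that the induced singular distributions agree, i.e. for every $p\in\Sigma$ $$\{v\in T_p\Sigma \mid D_p\iota_0(v)\in \xi_0(\iota_0(p))\}=\{v\in T_p\Sigma \mid D_p\iota_1(v)\in \xi_1(\iota_1(p))\}.$$ Then there exist an open neighborhood $U_0\subset M_0$ of $\iota_0(\Sigma)$, an open neighborhood $U_1\subset M_1$ of $\iota_1(\Sigma)$, and a contactomorphism $\Phi\colon (U_0,\xi_0)\to(U_1,\xi_1)$, i.e. a smooth diffeomorphism $\Phi\colon U_0\to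 U_1$ with $D_x\Phi(\xi_0(x))=\xi_1(\Phi(x))$ for all $x\in U_0$, such that $\Phi\circ\iota_0=\iota_1$. -/

import Mathlib

open Set Topology TopologicalSpace Bundle
open scoped Manifold ContDiff

namespace ContactGeometry

variable {m n k : ℕ}

/-- A field of tangent subspaces on an `m`-manifold: a linear subspace `D x ⊆ T_x M` for every
point `x`. The rank may vary with the point and no regularity is imposed (a "singular
distribution"). -/
abbrev TangentDistribution (m : ℕ) (M : Type*) [TopologicalSpace M]
    [ChartedSpace (EuclideanSpace ℝ (Fin m)) M] :=
  ∀ x : M, Submodule ℝ (TangentSpace (𝓡 m) x)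

/-- A (not necessarily continuous) `1`-form on an `m`-manifold. -/
abbrev OneForm (m : ℕ) (M : Type*) [TopologicalSpace M]
    [ChartedSpace (EuclideanSpace ℝ (Fin m)) M] :=
  ∀ x : M, TangentSpace (𝓡 m) x →L[ℝ] ℝ

section

variable {M : Type*} [TopologicalSpace M] [ChartedSpace (EuclideanSpace ℝ (Fin m)) M]
  {N : Type*} [TopologicalSpace N] [ChartedSpace (EuclideanSpace ℝ (Fin k)) N]

/-- The distribution `(Df)⁻¹(ξ)` on `M` induced by a distribution `ξ` on `N` through a map
`f : M → N`: at `x` it is `{v ∈ T_x M | Df_x v ∈ ξ (f x)}`. -/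
noncomputable def TangentDistribution.pullback (f : M → N) (ξ : TangentDistribution k N) :
    TangentDistribution m M :=
  fun x => (ξ (f x)).comap (mfderiv (𝓡 m) (𝓡 k) f x).toLinearMap

/-- The restriction of a distribution to an open subset, itself regarded as a manifold. -/
noncomputable def TangentDistribution.restrict (ξ : TangentDistribution m M) (U : Opens M) :
    TangentDistribution m U :=
  TangentDistribution.pullback (fun x : U => (x : M)) ξ

/-- The `1`-form `α` is smooth on `U`, as a section of the cotangent bundle. -/
def OneForm.SmoothOn [IsManifold (𝓡 m) ∞ M] (α : OneForm m M) (U : Set M) : Prop :=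
  ContMDiffOn (𝓡 m) ((𝓡 m).prod 𝓘(ℝ, EuclideanSpace ℝ (Fin m) →L[ℝ] ℝ)) ∞
    (fun x => (⟨x, α x⟩ : TotalSpace (EuclideanSpace ℝ (Fin m) →L[ℝ] ℝ)
      (fun x : M => TangentSpace (𝓡 m) x →L[ℝ] Bundle.Trivial M ℝ x))) U

/-- The `1`-form `α` read in the preferred chart `φ` at `p`, that is, the pullback of `α` under
`φ⁻¹`; it is meaningful on the target of `φ`. -/
noncomputable def OneForm.inChart (α : OneForm m M) (p : M) :
    EuclideanSpace ℝ (Fin m) →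
      EuclideanSpace ℝ (Fin m) [⋀^Fin 1]→L[ℝ] ℝ :=
  fun y => ContinuousAlternatingMap.ofSubsingleton ℝ (EuclideanSpace ℝ (Fin m)) ℝ (0 : Fin 1)
    ((α ((extChartAt (𝓡 m) p).symm y)).comp
      (mfderiv 𝓘(ℝ, EuclideanSpace ℝ (Fin m)) (𝓡 m) (extChartAt (𝓡 m) p).symm y))

/-- The exterior derivative of a `1`-form: `dα_x (u, v)` is computed in the preferred chart at
`x`. It is meaningful where `α` is smooth. -/
noncomputable def OneForm.d (α : OneForm m M) (x : M) (u v : TangentSpace (𝓡 m) x) : ℝ :=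
  extDeriv (α.inChart x) (extChartAt (𝓡 m) x x)
    ![mfderiv (𝓡 m) 𝓘(ℝ, EuclideanSpace ℝ (Fin m)) (extChartAt (𝓡 m) x) x u,
      mfderiv (𝓡 m) 𝓘(ℝ, EuclideanSpace ℝ (Fin m)) (extChartAt (𝓡 m) x) x v]

/-- `α` is a contact form on the open set `U`: it is smooth and, at every point `x` of `U`, it
does not vanish and `dα_x` is nondegenerate (that is, symplectic) on the hyperplane `ker α_x`. -/
structure OneForm.IsContactOn [IsManifold (𝓡 m) ∞ M] (α : OneForm m M) (U : Set M) : Prop where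
  smoothOn : α.SmoothOn U
  ne_zero : ∀ x ∈ U, α x ≠ 0
  nondegenerate : ∀ x ∈ U, ∀ u : TangentSpace (𝓡 m) x, α x u = 0 →
    (∀ v : TangentSpace (𝓡 m) x, α x v = 0 → α.d x u v = 0) → u = 0

/-- `ξ` is a contact structure on `M`: near every point it is the kernel of a contact form.
(No coorientation, i.e. no global contact form, is required.) -/
def IsContactStructure [IsManifold (𝓡 m) ∞ M] (ξ : TangentDistribution m M) : Prop :=
  ∀ p : M, ∃ U : Set M, IsOpen U ∧ p ∈ U ∧ ∃ α : OneForm m M, α.IsContactOn U ∧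
    ∀ x ∈ U, ξ x = LinearMap.ker (α x).toLinearMap

end

/-- The diffeomorphism `Φ : M → N` is a contactomorphism `(M, ξ) → (N, η)`:
`DΦ_x (ξ x) = η (Φ x)` for all `x`. -/
def IsContactomorphism {M : Type*} [TopologicalSpace M]
    [ChartedSpace (EuclideanSpace ℝ (Fin m)) M] {N : Type*} [TopologicalSpace N]
    [ChartedSpace (EuclideanSpace ℝ (Fin m)) N]
    (ξ : TangentDistribution m M) (η : TangentDistribution m N)
    (Φ : M ≃ₘ^∞⟮𝓡 m, 𝓡 m⟯ N) : Prop :=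
  ∀ x : M, (ξ x).map (mfderiv (𝓡 m) (𝓡 m) Φ x).toLinearMap = η (Φ x)

end ContactGeometry

/-!
In local coordinates, the `1`-forms induced on the hypersurface `S` by contact forms `a` and `a'`
of the two contact structures have the same kernels, and where such a form vanishes its exterior
derivative is nondegenerate. Hence `ι₁^* a' = f · ι₀^* a` for a smooth nowhere vanishing function
`f`, which is unique if `S` is not zero-dimensional: near a zero of the induced forms one divides
by a function with a regular zero.

Choose a Hamiltonian `H` whose contact vector field `X_H` is transverse to `ι₀ S`, and any `H'` on
the target with `H' ∘ ι₁ = f · (H ∘ ι₀)`. Whether `X_H` is tangent to the hypersurface depends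
only on the induced form and on `H ∘ ι₀`, so `X_{H'}` is transverse to `ι₁ S`. Contact flows
preserve the contact structures, so matching the flow-outs of `S` along `X_H` and along `X_{H'}`
gives a germ of contactomorphisms.

Conversely, the conformal factor `g` of a germ `Ψ` of contactomorphisms with `Ψ ∘ ι₀ = ι₁`
restricts to `f` on `S`, and `Ψ` maps `X_H` to `X_{H'}` if `H' ∘ Ψ = g · H`. A germ given along a
compact subset of `S` is therefore recovered from any `H'` which has this property near that
subset, so that local existence holds relative to given germs. This allows germs to be extended
successively over a countable cover of `S` by small compact sets, without contact forms that are
defined globally. The resulting germs glue to a local diffeomorphism `Φ` with `Φ ∘ ι₀ = ι₁`, and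
`Φ` is injective near `ι₀ S` because `ι₁` is an embedding.
-/

namespace ContactGeometry

open Filter

/-! ### Smoothness of composition operators -/

section Postcomp

variable {K : Type*} [TopologicalSpace K] [CompactSpace K]
  {H : Type*} [NormedAddCommGroup H] [NormedSpace ℝ H]
  {E : Type*} [NormedAddCommGroup E] [NormedSpace ℝ E]
  {G : Type*} [NormedAddCommGroup G] [NormedSpace ℝ G]

/-- Pointwise application `(L, h) ↦ (t ↦ B (L t) (h t))` of a continuous bilinear map to
continuous functions. For the evaluation pairing of `E →L[ℝ] G` with `E` it expresses the
derivative of postcomposition. -/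
noncomputable def pointwiseBilin (B : H →L[ℝ] E →L[ℝ] G) :
    C(K, H) →L[ℝ] C(K, E) →L[ℝ] C(K, G) :=
  LinearMap.mkContinuous₂
    (LinearMap.mk₂ ℝ (fun L h => (⟨fun t => B (L t) (h t), by fun_prop⟩ : C(K, G)))
      (fun _ _ _ => by ext; simp) (fun _ _ _ => by ext; simp)
      (fun _ _ _ => by ext; simp) (fun _ _ _ => by ext; simp)) ‖B‖
    (fun L h => (ContinuousMap.norm_le _ (by positivity)).2 fun t =>
      B.le_of_opNorm₂_le_of_le le_rfl (L.norm_coe_le_norm t) (h.norm_coe_le_norm t))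

theorem hasFDerivAt_postcomp {g : C(E, G)} {g' : C(E, E →L[ℝ] G)}
    (hg : ∀ x, HasFDerivAt g (g' x) x) (γ : C(K, E)) :
    HasFDerivAt (fun γ : C(K, E) => g.comp γ)
      (pointwiseBilin (.id ℝ (E →L[ℝ] G)) (g'.comp γ)) γ := by
  rw [hasFDerivAt_iff_isLittleO_nhds_zero, Asymptotics.isLittleO_iff]
  intro ε hε
  obtain ⟨δ, hδ, hg'δ⟩ := Metric.mem_uniformity_dist.1 <|
    (isCompact_range γ.continuous).uniformContinuousAt_of_continuousAt g'
      (fun x _ => g'.continuous.continuousAt) (Metric.dist_mem_uniformity hε)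
  filter_upwards [Metric.ball_mem_nhds (0 : C(K, E)) hδ] with h hh
  rw [mem_ball_zero_iff] at hh
  refine (ContinuousMap.norm_le _ (by positivity)).2 fun t => ?_
  have hmem : γ t + h t ∈ Metric.ball (γ t) δ := by
    simpa using (h.norm_coe_le_norm t).trans_lt hh
  have hg'_near : ∀ x ∈ Metric.ball (γ t) δ, ‖g' x - g' (γ t)‖ ≤ ε := fun x hx => by
    rw [← dist_eq_norm, dist_comm]
    exact (hg'δ (a := γ t) (b := x) (by rwa [dist_comm]) (mem_range_self t)).le
  have hmean : ‖g (γ t + h t) - g (γ t) - g' (γ t) (h t)‖ ≤ ε * ‖h t‖ := by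
    simpa using (convex_ball (γ t) δ).norm_image_sub_le_of_norm_hasFDerivWithin_le'
      (fun x _ => (hg x).hasFDerivWithinAt) hg'_near (Metric.mem_ball_self hδ) hmem
  change ‖g (γ t + h t) - g (γ t) - g' (γ t) (h t)‖ ≤ _
  exact hmean.trans (mul_le_mul_of_nonneg_left (h.norm_coe_le_norm t) hε.le)

end Postcomp

section ContDiffPostcomp

universe u v

variable {K : Type*} [TopologicalSpace K] [CompactSpace K]
  {E : Type u} [NormedAddCommGroup E] [NormedSpace ℝ E]

set_option synthInstance.maxHeartbeats 200000 in
-- The induction replaces `G` by `E →L[ℝ] G`, so `G` must live in a universe containing that of `E`.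
theorem contDiff_nat_postcomp_of_max (n : ℕ) :
    ∀ {G : Type max u v} [NormedAddCommGroup G] [NormedSpace ℝ G] (g : C(E, G)),
      ContDiff ℝ n g → ContDiff ℝ n (fun γ : C(K, E) => g.comp γ) := by
  induction n with
  | zero => exact fun g _ => contDiff_zero.2 (ContinuousMap.continuous_postcomp g)
  | succ n ih =>
    intro G _ _ g hg
    obtain ⟨g', hg', hd⟩ := contDiff_succ_iff_hasFDerivAt.1 (by exact_mod_cast hg)
    have hcomp := ih (G := E →L[ℝ] G) ⟨g', hg'.continuous⟩ hg'
    push_cast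
    exact contDiff_succ_iff_hasFDerivAt.2 ⟨_,
      (pointwiseBilin (K := K) (.id ℝ (E →L[ℝ] G))).contDiff.comp hcomp,
      hasFDerivAt_postcomp (g' := ⟨g', hg'.continuous⟩) hd⟩

theorem contDiff_postcomp {G : Type v} [NormedAddCommGroup G] [NormedSpace ℝ G]
    {g : C(E, G)} (hg : ContDiff ℝ ∞ g) : ContDiff ℝ ∞ (fun γ : C(K, E) => g.comp γ) := by
  let lift : G ≃L[ℝ] ULift.{u} G := ContinuousLinearEquiv.ulift.symm
  have hlift : ContDiff ℝ ∞ fun γ : C(K, E) => ((lift : C(G, ULift.{u} G)).comp g).comp γ :=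
    contDiff_infty.2 fun n => contDiff_nat_postcomp_of_max.{u, v} n _
      (contDiff_infty.1 (lift.contDiff.comp hg) n)
  exact ((lift.symm : ULift.{u} G →L[ℝ] G).compLeftContinuous ℝ K).contDiff.comp hlift

end ContDiffPostcomp

/-! ### Cutoffs and the inverse function theorem -/

theorem exists_contDiff_eventuallyEq {E G : Type*} [NormedAddCommGroup E] [NormedSpace ℝ E]
    [HasContDiffBump E] [NormedAddCommGroup G] [NormedSpace ℝ G] {f : E → G} {x₀ : E}
    (hf : ∀ᶠ x in 𝓝 x₀, ContDiffAt ℝ ∞ f x) : ∃ g : E → G, ContDiff ℝ ∞ g ∧ g =ᶠ[𝓝 x₀] f := by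
  obtain ⟨r, hr, hf_ball⟩ := Metric.eventually_nhds_iff_ball.1 hf
  let φ : ContDiffBump x₀ := ⟨r / 3, r / 2, by positivity, by linarith⟩
  refine ⟨fun x => φ x • f x, contDiff_iff_contDiffAt.2 fun x => ?_, ?_⟩
  · by_cases hx : x ∈ Metric.ball x₀ r
    · exact φ.contDiff.contDiffAt.smul (hf_ball x hx)
    · have hx_supp : x ∉ tsupport φ := by
        rw [φ.tsupport_eq]
        exact fun h => hx (Metric.closedBall_subset_ball (half_lt_self hr) h)
      refine (contDiffAt_const (c := (0 : G))).congr_of_eventuallyEq ?_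
      filter_upwards [notMem_tsupport_iff_eventuallyEq.1 hx_supp] with y hy
      simp [hy]
  · filter_upwards [φ.eventuallyEq_one] with y hy
    simp [hy]

theorem isInvertible_of_injective {𝕜 E G : Type*} [NontriviallyNormedField 𝕜] [CompleteSpace 𝕜]
    [NormedAddCommGroup E] [NormedSpace 𝕜 E] [FiniteDimensional 𝕜 E]
    [NormedAddCommGroup G] [NormedSpace 𝕜 G] [FiniteDimensional 𝕜 G]
    (h : Module.finrank 𝕜 E = Module.finrank 𝕜 G) {L : E →L[𝕜] G} (hL : Function.Injective L) :
    L.IsInvertible :=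
  ⟨(LinearEquiv.ofInjectiveOfFinrankEq L.toLinearMap hL h).toContinuousLinearEquiv, by ext; rfl⟩

theorem eventually_isInvertible_fderiv {E G : Type*} [NormedAddCommGroup E] [NormedSpace ℝ E]
    [CompleteSpace E] [NormedAddCommGroup G] [NormedSpace ℝ G] {f : E → G} {a : E}
    (hf : ContDiffAt ℝ 1 f a) (ha : (fderiv ℝ f a).IsInvertible) :
    ∀ᶠ x in 𝓝 a, (fderiv ℝ f x).IsInvertible := by
  obtain ⟨f', hf'⟩ := ha
  exact (hf.fderiv_right (m := 0) (by simp)).continuousAt.eventually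
    (hf' ▸ ContinuousLinearEquiv.nhds f')

-- Unlike `ContDiffAt.toOpenPartialHomeomorph`, both directions are smooth on all of the domain.
theorem exists_openPartialHomeomorph_of_isInvertible_fderiv {E G : Type*} [NormedAddCommGroup E]
    [NormedSpace ℝ E] [CompleteSpace E] [NormedAddCommGroup G] [NormedSpace ℝ G] {f : E → G}
    {a : E} (hf : ∀ᶠ x in 𝓝 a, ContDiffAt ℝ ∞ f x) (ha : (fderiv ℝ f a).IsInvertible) :
    ∃ e : OpenPartialHomeomorph E G, a ∈ e.source ∧ (∀ x, e x = f x) ∧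
      (∀ x ∈ e.source, ContDiffAt ℝ ∞ f x ∧ (fderiv ℝ f x).IsInvertible) ∧
      ∀ y ∈ e.target, ContDiffAt ℝ ∞ e.symm y := by
  have h0 : (∞ : WithTop ℕ∞) ≠ 0 := by simp
  have hfa := hf.self_of_nhds
  have hinv := eventually_isInvertible_fderiv (hfa.of_le (by simp)) ha
  obtain ⟨f', hf'⟩ := ha
  have hd : HasFDerivAt f (f' : E →L[ℝ] G) a := hf' ▸ (hfa.differentiableAt h0).hasFDerivAt
  obtain ⟨s, hs, hs_open, has⟩ := eventually_nhds_iff.1 (hf.and hinv)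
  let e := (hfa.toOpenPartialHomeomorph f hd h0).restrOpen s hs_open
  refine ⟨e, ⟨hfa.mem_toOpenPartialHomeomorph_source hd h0, has⟩, fun x => rfl,
    fun x hx => hs x hx.2, fun y hy => ?_⟩
  obtain ⟨hsmooth, g', hg'⟩ := hs _ (e.map_target hy).2
  refine e.contDiffAt_symm (f₀' := g') hy ?_ hsmooth
  exact hg' ▸ (hsmooth.differentiableAt h0).hasFDerivAt

/-! ### Integrals depending on a parameter -/

section UnitIntervalIntegral

open MeasureTheory unitInterval

theorem integral_unitInterval {E : Type*} [NormedAddCommGroup E] [NormedSpace ℝ E] (f : ℝ → E) :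
    ∫ t : I, f t = ∫ t in (0 : ℝ)..1, f t := by
  rw [integral_subtype measurableSet_Icc, intervalIntegral.integral_of_le zero_le_one,
    integral_Icc_eq_integral_Ioc]

theorem integrable_unitInterval {E : Type*} [NormedAddCommGroup E] (γ : C(I, E)) : Integrable γ :=
  γ.continuous.integrable_of_hasCompactSupport (HasCompactSupport.of_compactSpace γ)

/-- The integral over the unit interval, as a continuous linear functional. -/
noncomputable def unitIntegralCLM (E : Type*) [NormedAddCommGroup E] [NormedSpace ℝ E] :
    C(I, E) →L[ℝ] E :=
  LinearMap.mkContinuous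
    { toFun := fun γ => ∫ t, γ t
      map_add' := fun γ η => integral_add (integrable_unitInterval γ) (integrable_unitInterval η)
      map_smul' := fun c γ => integral_smul c γ } 1 fun γ => by
    simpa using norm_integral_le_of_norm_le_const (μ := volume)
      (.of_forall γ.norm_coe_le_norm)

theorem contDiff_integral_unitInterval {E : Type*} [NormedAddCommGroup E] [NormedSpace ℝ E]
    {F : Type*}
    [NormedAddCommGroup F] [NormedSpace ℝ F] {f : F × ℝ → E} (hf : ContDiff ℝ ∞ f) :
    ContDiff ℝ ∞ fun y => ∫ t in (0 : ℝ)..1, f (y, t) := by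
  let slice : F → C(I, F × ℝ) := fun y => ⟨fun t => (y, (t : ℝ)), by fun_prop⟩
  have hslice : ContDiff ℝ ∞ slice := by
    let const : F →L[ℝ] C(I, F × ℝ) :=
      ⟨{ toFun := fun y => .const I (y, 0), map_add' := fun _ _ => by ext <;> simp,
         map_smul' := fun _ _ => by ext <;> simp },
        ContinuousMap.continuous_const'.comp (Continuous.prodMk_left 0)⟩
    have : slice = fun y => const y + ⟨fun t : I => ((0 : F), (t : ℝ)), by fun_prop⟩ := by
      ext <;> simp [slice, const]
    rw [this]
    exact const.contDiff.add contDiff_const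
  have hcomp := (unitIntegralCLM E).contDiff.comp
    ((contDiff_postcomp (g := ⟨f, hf.continuous⟩) hf).comp hslice)
  exact (funext fun y => integral_unitInterval fun t => f (y, t)) ▸ hcomp

end UnitIntervalIntegral

/-! ### Smooth local flows -/

section Flow

open MeasureTheory unitInterval

variable {E : Type*} [NormedAddCommGroup E] [NormedSpace ℝ E]

/-- The integral form of `γ 0 = x` and `γ' = s • Y ∘ γ` on the unit interval. A negative speed `s`
runs the integral curve of `Y` through `x` backwards. -/
def IsIntegralCurveWithSpeed (Y : E → E) (s : ℝ) (x : E) (γ : C(I, E)) : Prop :=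
  ∀ t : I, γ t = x + (s * t) • ∫ u : I, Y (γ (t * u))

/-- The self-map `u ↦ c * u` of the unit interval. -/
def timeScale (c : I) : C(I, I) := ⟨fun u => c * u, by fun_prop⟩

theorem IsIntegralCurveWithSpeed.comp_timeScale {Y : E → E} {s : ℝ} {x : E} {γ : C(I, E)}
    (h : IsIntegralCurveWithSpeed Y s x γ) (c : I) :
    IsIntegralCurveWithSpeed Y (s * c) x (γ.comp (timeScale c)) := fun t => by
  simpa [timeScale, mul_assoc] using h (c * t)

/-- The operator `γ ↦ (t ↦ ∫ v in 0..t, γ v)`, with the integral rescaled to the unit interval. -/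
noncomputable def primitiveCLM (E : Type*) [NormedAddCommGroup E] [NormedSpace ℝ E] :
    C(I, E) →L[ℝ] C(I, E) :=
  LinearMap.mkContinuous
    { toFun := fun γ => ⟨fun t => (t : ℝ) • unitIntegralCLM E (γ.comp (timeScale t)), by
        have : Continuous fun t : I => γ.comp (timeScale t) :=
          ContinuousMap.continuous_of_continuous_uncurry _
            (γ.continuous.comp (continuous_fst.mul continuous_snd))
        fun_prop⟩
      map_add' := fun γ η => by
        ext t
        exact (congrArg _ (map_add (unitIntegralCLM E) (γ.comp (timeScale t))
          (η.comp (timeScale t)))).trans (smul_add _ _ _)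
      map_smul' := fun c γ => by
        ext t
        exact (congrArg _ (map_smul (unitIntegralCLM E) c (γ.comp (timeScale t)))).trans
          (smul_comm _ _ _) } ‖unitIntegralCLM E‖
    fun γ => (ContinuousMap.norm_le _ (by positivity)).2 fun t => by
      have hγt : ‖γ.comp (timeScale t)‖ ≤ ‖γ‖ :=
        (ContinuousMap.norm_le _ (norm_nonneg γ)).2 fun u => γ.norm_coe_le_norm _
      calc ‖(t : ℝ) • unitIntegralCLM E (γ.comp (timeScale t))‖
          ≤ 1 * ‖unitIntegralCLM E (γ.comp (timeScale t))‖ := by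
            rw [norm_smul, Real.norm_of_nonneg t.2.1]
            exact mul_le_mul_of_nonneg_right t.2.2 (norm_nonneg _)
        _ ≤ ‖unitIntegralCLM E‖ * ‖γ‖ := by
            rw [one_mul]
            exact (unitIntegralCLM E).le_opNorm_of_le hγt

theorem isIntegralCurveWithSpeed_iff (Y : C(E, E)) {s : ℝ} {x : E} {γ : C(I, E)} :
    IsIntegralCurveWithSpeed Y s x γ ↔
      γ - s • primitiveCLM E (Y.comp γ) = ContinuousMap.const I x := by
  rw [sub_eq_iff_eq_add, ContinuousMap.ext_iff]
  refine forall_congr' fun t => ?_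
  rw [mul_smul]
  rfl

theorem isInvertible_fderiv_sub_smul {F : Type*} [NormedAddCommGroup F] [NormedSpace ℝ F]
    {N : F → F} {a : F} (hN : DifferentiableAt ℝ N a) :
    (fderiv ℝ (fun q : F × ℝ => (q.1 - q.2 • N q.1, q.2)) (a, 0)).IsInvertible := by
  have hN_fst : HasFDerivAt (fun q : F × ℝ => N q.1) _ (a, 0) :=
    HasFDerivAt.comp (g := N) (a, (0 : ℝ)) hN.hasFDerivAt hasFDerivAt_fst
  have hd : HasFDerivAt (fun q : F × ℝ => (q.1 - q.2 • N q.1, q.2)) _ (a, 0) :=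
    (hasFDerivAt_fst.sub (hasFDerivAt_snd.smul hN_fst)).prodMk hasFDerivAt_snd
  rw [hd.fderiv]
  refine .of_inverse (g := (ContinuousLinearMap.fst ℝ F ℝ +
    (ContinuousLinearMap.snd ℝ F ℝ).smulRight (N a)).prod (ContinuousLinearMap.snd ℝ F ℝ)) ?_ ?_ <;>
  ext <;> simp

theorem exists_smooth_integralCurveWithSpeed [CompleteSpace E] {Y : E → E} (hY : ContDiff ℝ ∞ Y)
    (x₀ : E) :
    ∃ Γ : E × ℝ → C(I, E), Γ (x₀, 0) = ContinuousMap.const I x₀ ∧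
      (∀ᶠ p in 𝓝 (x₀, (0 : ℝ)), ContDiffAt ℝ ∞ Γ p ∧ IsIntegralCurveWithSpeed Y p.2 p.1 (Γ p)) ∧
      ∀ᶠ q in 𝓝 ((x₀, (0 : ℝ)), ContinuousMap.const I x₀),
        IsIntegralCurveWithSpeed Y q.1.2 q.1.1 q.2 → q.2 = Γ q.1 := by
  let Y' : C(E, E) := ⟨Y, hY.continuous⟩
  let N : C(I, E) → C(I, E) := fun γ => primitiveCLM E (Y'.comp γ)
  have hN : ContDiff ℝ ∞ N := (primitiveCLM E).contDiff.comp (contDiff_postcomp hY)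
  let const : E →L[ℝ] C(I, E) :=
    ⟨{ toFun := ContinuousMap.const I, map_add' := fun _ _ => rfl, map_smul' := fun _ _ => rfl },
      ContinuousMap.continuous_const'⟩
  let G : C(I, E) × ℝ → C(I, E) × ℝ := fun q => (q.1 - q.2 • N q.1, q.2)
  have hG : ContDiff ℝ ∞ G :=
    (contDiff_fst.sub (contDiff_snd.smul (hN.comp contDiff_fst))).prodMk contDiff_snd
  have hGd : (fderiv ℝ G (const x₀, 0)).IsInvertible :=
    isInvertible_fderiv_sub_smul (hN.differentiable (by simp) _)
  obtain ⟨e, h_mem, heG, -, he_symm⟩ := exists_openPartialHomeomorph_of_isInvertible_fderiv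
    (.of_forall fun q => hG.contDiffAt (x := q)) hGd
  have hG₀ : G (const x₀, 0) = (const x₀, 0) := by simp [G]
  let ι : E × ℝ →L[ℝ] C(I, E) × ℝ := const.prodMap (.id ℝ ℝ)
  have hι : ∀ᶠ p in 𝓝 (x₀, (0 : ℝ)), ι p ∈ e.target :=
    ι.continuous.continuousAt.eventually
      (e.open_target.mem_nhds (by simpa [heG, hG₀, ι] using e.map_source h_mem))
  refine ⟨fun p => (e.symm (ι p)).1, ?_, ?_, ?_⟩
  · have := e.left_inv h_mem
    rw [heG, hG₀] at this
    exact congrArg Prod.fst this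
  · filter_upwards [hι] with p hp
    refine ⟨contDiffAt_fst.comp p ((he_symm _ hp).comp p ι.contDiff.contDiffAt), ?_⟩
    have hsol : G (e.symm (ι p)) = ι p := by rw [← heG, e.right_inv hp]
    have hspeed : (e.symm (ι p)).2 = p.2 := congrArg Prod.snd hsol
    rw [← hspeed]
    exact (isIntegralCurveWithSpeed_iff Y').2 (congrArg Prod.fst hsol)
  · have hcont : Continuous fun q : (E × ℝ) × C(I, E) => (q.2, q.1.2) := by fun_prop
    filter_upwards [hcont.continuousAt.eventually (e.open_source.mem_nhds h_mem)] with q hq hsol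
    have hGq : G (q.2, q.1.2) = ι q.1 :=
      Prod.ext ((isIntegralCurveWithSpeed_iff Y').1 hsol) rfl
    change q.2 = (e.symm (ι q.1)).1
    rw [← hGq, ← heG, e.left_inv hq]

theorem hasDerivAt_of_eq_add_integral [CompleteSpace E] {f g : ℝ → E} {x : E} {ε : ℝ}
    (hg : ContinuousOn g (Ioo (-ε) ε)) (hf : ∀ r ∈ Ioo (-ε) ε, f r = x + ∫ v in (0 : ℝ)..r, g v)
    {r : ℝ} (hr : r ∈ Ioo (-ε) ε) : HasDerivAt f (g r) r := by
  have h0 : (0 : ℝ) ∈ Ioo (-ε) ε := by constructor <;> linarith [hr.1, hr.2]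
  have hint : IntervalIntegrable g volume 0 r :=
    (hg.mono (ordConnected_Ioo.uIcc_subset h0 hr)).intervalIntegrable
  have hd := (intervalIntegral.integral_hasDerivAt_right hint
    (hg.stronglyMeasurableAtFilter isOpen_Ioo r hr)
    (hg.continuousAt (isOpen_Ioo.mem_nhds hr))).const_add x
  refine hd.congr_of_eventuallyEq ?_
  filter_upwards [isOpen_Ioo.mem_nhds hr] with r' hr' using hf r' hr'

-- Uniqueness makes the family homogeneous: the curve at speed `c * s` is a rescaling of the one
-- at speed `s`, so that its endpoint at speed `s` is the flow at time `s`.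
theorem exists_smooth_flow_integral_eq [CompleteSpace E] {Y : E → E} (hY : ContDiff ℝ ∞ Y)
    (x₀ : E) :
    ∃ Φ : E × ℝ → E, Φ (x₀, 0) = x₀ ∧ ∀ᶠ p in 𝓝 (x₀, (0 : ℝ)), ContDiffAt ℝ ∞ Φ p ∧
      Φ p = p.1 + ∫ v in (0 : ℝ)..p.2, Y (Φ (p.1, v)) := by
  obtain ⟨Γ, hΓ₀, hΓ, hunique⟩ := exists_smooth_integralCurveWithSpeed hY x₀
  have hscale : ∀ᶠ p in 𝓝 (x₀, (0 : ℝ)), ∀ c : I,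
      (Γ p).comp (timeScale c) = Γ (p.1, p.2 * c) := by
    obtain ⟨δ, hδ, hδ_unique⟩ := Metric.eventually_nhds_iff.1 hunique
    have hclose : ∀ᶠ p in 𝓝 (x₀, (0 : ℝ)), dist (Γ p) (ContinuousMap.const I x₀) < δ :=
      hΓ.self_of_nhds.1.continuousAt.eventually (by rw [hΓ₀]; exact Metric.ball_mem_nhds _ hδ)
    filter_upwards [hclose, hΓ, Metric.ball_mem_nhds _ hδ] with p hp hpΓ hpδ c
    refine hδ_unique (y := ((p.1, p.2 * c), (Γ p).comp (timeScale c))) ?_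
      (hpΓ.2.comp_timeScale c)
    rw [Metric.mem_ball, Prod.dist_eq, max_lt_iff, dist_zero_right] at hpδ
    rw [Prod.dist_eq, Prod.dist_eq, max_lt_iff, max_lt_iff, dist_zero_right, norm_mul,
      Real.norm_of_nonneg c.2.1]
    exact ⟨⟨hpδ.1, (mul_le_of_le_one_right (norm_nonneg _) c.2.2).trans_lt hpδ.2⟩,
      ((ContinuousMap.dist_le dist_nonneg).2 fun t =>
        ContinuousMap.dist_apply_le_dist (f := Γ p) (g := .const I x₀) (c * t)).trans_lt hp⟩
  let endpoint : C(I, E) →L[ℝ] E := ContinuousMap.evalCLM ℝ 1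
  refine ⟨fun p => endpoint (Γ p), congrArg endpoint hΓ₀, ?_⟩
  filter_upwards [hΓ, hscale] with p hp hp_scale
  refine ⟨endpoint.contDiff.contDiffAt.comp p hp.1, ?_⟩
  have hendpoint : ∀ u : I, Γ p (1 * u) = Γ (p.1, p.2 * u) 1 := fun u => by
    rw [← hp_scale u, mul_comm]
    rfl
  have hsol := hp.2 1
  simp only [hendpoint] at hsol
  rw [integral_unitInterval (fun u => Y (Γ (p.1, p.2 * u) 1)), Icc.coe_one, mul_one,
    intervalIntegral.smul_integral_comp_mul_left (fun v => Y (Γ (p.1, v) 1)), mul_zero,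
    mul_one] at hsol
  exact hsol

theorem exists_smooth_flow [CompleteSpace E] [HasContDiffBump E] {X : E → E} {x₀ : E}
    (hX : ∀ᶠ x in 𝓝 x₀, ContDiffAt ℝ ∞ X x) :
    ∃ Φ : E × ℝ → E, (∀ᶠ p in 𝓝 (x₀, (0 : ℝ)), ContDiffAt ℝ ∞ Φ p ∧
      HasDerivAt (fun s => Φ (p.1, s)) (X (Φ p)) p.2) ∧ ∀ᶠ x in 𝓝 x₀, Φ (x, 0) = x := by
  obtain ⟨Y, hY, hYX⟩ := exists_contDiff_eventuallyEq hX
  obtain ⟨Φ, hΦ₀, hΦ⟩ := exists_smooth_flow_integral_eq hY x₀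
  have hYX' : ∀ᶠ p in 𝓝 (x₀, (0 : ℝ)), Y (Φ p) = X (Φ p) :=
    hΦ.self_of_nhds.1.continuousAt.eventually (hΦ₀.symm ▸ hYX)
  obtain ⟨ε, hε, hΦ_ball⟩ := Metric.eventually_nhds_iff_ball.1 hΦ
  have hmem : ∀ x ∈ Metric.ball x₀ ε, ∀ r ∈ Ioo (-ε) ε, (x, r) ∈ Metric.ball (x₀, (0 : ℝ)) ε :=
    fun x hx r hr => by
      rw [← ball_prod_same, Real.ball_eq_Ioo, zero_sub, zero_add]
      exact ⟨hx, hr⟩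
  refine ⟨Φ, ?_, ?_⟩
  · filter_upwards [hΦ, hYX', Metric.ball_mem_nhds _ hε] with p hp hpX hp_ball
    rw [← ball_prod_same, Real.ball_eq_Ioo, zero_sub, zero_add] at hp_ball
    refine ⟨hp.1, hpX ▸ hasDerivAt_of_eq_add_integral (g := fun r => Y (Φ (p.1, r)))
      (fun r hr => ?_) (fun r hr => (hΦ_ball _ (hmem _ hp_ball.1 r hr)).2) hp_ball.2⟩
    have hcont := (hΦ_ball _ (hmem _ hp_ball.1 r hr)).1.continuousAt.comp
      (Continuous.prodMk_right p.1).continuousAt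
    exact (hY.continuous.continuousAt.comp hcont).continuousWithinAt
  · filter_upwards [Metric.ball_mem_nhds x₀ hε] with x hx
    simpa using (hΦ_ball _ (hmem x hx 0 ⟨by linarith, hε⟩)).2

end Flow

/-! ### Division by a function with a regular zero -/

section Hadamard

variable {F : Type*} [NormedAddCommGroup F] [NormedSpace ℝ F]
  {G : Type*} [NormedAddCommGroup G] [NormedSpace ℝ G] [CompleteSpace G]

theorem exists_contDiff_sub_eq_smul {c : F → G} (hc : ContDiff ℝ ∞ c) (L : F →L[ℝ] ℝ) (u : F) :
    ∃ g : F → G, ContDiff ℝ ∞ g ∧ ∀ y, c y - c (y - L y • u) = L y • g y := by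
  have hcd : ContDiff ℝ ∞ (fderiv ℝ c) := (contDiff_infty_iff_fderiv.1 hc).2
  let D : F × ℝ → G := fun q => fderiv ℝ c (q.1 - L q.1 • u + q.2 • L q.1 • u) u
  have hD : ContDiff ℝ ∞ D := by
    refine (hcd.comp ?_).clm_apply contDiff_const
    fun_prop
  refine ⟨fun y => ∫ t in (0 : ℝ)..1, D (y, t), contDiff_integral_unitInterval hD, fun y => ?_⟩
  have hline : ∀ t : ℝ, HasDerivAt (fun t : ℝ => c (y - L y • u + t • L y • u))
      (L y • D (y, t)) t := fun t => by
    have hd : HasDerivAt (fun t : ℝ => y - L y • u + t • L y • u) (L y • u) t := by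
      simpa using ((hasDerivAt_id t).smul_const (L y • u)).const_add (y - L y • u)
    have hcd_line := (hc.differentiable (by simp)
      (y - L y • u + t • L y • u)).hasFDerivAt.comp_hasDerivAt t hd
    rwa [map_smul] at hcd_line
  have hcont : Continuous fun t => L y • D (y, t) :=
    (hD.continuous.comp (Continuous.prodMk_right y)).const_smul _
  have := intervalIntegral.integral_eq_sub_of_hasDerivAt (a := 0) (b := 1) (fun t _ => hline t)
    (hcont.intervalIntegrable _ _)
  simpa using this.symm

variable [CompleteSpace F]

theorem exists_openPartialHomeomorph_fderiv_apply_eq {b : F → ℝ} {p : F}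
    (hb : ∀ᶠ x in 𝓝 p, ContDiffAt ℝ ∞ b x) (hp : b p = 0) {u : F} (hu : fderiv ℝ b p u = 1) :
    ∃ e : OpenPartialHomeomorph F F, p ∈ e.source ∧ e p = 0 ∧
      (∀ x ∈ e.source, fderiv ℝ b p (e x) = b x ∧ ContDiffAt ℝ ∞ e x) ∧
      ∀ y ∈ e.target, ContDiffAt ℝ ∞ e.symm y := by
  set L := fderiv ℝ b p with hL
  let Θ : F → F := fun x => (x - p) + (b x - L (x - p)) • u
  have hΘ : ∀ᶠ x in 𝓝 p, ContDiffAt ℝ ∞ Θ x := by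
    filter_upwards [hb] with x hx
    fun_prop
  have hdΘ : HasFDerivAt Θ (ContinuousLinearMap.id ℝ F) p := by
    have hsub : HasFDerivAt (fun x => x - p) (ContinuousLinearMap.id ℝ F) p :=
      (hasFDerivAt_id p).sub_const p
    have hbd := (hb.self_of_nhds.differentiableAt (by simp)).hasFDerivAt
    refine (hsub.add ((hbd.sub (L.hasFDerivAt.comp p hsub)).smul_const u)).congr_fderiv ?_
    ext v
    simp [hL]
  obtain ⟨e, hpe, heΘ, hsmooth, hsymm⟩ := exists_openPartialHomeomorph_of_isInvertible_fderiv hΘ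
    (by rw [hdΘ.fderiv]; exact ⟨ContinuousLinearEquiv.refl ℝ F, rfl⟩)
  refine ⟨e, hpe, by simp [heΘ, Θ, hp], fun x hx => ⟨by simp [heΘ, Θ, hu], ?_⟩, hsymm⟩
  exact (hsmooth x hx).1.congr_of_eventuallyEq (.of_forall heΘ)

-- Once `b` is straightened to the linear functional `L = fderiv ℝ b p`, the quotient is the average
-- of the derivative of `c` along the segments transverse to the zero set of `L`.
theorem exists_smooth_quotient [HasContDiffBump F] {b : F → ℝ} {c : F → G} {p : F}
    (hb : ∀ᶠ x in 𝓝 p, ContDiffAt ℝ ∞ b x) (hc : ∀ᶠ x in 𝓝 p, ContDiffAt ℝ ∞ c x)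
    (hp : b p = 0) (hdb : fderiv ℝ b p ≠ 0) (hbc : ∀ᶠ x in 𝓝 p, b x = 0 → c x = 0) :
    ∃ f : F → G, ∀ᶠ x in 𝓝 p, ContDiffAt ℝ ∞ f x ∧ c x = b x • f x := by
  obtain ⟨u, hu⟩ : ∃ u, fderiv ℝ b p u = 1 := by
    obtain ⟨w, hw⟩ := DFunLike.ne_iff.1 hdb
    exact ⟨(fderiv ℝ b p w)⁻¹ • w, by simpa using inv_mul_cancel₀ hw⟩
  obtain ⟨e, hpe, hep, he, hsymm⟩ := exists_openPartialHomeomorph_fderiv_apply_eq hb hp hu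
  set L := fderiv ℝ b p
  have h0 : (0 : F) ∈ e.target := hep ▸ e.map_source hpe
  have hsymm_tendsto : Tendsto e.symm (𝓝 0) (𝓝 p) := hep ▸ e.tendsto_symm hpe
  have he_tendsto : Tendsto e (𝓝 p) (𝓝 0) := hep ▸ (e.continuousAt hpe)
  obtain ⟨C, hC, hCc⟩ : ∃ C : F → G, ContDiff ℝ ∞ C ∧ C =ᶠ[𝓝 0] fun y => c (e.symm y) := by
    refine exists_contDiff_eventuallyEq ?_
    filter_upwards [hsymm_tendsto.eventually hc, e.open_target.mem_nhds h0] with y hy hy_mem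
    exact hy.comp y (hsymm y hy_mem)
  obtain ⟨g, hg, hCg⟩ := exists_contDiff_sub_eq_smul hC L u
  have hC_ker : ∀ᶠ y in 𝓝 (0 : F), C (y - L y • u) = 0 := by
    have hproj : Tendsto (fun y => y - L y • u) (𝓝 0) (𝓝 0) :=
      Continuous.tendsto' (by fun_prop) _ _ (by simp)
    filter_upwards [hproj.eventually hCc, hproj.eventually (hsymm_tendsto.eventually hbc),
      hproj.eventually (e.open_target.mem_nhds h0)] with y hyC hy_zero hy_mem
    refine hyC.trans (hy_zero ?_)
    rw [← (he _ (e.map_target hy_mem)).1, e.right_inv hy_mem]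
    simp [hu]
  refine ⟨fun x => g (e x), ?_⟩
  filter_upwards [he_tendsto.eventually hCc, he_tendsto.eventually hC_ker,
    e.open_source.mem_nhds hpe] with x hxC hx_ker hx
  refine ⟨hg.contDiffAt.comp x (he x hx).2, ?_⟩
  have := hCg (e x)
  rwa [hx_ker, sub_zero, (he x hx).1, hxC, e.left_inv hx] at this

end Hadamard

/-! ### Uniqueness of integral curves -/

theorem eqOn_Ioo_of_hasDerivAt {E : Type*} [NormedAddCommGroup E] [NormedSpace ℝ E]
    {X : E → E} {γ η : ℝ → E} {a b t₀ : ℝ} (hX : ∀ s ∈ Ioo a b, ContDiffAt ℝ 1 X (γ s))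
    (hγ : ∀ s ∈ Ioo a b, HasDerivAt γ (X (γ s)) s)
    (hη : ∀ s ∈ Ioo a b, HasDerivAt η (X (η s)) s) (ht₀ : t₀ ∈ Ioo a b) (h₀ : γ t₀ = η t₀) :
    EqOn γ η (Ioo a b) := by
  let A : Set ℝ := {s | γ =ᶠ[𝓝 s] η}
  have hA_open : IsOpen A := isOpen_iff_mem_nhds.2 fun s hs => hs.eventuallyEq_nhds
  have hA_of_eq : ∀ s ∈ Ioo a b, γ s = η s → s ∈ A := by
    intro s hs heq
    obtain ⟨K, V, hV, hK⟩ := (hX s hs).exists_lipschitzOnWith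
    refine ODE_solution_unique_of_eventually (v := fun _ => X) (s := fun _ => V) (K := K)
      (.of_forall fun _ => hK) ?_ ?_ heq
    · filter_upwards [Ioo_mem_nhds hs.1 hs.2, (hγ s hs).continuousAt.eventually_mem hV]
        with t ht htV using ⟨hγ t ht, htV⟩
    · filter_upwards [Ioo_mem_nhds hs.1 hs.2, (hη s hs).continuousAt.eventually_mem (heq ▸ hV)]
        with t ht htV using ⟨hη t ht, htV⟩
  have hsub : Ioo a b ⊆ A := by
    refine isPreconnected_Ioo.subset_of_closure_inter_subset hA_open
      ⟨t₀, ht₀, hA_of_eq t₀ ht₀ h₀⟩ ?_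
    rintro t ⟨htA, ht⟩
    refine hA_of_eq t ht (by_contra fun hne => ?_)
    have hne_near : ∀ᶠ r in 𝓝 t, γ r ≠ η r :=
      (hγ t ht).continuousAt.ne_iff_eventually_ne (hη t ht).continuousAt |>.1 hne
    obtain ⟨r, hr, hrA⟩ := mem_closure_iff_nhds.1 htA _ hne_near
    exact hr hrA.self_of_nhds
  exact fun s hs => (hsub hs).self_of_nhds

/-! ### Contact Hamiltonian vector fields -/

section ContactAlgebra

variable {E : Type*} [NormedAddCommGroup E] [NormedSpace ℝ E]

/-- The exterior derivative of a `1`-form on a normed space, as a function of two vectors; this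
avoids the passage through alternating maps of `extDeriv`. -/
noncomputable def dOne (a : E → E →L[ℝ] ℝ) (x u v : E) : ℝ :=
  fderiv ℝ a x u v - fderiv ℝ a x v u

/-- The `1`-form `a` on a normed space is smooth near `x` and is a contact form at `x`. -/
structure IsContactAt (a : E → E →L[ℝ] ℝ) (x : E) : Prop where
  smooth : ∀ᶠ y in 𝓝 x, ContDiffAt ℝ ∞ a y
  ne_zero : a x ≠ 0
  nondegenerate : ∀ u, a x u = 0 → (∀ v, a x v = 0 → dOne a x u v = 0) → u = 0

theorem IsContactAt.contDiffAt {a : E → E →L[ℝ] ℝ} {x : E} (h : IsContactAt a x) :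
    ContDiffAt ℝ ∞ a x := h.smooth.self_of_nhds

/-- The linear map `(X, ρ) ↦ (ι_X da - ρ a, a X)` at the point `x`. It is invertible where `a` is a
contact form, and its inverse produces the contact Hamiltonian vector fields. -/
noncomputable def contactMap (a : E → E →L[ℝ] ℝ) (x : E) : E × ℝ →L[ℝ] (E →L[ℝ] ℝ) × ℝ :=
  ((fderiv ℝ a x - (fderiv ℝ a x).flip) ∘L .fst ℝ E ℝ -
    (ContinuousLinearMap.snd ℝ E ℝ).smulRight (a x)).prod (a x ∘L .fst ℝ E ℝ)

theorem contactMap_fst_apply (a : E → E →L[ℝ] ℝ) (x : E) (z : E × ℝ) (v : E) :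
    (contactMap a x z).1 v = dOne a x z.1 v - z.2 * a x v := rfl

theorem contactMap_snd (a : E → E →L[ℝ] ℝ) (x : E) (z : E × ℝ) :
    (contactMap a x z).2 = a x z.1 := rfl

theorem IsContactAt.contactMap_injective {a : E → E →L[ℝ] ℝ} {x : E} (h : IsContactAt a x) :
    Function.Injective (contactMap a x) := by
  refine (injective_iff_map_eq_zero _).2 fun z hz => ?_
  have ha : a x z.1 = 0 := by rw [← contactMap_snd, hz, Prod.snd_zero]
  have hda : ∀ v, dOne a x z.1 v = z.2 * a x v := fun v => by
    rw [← sub_eq_zero, ← contactMap_fst_apply, hz, Prod.fst_zero, zero_apply]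
  have hfst : z.1 = 0 := h.nondegenerate z.1 ha fun v hv => by rw [hda, hv, mul_zero]
  obtain ⟨v, hv⟩ := DFunLike.ne_iff.1 h.ne_zero
  have hsnd : z.2 * a x v = 0 := by rw [← hda, hfst]; simp [dOne]
  exact Prod.ext hfst ((mul_eq_zero.1 hsnd).resolve_right hv)

set_option synthInstance.maxHeartbeats 200000 in
-- Instance search on nested spaces of continuous linear maps is slow.
theorem contDiff_flip {𝕜 E G K : Type*} [NontriviallyNormedField 𝕜]
    [NormedAddCommGroup E] [NormedSpace 𝕜 E] [NormedAddCommGroup G] [NormedSpace 𝕜 G]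
    [NormedAddCommGroup K] [NormedSpace 𝕜 K] {n : WithTop ℕ∞} :
    ContDiff 𝕜 n (fun L : E →L[𝕜] G →L[𝕜] K => L.flip) :=
  LinearIsometryEquiv.contDiff (𝕜 := 𝕜) (E := E →L[𝕜] G →L[𝕜] K) (F := G →L[𝕜] E →L[𝕜] K)
    (ContinuousLinearMap.flipₗᵢ 𝕜 E G K)

theorem contDiffAt_clm_prod {𝕜 Y E G K : Type*} [NontriviallyNormedField 𝕜]
    [NormedAddCommGroup Y] [NormedSpace 𝕜 Y] [NormedAddCommGroup E] [NormedSpace 𝕜 E]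
    [NormedAddCommGroup G] [NormedSpace 𝕜 G] [NormedAddCommGroup K] [NormedSpace 𝕜 K]
    {n : WithTop ℕ∞} {f : Y → E →L[𝕜] G} {g : Y → E →L[𝕜] K} {y : Y}
    (hf : ContDiffAt 𝕜 n f y) (hg : ContDiffAt 𝕜 n g y) :
    ContDiffAt 𝕜 n (fun y => (f y).prod (g y)) y := by
  have hprod : (fun y => (f y).prod (g y)) =
      fun y => .inl 𝕜 G K ∘L f y + .inr 𝕜 G K ∘L g y := by
    funext y; ext v <;> simp
  rw [hprod]
  exact (contDiffAt_const.clm_comp hf).add (contDiffAt_const.clm_comp hg)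

theorem contDiffAt_contactMap {a : E → E →L[ℝ] ℝ} {x : E} (h : ContDiffAt ℝ ∞ a x) :
    ContDiffAt ℝ ∞ (contactMap a) x := by
  have hd : ContDiffAt ℝ ∞ (fderiv ℝ a) x := h.fderiv_right (by simp)
  have hd_flip : ContDiffAt ℝ ∞ (fun x => (fderiv ℝ a x).flip) x :=
    ContDiffAt.comp (g := fun L : E →L[ℝ] E →L[ℝ] ℝ => L.flip) x contDiff_flip.contDiffAt hd
  exact contDiffAt_clm_prod (((hd.sub hd_flip).clm_comp contDiffAt_const).sub
    (contDiffAt_const.smulRight h)) (h.clm_comp contDiffAt_const)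

variable [FiniteDimensional ℝ E]

theorem IsContactAt.isInvertible {a : E → E →L[ℝ] ℝ} {x : E} (h : IsContactAt a x) :
    (contactMap a x).IsInvertible := by
  refine isInvertible_of_injective ?_ h.contactMap_injective
  have : Module.finrank ℝ (E →L[ℝ] ℝ) = Module.finrank ℝ E := by
    rw [← (LinearMap.toContinuousLinearMap (𝕜 := ℝ) (E := E) (F' := ℝ)).finrank_eq]
    exact Subspace.dual_finrank_eq
  simp [this]

/-- The contact Hamiltonian vector field `X` of the function `H`, together with its conformal
factor `ρ`: `a X = H` and `ι_X da + dH = ρ a`. -/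
noncomputable def hamPair (a : E → E →L[ℝ] ℝ) (H : E → ℝ) (x : E) : E × ℝ :=
  (contactMap a x).inverse (-fderiv ℝ H x, H x)

namespace IsContactAt

variable {a : E → E →L[ℝ] ℝ} {x : E} {H : E → ℝ}

theorem contactMap_hamPair (h : IsContactAt a x) (H : E → ℝ) :
    contactMap a x (hamPair a H x) = (-fderiv ℝ H x, H x) :=
  h.isInvertible.self_apply_inverse _

theorem eq_hamPair (h : IsContactAt a x) {Z : E} {ρ : ℝ} (hZ : a x Z = H x)
    (hdZ : ∀ v, dOne a x Z v + fderiv ℝ H x v = ρ * a x v) : hamPair a H x = (Z, ρ) := by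
  refine h.contactMap_injective ?_
  rw [h.contactMap_hamPair]
  refine Prod.ext (ContinuousLinearMap.ext fun v => ?_) hZ.symm
  rw [contactMap_fst_apply, neg_apply]
  linarith [hdZ v]

theorem apply_hamPair (h : IsContactAt a x) (H : E → ℝ) : a x (hamPair a H x).1 = H x := by
  rw [← contactMap_snd, h.contactMap_hamPair]

theorem dOne_hamPair (h : IsContactAt a x) (H : E → ℝ) (v : E) :
    dOne a x (hamPair a H x).1 v + fderiv ℝ H x v = (hamPair a H x).2 * a x v := by
  have := contactMap_fst_apply a x (hamPair a H x) v
  rw [h.contactMap_hamPair, neg_apply] at this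
  linarith

theorem contDiffAt_hamPair (h : IsContactAt a x) (hH : ContDiffAt ℝ ∞ H x) :
    ContDiffAt ℝ ∞ (hamPair a H) x := by
  have := FiniteDimensional.complete ℝ E
  obtain ⟨e, he⟩ := h.isInvertible
  have hinv : ContDiffAt ℝ ∞ (fun x => (contactMap a x).inverse) x := by
    have := contDiffAt_map_inverse (𝕜 := ℝ) (n := ∞) e
    rw [he] at this
    exact this.comp x (contDiffAt_contactMap h.contDiffAt)
  exact hinv.clm_apply ((hH.fderiv_right (by simp)).neg.prodMk hH)

theorem lieDerivative_hamPair (h : ∀ᶠ y in 𝓝 x, IsContactAt a y) (hH : ContDiffAt ℝ ∞ H x)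
    (w : E) :
    fderiv ℝ a x (hamPair a H x).1 w + a x (fderiv ℝ (fun y => (hamPair a H y).1) x w) =
      (hamPair a H x).2 * a x w := by
  have h0 : (∞ : WithTop ℕ∞) ≠ 0 := by simp
  have hx := h.self_of_nhds
  have ha_ham : (fun y => a y (hamPair a H y).1) =ᶠ[𝓝 x] H := by
    filter_upwards [h] with y hy using hy.apply_hamPair H
  have ha := (hx.contDiffAt.differentiableAt h0).hasFDerivAt
  have hX : DifferentiableAt ℝ (fun y => (hamPair a H y).1) x :=
    (hx.contDiffAt_hamPair hH).fst.differentiableAt h0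
  have hdH : fderiv ℝ H x w =
      a x (fderiv ℝ (fun y => (hamPair a H y).1) x w) + fderiv ℝ a x w (hamPair a H x).1 := by
    rw [← ha_ham.fderiv_eq, (ha.clm_apply hX.hasFDerivAt).fderiv]
    rfl
  have hdOne := hx.dOne_hamPair H w
  rw [dOne] at hdOne
  linarith

end IsContactAt

end ContactAlgebra

theorem eq_zero_iff_of_hasDerivAt_mul {q m : ℝ → ℝ} {ε : ℝ} (hm : ContinuousOn m (Ioo (-ε) ε))
    (hq : ∀ s ∈ Ioo (-ε) ε, HasDerivAt q (m s * q s) s) {s : ℝ} (hs : s ∈ Ioo (-ε) ε) :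
    q s = 0 ↔ q 0 = 0 := by
  have h0 : (0 : ℝ) ∈ Ioo (-ε) ε := by constructor <;> linarith [hs.1, hs.2]
  let P : ℝ → ℝ := fun s => ∫ u in (0 : ℝ)..s, m u
  have hP : ∀ s ∈ Ioo (-ε) ε, HasDerivAt P (m s) s := fun s hs =>
    hasDerivAt_of_eq_add_integral (x := 0) hm (fun r _ => (zero_add _).symm) hs
  have hd : ∀ s ∈ Ioo (-ε) ε, HasDerivAt (fun s => q s * Real.exp (-P s)) 0 s := fun s hs => by
    refine ((hq s hs).mul (hP s hs).neg.exp).congr_deriv ?_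
    simp only [Pi.neg_apply]
    ring
  have hconst : q s * Real.exp (-P s) = q 0 * Real.exp (-P 0) :=
    isOpen_Ioo.is_const_of_deriv_eq_zero isPreconnected_Ioo
      (fun s hs => (hd s hs).differentiableAt.differentiableWithinAt)
      (fun s hs => (hd s hs).deriv) hs h0
  rw [show P 0 = 0 from intervalIntegral.integral_same, neg_zero, Real.exp_zero, mul_one] at hconst
  rw [← hconst, mul_eq_zero_iff_right (Real.exp_ne_zero _)]

section FlowPreservesKernel

theorem exists_eventually_forall_Ioo {T : Type*} [PseudoMetricSpace T] {P : T × ℝ → Prop}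
    {p : T} (h : ∀ᶠ z in 𝓝 (p, (0 : ℝ)), P z) :
    ∃ δ > 0, ∀ᶠ z in 𝓝 (p, (0 : ℝ)), z.2 ∈ Ioo (-δ) δ ∧ ∀ r ∈ Ioo (-δ) δ, P (z.1, r) := by
  obtain ⟨δ, hδ, hball⟩ := Metric.eventually_nhds_iff_ball.1 h
  refine ⟨δ, hδ, ?_⟩
  rw [← ball_prod_same, Real.ball_eq_Ioo, zero_sub, zero_add] at hball
  filter_upwards [prod_mem_nhds (Metric.ball_mem_nhds p hδ) (Ioo_mem_nhds (neg_lt_zero.2 hδ) hδ)]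
    with z hz
  exact ⟨hz.2, fun r hr => hball _ ⟨hz.1, hr⟩⟩

variable {E F : Type*} [NormedAddCommGroup E] [NormedSpace ℝ E]
  [NormedAddCommGroup F] [NormedSpace ℝ F]

theorem minSmoothness_two_le_infty : minSmoothness ℝ 2 ≤ (∞ : WithTop ℕ∞) := by
  rw [minSmoothness_of_isRCLikeNormedField]
  exact WithTop.coe_le_coe.2 (le_top : (2 : ℕ∞) ≤ ⊤)

theorem fderiv_apply_zero_one_of_hasDerivAt {Φ : F × ℝ → E} {V : E} {z : F × ℝ}
    (hΦ : DifferentiableAt ℝ Φ z) (hV : HasDerivAt (fun s => Φ (z.1, s)) V z.2) :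
    fderiv ℝ Φ z (0, 1) = V :=
  (hΦ.hasFDerivAt.comp_hasDerivAt z.2
    ((hasDerivAt_const z.2 z.1).prodMk (hasDerivAt_id z.2))).unique hV

theorem hasDerivAt_fderiv_flow_apply {X : E → E} {Φ : F × ℝ → E} {y : F} {r : ℝ}
    (hΦ : ∀ᶠ z in 𝓝 (y, r), ContDiffAt ℝ ∞ Φ z ∧ HasDerivAt (fun s => Φ (z.1, s)) (X (Φ z)) z.2)
    (hX : DifferentiableAt ℝ X (Φ (y, r))) (w : F × ℝ) :
    HasDerivAt (fun r => fderiv ℝ Φ (y, r) w)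
      (fderiv ℝ X (Φ (y, r)) (fderiv ℝ Φ (y, r) w)) r := by
  have h0 : (∞ : WithTop ℕ∞) ≠ 0 := by simp
  have hsmooth := hΦ.self_of_nhds.1
  have hdd : HasFDerivAt (fderiv ℝ Φ) (fderiv ℝ (fderiv ℝ Φ) (y, r)) (y, r) :=
    ((hsmooth.fderiv_right (m := ∞) (by simp)).differentiableAt h0).hasFDerivAt
  have htime : (fun z => fderiv ℝ Φ z (0, 1)) =ᶠ[𝓝 (y, r)] fun z => X (Φ z) := by
    filter_upwards [hΦ] with z hz
    exact fderiv_apply_zero_one_of_hasDerivAt (hz.1.differentiableAt h0) hz.2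
  have hmixed : fderiv ℝ (fderiv ℝ Φ) (y, r) w (0, 1) =
      fderiv ℝ X (Φ (y, r)) (fderiv ℝ Φ (y, r) w) := by
    have h := htime.fderiv_eq (𝕜 := ℝ)
    rw [(hdd.clm_apply (hasFDerivAt_const ((0 : F), (1 : ℝ)) (y, r))).fderiv,
      fderiv_fun_comp _ hX (hsmooth.differentiableAt h0)] at h
    simpa using DFunLike.congr_fun h w
  have hline : HasDerivAt (fun r : ℝ => (y, r)) ((0 : F), (1 : ℝ)) r :=
    (hasDerivAt_const r y).prodMk (hasDerivAt_id r)
  have hsymm := (hsmooth.isSymmSndFDerivAt minSmoothness_two_le_infty).eq (0, 1) w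
  simpa [hsymm, hmixed] using (hdd.comp_hasDerivAt r hline).clm_apply (hasDerivAt_const r w)

variable [FiniteDimensional ℝ E]

theorem hasDerivAt_apply_fderiv_hamiltonianFlow {a : E → E →L[ℝ] ℝ} {H : E → ℝ} {Φ : F × ℝ → E}
    {y : F} {r : ℝ} (ha : ∀ᶠ x in 𝓝 (Φ (y, r)), IsContactAt a x)
    (hH : ContDiffAt ℝ ∞ H (Φ (y, r)))
    (hΦ : ∀ᶠ z in 𝓝 (y, r), ContDiffAt ℝ ∞ Φ z ∧
      HasDerivAt (fun s => Φ (z.1, s)) (hamPair a H (Φ z)).1 z.2) (w : F × ℝ) :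
    HasDerivAt (fun r => a (Φ (y, r)) (fderiv ℝ Φ (y, r) w))
      ((hamPair a H (Φ (y, r))).2 * a (Φ (y, r)) (fderiv ℝ Φ (y, r) w)) r := by
  have h0 : (∞ : WithTop ℕ∞) ≠ 0 := by simp
  have hx := ha.self_of_nhds
  have hderiv_a : HasDerivAt (fun r => a (Φ (y, r)))
      (fderiv ℝ a (Φ (y, r)) (hamPair a H (Φ (y, r))).1) r :=
    (hx.contDiffAt.differentiableAt h0).hasFDerivAt.comp_hasDerivAt r hΦ.self_of_nhds.2
  have hderiv_w := hasDerivAt_fderiv_flow_apply (X := fun z => (hamPair a H z).1) hΦ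
    ((hx.contDiffAt_hamPair hH).fst.differentiableAt h0) w
  exact (hderiv_a.clm_apply hderiv_w).congr_deriv (IsContactAt.lieDerivative_hamPair ha hH _)

theorem apply_fderiv_hamiltonianFlow_eq_zero_iff {a : E → E →L[ℝ] ℝ} {H : E → ℝ}
    {Φ : F × ℝ → E} {p : F}
    (ha : ∀ᶠ x in 𝓝 (Φ (p, 0)), IsContactAt a x)
    (hH : ∀ᶠ x in 𝓝 (Φ (p, 0)), ContDiffAt ℝ ∞ H x)
    (hΦ : ∀ᶠ z in 𝓝 (p, (0 : ℝ)), ContDiffAt ℝ ∞ Φ z ∧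
      HasDerivAt (fun s => Φ (z.1, s)) (hamPair a H (Φ z)).1 z.2) :
    ∀ᶠ z in 𝓝 (p, (0 : ℝ)), ∀ w, a (Φ z) (fderiv ℝ Φ z w) = 0 ↔
      a (Φ (z.1, 0)) (fderiv ℝ Φ (z.1, 0) w) = 0 := by
  have hcont : ContinuousAt Φ (p, 0) := hΦ.self_of_nhds.1.continuousAt
  obtain ⟨δ, -, hnear⟩ := exists_eventually_forall_Ioo (hΦ.eventually_nhds.and
    ((hcont.eventually ha.eventually_nhds).and (hcont.eventually hH)))
  filter_upwards [hnear]
  rintro ⟨y, s⟩ ⟨hs, hy⟩ w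
  refine eq_zero_iff_of_hasDerivAt_mul (q := fun r => a (Φ (y, r)) (fderiv ℝ Φ (y, r) w))
    (m := fun r => (hamPair a H (Φ (y, r))).2) (fun r hr => ?_) (fun r hr => ?_) hs
  all_goals obtain ⟨hΦr, har, hHr⟩ := hy r hr
  · have hρ : ContinuousAt (fun x => (hamPair a H x).2) (Φ (y, r)) :=
      (har.self_of_nhds.contDiffAt_hamPair hHr).continuousAt.snd
    exact (ContinuousAt.comp (f := fun r => Φ (y, r)) hρ
      hΦr.self_of_nhds.2.continuousAt).continuousWithinAt
  · exact hasDerivAt_apply_fderiv_hamiltonianFlow har hHr hΦr w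

end FlowPreservesKernel

section Pullback

variable {E G : Type*} [NormedAddCommGroup E] [NormedSpace ℝ E]
  [NormedAddCommGroup G] [NormedSpace ℝ G]

theorem dOne_sub_left (a : E → E →L[ℝ] ℝ) (x u u' v : E) :
    dOne a x (u - u') v = dOne a x u v - dOne a x u' v := by
  simp only [dOne, map_sub, sub_apply]
  ring

theorem dOne_add_smul_self (a : E → E →L[ℝ] ℝ) (x u v : E) (s : ℝ) :
    dOne a x u (v + s • u) = dOne a x u v := by
  simp only [dOne, map_add, map_smul, add_apply, smul_apply]
  ring

theorem dOne_congr {b c : E → E →L[ℝ] ℝ} {x : E} (h : b =ᶠ[𝓝 x] c) : dOne b x = dOne c x := by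
  funext u v
  simp only [dOne, h.fderiv_eq]

theorem dOne_smul {b : E → E →L[ℝ] ℝ} {g : E → ℝ} {x : E}
    (hb : DifferentiableAt ℝ b x) (hg : DifferentiableAt ℝ g x) (u v : E) :
    dOne (fun y => g y • b y) x u v =
      fderiv ℝ g x u * b x v - fderiv ℝ g x v * b x u + g x * dOne b x u v := by
  simp only [dOne, fderiv_fun_smul hg hb, add_apply, smul_apply,
    ContinuousLinearMap.smulRight_apply, smul_eq_mul]
  ring

theorem dOne_pullback {a : E → E →L[ℝ] ℝ} {f : G → E} {x : G}
    (ha : DifferentiableAt ℝ a (f x)) (hf : ContDiffAt ℝ ∞ f x) (u v : G) :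
    dOne (fun y => a (f y) ∘L fderiv ℝ f y) x u v =
      dOne a (f x) (fderiv ℝ f x u) (fderiv ℝ f x v) := by
  have h0 : (∞ : WithTop ℕ∞) ≠ 0 := by simp
  have hdf : ContDiffAt ℝ ∞ (fderiv ℝ f) x := hf.fderiv_right (by simp)
  have hderiv := ((ha.hasFDerivAt.comp x (hf.differentiableAt h0).hasFDerivAt).clm_comp
    (hdf.differentiableAt h0).hasFDerivAt).fderiv
  have hsymm := (hf.isSymmSndFDerivAt minSmoothness_two_le_infty).eq u v
  simp only [Function.comp_def] at hderiv
  rw [dOne, hderiv]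
  simp [dOne, hsymm]

theorem dOne_apply_fderiv_of_pullback_eq_smul {a : E → E →L[ℝ] ℝ} {b : G → G →L[ℝ] ℝ}
    {Ψ : G → E} {g : G → ℝ} {y : G} (ha : DifferentiableAt ℝ a (Ψ y)) (hΨ : ContDiffAt ℝ ∞ Ψ y)
    (hb : DifferentiableAt ℝ b y) (hg : DifferentiableAt ℝ g y)
    (hab : ∀ᶠ z in 𝓝 y, a (Ψ z) ∘L fderiv ℝ Ψ z = g z • b z) (u v : G) :
    dOne a (Ψ y) (fderiv ℝ Ψ y u) (fderiv ℝ Ψ y v) =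
      fderiv ℝ g y u * b y v - fderiv ℝ g y v * b y u + g y * dOne b y u v := by
  rw [← dOne_pullback ha hΨ, dOne_congr hab, dOne_smul hb hg]

theorem fderiv_apply_fderiv_of_comp_eq_mul {H : E → ℝ} {K : G → ℝ} {Ψ : G → E} {g : G → ℝ} {y : G}
    (hH : DifferentiableAt ℝ H (Ψ y)) (hΨ : DifferentiableAt ℝ Ψ y) (hK : DifferentiableAt ℝ K y)
    (hg : DifferentiableAt ℝ g y) (hHK : ∀ᶠ z in 𝓝 y, H (Ψ z) = g z * K z) (v : G) :
    fderiv ℝ H (Ψ y) (fderiv ℝ Ψ y v) = g y * fderiv ℝ K y v + K y * fderiv ℝ g y v := by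
  have h : fderiv ℝ (H ∘ Ψ) y = fderiv ℝ (fun z => g z * K z) y := EventuallyEq.fderiv_eq hHK
  rw [fderiv_comp y hH hΨ, fderiv_fun_mul hg hK] at h
  exact DFunLike.congr_fun h v

theorem injective_add_smul {𝕜 V W : Type*} [Field 𝕜] [AddCommGroup V] [Module 𝕜 V]
    [AddCommGroup W] [Module 𝕜 W] {L : V →ₗ[𝕜] W} (hL : Function.Injective L) {Z : W}
    (hZ : Z ∉ range L) : Function.Injective fun w : V × 𝕜 => L w.1 + w.2 • Z := by
  rintro ⟨v, s⟩ ⟨w, t⟩ h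
  simp only at h
  have hdiff : (s - t) • Z = L (w - v) := by
    rw [sub_smul, map_sub, sub_eq_sub_iff_add_eq_add, add_comm, h, add_comm]
  obtain rfl : s = t := by
    by_contra hne
    refine hZ ⟨(s - t)⁻¹ • (w - v), ?_⟩
    rw [map_smul, ← hdiff, smul_smul, inv_mul_cancel₀ (sub_ne_zero.2 hne), one_smul]
  rw [Prod.mk.injEq]
  exact ⟨hL (add_right_cancel h), rfl⟩

theorem exists_eq_add_smul {𝕜 V W : Type*} [Field 𝕜] [AddCommGroup V] [Module 𝕜 V]
    [AddCommGroup W] [Module 𝕜 W] [FiniteDimensional 𝕜 V] [FiniteDimensional 𝕜 W]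
    (hdim : Module.finrank 𝕜 W = Module.finrank 𝕜 V + 1)
    {L : V →ₗ[𝕜] W} (hL : Function.Injective L) {Z : W} (hZ : Z ∉ range L) (U : W) :
    ∃ v, ∃ s : 𝕜, U = L v + s • Z := by
  let A : V × 𝕜 →ₗ[𝕜] W := L.coprod (LinearMap.toSpanSingleton 𝕜 W Z)
  have hA : Function.Injective A := injective_add_smul hL hZ
  have hA_surj : Function.Surjective A :=
    (LinearMap.injective_iff_surjective_of_finrank_eq_finrank (by simp [hdim])).1 hA
  obtain ⟨⟨v, s⟩, h⟩ := hA_surj U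
  exact ⟨v, s, h.symm⟩

variable [FiniteDimensional ℝ E]

theorem fderiv_hamPair_eq [FiniteDimensional ℝ G] {a : E → E →L[ℝ] ℝ} {b : G → G →L[ℝ] ℝ}
    {H : E → ℝ} {K : G → ℝ} {Ψ : G → E} {g : G → ℝ} {y : G}
    (hb : IsContactAt b y) (ha : IsContactAt a (Ψ y))
    (hΨ : ContDiffAt ℝ ∞ Ψ y) (hsurj : Function.Surjective (fderiv ℝ Ψ y))
    (hg : DifferentiableAt ℝ g y) (hg0 : g y ≠ 0)
    (hK : DifferentiableAt ℝ K y) (hH : DifferentiableAt ℝ H (Ψ y))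
    (hab : ∀ᶠ z in 𝓝 y, a (Ψ z) ∘L fderiv ℝ Ψ z = g z • b z)
    (hHK : ∀ᶠ z in 𝓝 y, H (Ψ z) = g z * K z) :
    fderiv ℝ Ψ y (hamPair b K y).1 = (hamPair a H (Ψ y)).1 := by
  have h0 : (∞ : WithTop ℕ∞) ≠ 0 := by simp
  have hap : ∀ v, a (Ψ y) (fderiv ℝ Ψ y v) = g y * b y v :=
    DFunLike.congr_fun hab.self_of_nhds
  refine (congrArg Prod.fst (ha.eq_hamPair
    (ρ := fderiv ℝ g y (hamPair b K y).1 / g y + (hamPair b K y).2) ?_ ?_)).symm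
  · rw [hap, hb.apply_hamPair, hHK.self_of_nhds]
  · intro V
    obtain ⟨v, rfl⟩ := hsurj V
    rw [dOne_apply_fderiv_of_pullback_eq_smul (ha.contDiffAt.differentiableAt h0) hΨ
        (hb.contDiffAt.differentiableAt h0) hg hab, hb.apply_hamPair,
      fderiv_apply_fderiv_of_comp_eq_mul hH (hΨ.differentiableAt h0) hK hg hHK, hap]
    field_simp
    linear_combination g y * hb.dOne_hamPair K v

theorem exists_dOne_add_fderiv_eq_of_fderiv_apply_eq_hamPair {a : E → E →L[ℝ] ℝ}
    {b : G → G →L[ℝ] ℝ} {H : E → ℝ} {K : G → ℝ} {Ψ : G → E} {g : G → ℝ} {y w : G}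
    (ha : IsContactAt a (Ψ y)) (hb : DifferentiableAt ℝ b y) (hΨ : ContDiffAt ℝ ∞ Ψ y)
    (hg : DifferentiableAt ℝ g y) (hg0 : g y ≠ 0)
    (hK : DifferentiableAt ℝ K y) (hH : DifferentiableAt ℝ H (Ψ y))
    (hab : ∀ᶠ z in 𝓝 y, a (Ψ z) ∘L fderiv ℝ Ψ z = g z • b z)
    (hHK : ∀ᶠ z in 𝓝 y, H (Ψ z) = g z * K z)
    (hw : fderiv ℝ Ψ y w = (hamPair a H (Ψ y)).1) :
    b y w = K y ∧ ∃ ρ : ℝ, ∀ v, dOne b y w v + fderiv ℝ K y v = ρ * b y v := by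
  have h0 : (∞ : WithTop ℕ∞) ≠ 0 := by simp
  have hap : ∀ v, a (Ψ y) (fderiv ℝ Ψ y v) = g y * b y v :=
    DFunLike.congr_fun hab.self_of_nhds
  have hbw : b y w = K y := by
    have h := ha.apply_hamPair H
    rw [← hw, hap, hHK.self_of_nhds] at h
    exact mul_left_cancel₀ hg0 h
  refine ⟨hbw, (hamPair a H (Ψ y)).2 - fderiv ℝ g y w / g y, fun v => ?_⟩
  have h := ha.dOne_hamPair H (fderiv ℝ Ψ y v)
  rw [← hw, hap, dOne_apply_fderiv_of_pullback_eq_smul (ha.contDiffAt.differentiableAt h0) hΨ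
      hb hg hab, fderiv_apply_fderiv_of_comp_eq_mul hH (hΨ.differentiableAt h0) hK hg hHK, hbw] at h
  field_simp
  linear_combination h

theorem hamPair_mem_range_of_dOne_add_fderiv_eq [FiniteDimensional ℝ G]
    (hdim : Module.finrank ℝ E = Module.finrank ℝ G + 1)
    {a : E → E →L[ℝ] ℝ} {H : E → ℝ} {x : E} {L : G →L[ℝ] E} (hL : Function.Injective L)
    (ha : IsContactAt a x) {w : G} {ρ : ℝ} (hw : a x (L w) = H x)
    (hdw : ∀ v, dOne a x (L w) (L v) + fderiv ℝ H x (L v) = ρ * a x (L v)) :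
    (hamPair a H x).1 ∈ range L := by
  by_contra hnot
  set Z := (hamPair a H x).1 - L w with hZ
  have hZ_range : Z ∉ range L := by
    rintro ⟨v, hv⟩
    exact hnot ⟨v + w, by rw [map_add, hv, hZ, sub_add_cancel]⟩
  have haZ : a x Z = 0 := by rw [hZ, map_sub, hw, ha.apply_hamPair, sub_self]
  refine hZ_range ⟨0, (map_zero L).trans (ha.nondegenerate Z haZ fun V hV => ?_).symm⟩
  obtain ⟨v, s, rfl⟩ := exists_eq_add_smul hdim (L := (L : G →ₗ[ℝ] E)) hL hZ_range V
  simp only [ContinuousLinearMap.coe_coe] at hV ⊢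
  rw [map_add, map_smul, haZ, smul_zero, add_zero] at hV
  rw [dOne_add_smul_self, hZ, dOne_sub_left]
  linear_combination ha.dOne_hamPair H (L v) - hdw v + ((hamPair a H x).2 - ρ) * hV

theorem hamPair_mem_range_of_mem_range {E' : Type*} [NormedAddCommGroup E'] [NormedSpace ℝ E']
    [FiniteDimensional ℝ E'] [FiniteDimensional ℝ G]
    (hdim : Module.finrank ℝ E = Module.finrank ℝ G + 1)
    {a : E → E →L[ℝ] ℝ} {a' : E' → E' →L[ℝ] ℝ} {j : G → E} {j' : G → E'} {H : E → ℝ} {H' : E' → ℝ}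
    {f : G → ℝ} {x : G} (ha : IsContactAt a (j x)) (ha' : IsContactAt a' (j' x))
    (hj : ContDiffAt ℝ ∞ j x) (hj' : ContDiffAt ℝ ∞ j' x)
    (hjinj : Function.Injective (fderiv ℝ j x))
    (hH : DifferentiableAt ℝ H (j x)) (hH' : DifferentiableAt ℝ H' (j' x))
    (hf : DifferentiableAt ℝ f x) (hf0 : f x ≠ 0)
    (haa' : ∀ᶠ y in 𝓝 x, a' (j' y) ∘L fderiv ℝ j' y = f y • (a (j y) ∘L fderiv ℝ j y))
    (hHH' : ∀ᶠ y in 𝓝 x, H' (j' y) = f y * H (j y))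
    (hmem : (hamPair a' H' (j' x)).1 ∈ range (fderiv ℝ j' x)) :
    (hamPair a H (j x)).1 ∈ range (fderiv ℝ j x) := by
  have h0 : (∞ : WithTop ℕ∞) ≠ 0 := by simp
  obtain ⟨w, hw⟩ := hmem
  have hda := ha.contDiffAt.differentiableAt h0
  have hdj := hj.differentiableAt h0
  have hpull : DifferentiableAt ℝ (fun y => a (j y) ∘L fderiv ℝ j y) x :=
    (hda.comp x hdj).clm_comp ((hj.fderiv_right (m := ∞) (by simp)).differentiableAt h0)
  obtain ⟨haw, ρ, hdw⟩ := exists_dOne_add_fderiv_eq_of_fderiv_apply_eq_hamPair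
    (K := H ∘ j) ha' hpull hj' hf hf0 (hH.comp x hdj) hH' haa' hHH' hw
  refine hamPair_mem_range_of_dOne_add_fderiv_eq (ρ := ρ) hdim hjinj ha haw fun v => ?_
  have h := hdw v
  rwa [dOne_pullback hda hj, fderiv_comp x hH hdj] at h

end Pullback

/-! ### Conformal factors -/

theorem eq_div_smul_of_ker_le_ker {𝕜 V : Type*} [Field 𝕜] [TopologicalSpace 𝕜]
    [IsTopologicalSemiring 𝕜] [AddCommGroup V] [Module 𝕜 V] [TopologicalSpace V]
    {β γ : V →L[𝕜] 𝕜} {u : V} (h : ∀ v, β v = 0 → γ v = 0) (hu : β u ≠ 0) :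
    γ = (γ u / β u) • β := by
  ext v
  have hker : γ (v - (β v / β u) • u) = 0 := h _ (by simp [hu])
  rw [map_sub, map_smul, smul_eq_mul, sub_eq_zero] at hker
  rw [hker, smul_apply, smul_eq_mul]
  ring

section ConformalFactor

variable {F : Type*} [NormedAddCommGroup F] [NormedSpace ℝ F]

/-- If the `1`-form `b` vanishes at `x`, then its exterior derivative is nondegenerate there. This
is the property of the forms induced on hypersurfaces by contact forms that makes the conformal
factor between two such forms smooth, nonvanishing and unique. -/
def NondegenerateZeros (b : F → F →L[ℝ] ℝ) (x : F) : Prop :=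
  b x = 0 → ∀ u, (∀ v, dOne b x u v = 0) → u = 0

namespace NondegenerateZeros

variable {b c : F → F →L[ℝ] ℝ} {x : F}

theorem exists_dOne_ne_zero [Nontrivial F] (h : NondegenerateZeros b x) (hx : b x = 0) :
    ∃ u v, dOne b x u v ≠ 0 := by
  obtain ⟨u, hu⟩ := exists_ne (0 : F)
  by_contra! hzero
  exact hu (h hx u (hzero u))

theorem exists_fderiv_apply_ne_zero [Nontrivial F] (h : NondegenerateZeros b x) (hx : b x = 0) :
    ∃ u v, fderiv ℝ b x u v ≠ 0 := by
  obtain ⟨u, v, huv⟩ := h.exists_dOne_ne_zero hx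
  by_contra! hzero
  exact huv (by rw [dOne, hzero, hzero, sub_zero])

theorem frequently_ne_zero [Nontrivial F] (h : NondegenerateZeros b x) : ∃ᶠ y in 𝓝 x, b y ≠ 0 := by
  intro hzero
  have hb : b =ᶠ[𝓝 x] fun _ => 0 := by
    filter_upwards [hzero] with y hy using not_not.1 hy
  obtain ⟨u, v, huv⟩ := h.exists_dOne_ne_zero hb.self_of_nhds
  exact huv (by rw [dOne_congr hb]; simp [dOne])

theorem factor_unique [Nontrivial F] (h : NondegenerateZeros b x) {f g : F → ℝ}
    (hf : ContinuousAt f x) (hg : ContinuousAt g x)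
    (hfg : ∀ᶠ y in 𝓝 x, f y • b y = g y • b y) : f x = g x := by
  by_contra hne
  have hsub : ∀ᶠ y in 𝓝 x, f y - g y ≠ 0 := (hf.sub hg).eventually_ne (sub_ne_zero.2 hne)
  obtain ⟨y, hby, hy, hfgy⟩ := (h.frequently_ne_zero.and_eventually (hsub.and hfg)).exists
  refine hby ((smul_eq_zero.1 ?_).resolve_left hy)
  rw [sub_smul, hfgy, sub_self]

theorem factor_ne_zero [Nontrivial F] (h : NondegenerateZeros c x) {f : F → ℝ}
    (hb : DifferentiableAt ℝ b x) (hf : DifferentiableAt ℝ f x) (hbx : b x = 0)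
    (hcb : ∀ᶠ y in 𝓝 x, c y = f y • b y) : f x ≠ 0 := by
  intro hfx
  obtain ⟨u, v, huv⟩ := h.exists_dOne_ne_zero (by rw [hcb.self_of_nhds, hfx, zero_smul])
  refine huv ?_
  rw [dOne_congr hcb, dOne_smul hb hf, hfx, hbx]
  simp only [zero_apply, mul_zero, zero_mul, sub_zero, add_zero]

end NondegenerateZeros

/-- The set where `b · v` does not vanish is dense near `p`, and there the factor is determined by
the values on `v`. -/
theorem eventually_eq_smul_of_apply_eq_smul {b c : F → F →L[ℝ] ℝ} {f : F → ℝ} {p v : F}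
    (hb : ∀ᶠ x in 𝓝 p, ContDiffAt ℝ ∞ b x) (hc : ∀ᶠ x in 𝓝 p, ContinuousAt c x)
    (hf : ∀ᶠ x in 𝓝 p, ContinuousAt f x) (hdb : fderiv ℝ (fun x => b x v) p ≠ 0)
    (hbc : ∀ᶠ x in 𝓝 p, ∀ v, b x v = 0 → c x v = 0)
    (hbcf : ∀ᶠ x in 𝓝 p, c x v = b x v • f x) :
    ∀ᶠ x in 𝓝 p, c x = f x • b x := by
  have hdb_ne : ∀ᶠ x in 𝓝 p, fderiv ℝ (fun x => b x v) x ≠ 0 :=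
    ((hb.self_of_nhds.clm_apply contDiffAt_const).fderiv_right (m := 0) (by simp)).continuousAt
      |>.eventually_ne hdb
  filter_upwards [hdb_ne, hbcf.eventually_nhds, hbc.eventually_nhds, hb, hc, hf]
    with x hdbx hbcfx hbcx hbx hcx hfx
  by_contra hne
  refine hdbx ?_
  have hzero : (fun x => b x v) =ᶠ[𝓝 x] fun _ => 0 := by
    filter_upwards [(hcx.sub (hfx.smul hbx.continuousAt)).eventually_ne (sub_ne_zero.2 hne),
      hbcfx, hbcx] with y hney hbcfy hbcy
    by_contra hby
    refine hney (sub_eq_zero.2 ?_)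
    have h := eq_div_smul_of_ker_le_ker hbcy hby
    rwa [hbcfy, smul_eq_mul, mul_div_cancel_left₀ _ hby] at h
  rw [hzero.fderiv_eq, fderiv_const_apply]

theorem exists_smooth_factor_of_ne_zero {b c : F → F →L[ℝ] ℝ} {p : F}
    (hb : ∀ᶠ x in 𝓝 p, ContDiffAt ℝ ∞ b x) (hc : ∀ᶠ x in 𝓝 p, ContDiffAt ℝ ∞ c x)
    (hbc : ∀ᶠ x in 𝓝 p, ∀ v, b x v = 0 ↔ c x v = 0) (hp : b p ≠ 0) :
    ∃ f : F → ℝ, ∀ᶠ x in 𝓝 p, ContDiffAt ℝ ∞ f x ∧ f x ≠ 0 ∧ c x = f x • b x := by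
  obtain ⟨u, hu⟩ := DFunLike.ne_iff.1 hp
  have hbu : ∀ᶠ x in 𝓝 p, b x u ≠ 0 :=
    (hb.self_of_nhds.continuousAt.clm_apply continuousAt_const).eventually_ne hu
  refine ⟨fun x => c x u / b x u, ?_⟩
  filter_upwards [hb, hc, hbu, hbc] with x hbx hcx hbux hbcx
  exact ⟨(hcx.clm_apply contDiffAt_const).div (hbx.clm_apply contDiffAt_const) hbux,
    div_ne_zero (mt (hbcx u).2 hbux) hbux,
    eq_div_smul_of_ker_le_ker (fun v => (hbcx v).1) hbux⟩

theorem exists_smooth_factor_of_eq_zero [CompleteSpace F] [HasContDiffBump F] [Nontrivial F]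
    {b c : F → F →L[ℝ] ℝ} {p : F}
    (hb : ∀ᶠ x in 𝓝 p, ContDiffAt ℝ ∞ b x) (hc : ∀ᶠ x in 𝓝 p, ContDiffAt ℝ ∞ c x)
    (hbn : NondegenerateZeros b p) (hcn : NondegenerateZeros c p)
    (hbc : ∀ᶠ x in 𝓝 p, ∀ v, b x v = 0 → c x v = 0) (hp : b p = 0) :
    ∃ f : F → ℝ, ∀ᶠ x in 𝓝 p, ContDiffAt ℝ ∞ f x ∧ f x ≠ 0 ∧ c x = f x • b x := by
  have h0 : (∞ : WithTop ℕ∞) ≠ 0 := by simp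
  have hbp : DifferentiableAt ℝ b p := hb.self_of_nhds.differentiableAt h0
  obtain ⟨w, v, hwv⟩ := hbn.exists_fderiv_apply_ne_zero hp
  have hdb : fderiv ℝ (fun x => b x v) p ≠ 0 := fun h => hwv <| by
    rw [fderiv_clm_apply hbp (differentiableAt_const v)] at h
    simpa using DFunLike.congr_fun h w
  obtain ⟨f, hf⟩ := exists_smooth_quotient (hb.mono fun x hx => hx.clm_apply contDiffAt_const)
    (hc.mono fun x hx => hx.clm_apply contDiffAt_const) (by rw [hp, zero_apply]) hdb
    (hbc.mono fun x hx => hx v)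
  have hcb : ∀ᶠ x in 𝓝 p, c x = f x • b x :=
    eventually_eq_smul_of_apply_eq_smul hb (hc.mono fun x hx => hx.continuousAt)
      (hf.mono fun x hx => hx.1.continuousAt) hdb hbc (hf.mono fun x hx => hx.2)
  have hfp := hf.self_of_nhds.1
  have hf_ne : f p ≠ 0 := hcn.factor_ne_zero hbp (hfp.differentiableAt h0) hp hcb
  refine ⟨f, ?_⟩
  filter_upwards [hf, hcb, hfp.continuousAt.eventually_ne hf_ne] with x hfx hcbx hnex
  exact ⟨hfx.1, hnex, hcbx⟩

theorem exists_smooth_factor [CompleteSpace F] [HasContDiffBump F] {b c : F → F →L[ℝ] ℝ} {p : F}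
    (hb : ∀ᶠ x in 𝓝 p, ContDiffAt ℝ ∞ b x) (hc : ∀ᶠ x in 𝓝 p, ContDiffAt ℝ ∞ c x)
    (hbn : NondegenerateZeros b p) (hcn : NondegenerateZeros c p)
    (hbc : ∀ᶠ x in 𝓝 p, ∀ v, b x v = 0 ↔ c x v = 0) :
    ∃ f : F → ℝ, ∀ᶠ x in 𝓝 p, ContDiffAt ℝ ∞ f x ∧ f x ≠ 0 ∧ c x = f x • b x := by
  rcases subsingleton_or_nontrivial F with hF | hF
  · refine ⟨fun _ => 1, .of_forall fun x => ⟨contDiffAt_const, one_ne_zero, ?_⟩⟩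
    exact Subsingleton.elim _ _
  · by_cases hp : b p = 0
    · exact exists_smooth_factor_of_eq_zero hb hc hbn hcn
        (hbc.mono fun x hx v => (hx v).1) hp
    · exact exists_smooth_factor_of_ne_zero hb hc hbc hp

theorem IsContactAt.nondegenerateZeros_pullback {E : Type*} [NormedAddCommGroup E]
    [NormedSpace ℝ E] [FiniteDimensional ℝ E] [FiniteDimensional ℝ F]
    (hdim : Module.finrank ℝ E = Module.finrank ℝ F + 1)
    {a : E → E →L[ℝ] ℝ} {j : F → E} {x : F} (ha : IsContactAt a (j x)) (hj : ContDiffAt ℝ ∞ j x)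
    (hinj : Function.Injective (fderiv ℝ j x)) :
    NondegenerateZeros (fun y => a (j y) ∘L fderiv ℝ j y) x := by
  intro h u hu
  have hzero : ∀ v, a (j x) (fderiv ℝ j x v) = 0 := DFunLike.congr_fun h
  obtain ⟨Z, hZ⟩ := DFunLike.ne_iff.1 ha.ne_zero
  have hZ_range : Z ∉ range (fderiv ℝ j x) := by
    rintro ⟨v, rfl⟩
    exact hZ (hzero v)
  refine (map_eq_zero_iff _ hinj).1 (ha.nondegenerate _ (hzero u) fun V hV => ?_)
  obtain ⟨v, s, rfl⟩ := exists_eq_add_smul hdim (L := (fderiv ℝ j x : F →ₗ[ℝ] E)) hinj hZ_range V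
  rw [ContinuousLinearMap.coe_coe] at hV ⊢
  rw [map_add, hzero, zero_add, map_smul, smul_eq_mul] at hV
  rw [(mul_eq_zero.1 hV).resolve_right hZ, zero_smul, add_zero,
    ← dOne_pullback (ha.contDiffAt.differentiableAt (by simp)) hj]
  exact hu v

end ConformalFactor

/-! ### Gluing germs along a subspace -/

section Gluing

theorem exists_closed_locallyFinite_refinement {X ι : Type*} [TopologicalSpace X]
    [ParacompactSpace X] [NormalSpace X] (u : ι → Set X) (huo : ∀ i, IsOpen (u i))
    (hu : ⋃ i, u i = univ) :
    ∃ C : ι → Set X, (∀ i, IsClosed (C i)) ∧ ⋃ i, C i = univ ∧ LocallyFinite C ∧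
      ∀ i, C i ⊆ u i := by
  obtain ⟨v, hvo, hv, hvlf, hvu⟩ := precise_refinement u huo hu
  obtain ⟨C, hC, hCc, hCv⟩ := exists_iUnion_eq_closed_subset hvo hvlf.point_finite hv
  exact ⟨C, hCc, hC, hvlf.subset hCv, fun i => (hCv i).trans (hvu i)⟩

theorem exists_eventuallyEq_of_open_cover {X ι N : Type*} [TopologicalSpace X]
    [ParacompactSpace X] [NormalSpace X] {u : ι → Set X} (huo : ∀ i, IsOpen (u i))
    (hu : ⋃ i, u i = univ) (φ : ι → X → N) :
    ∃ Φ : X → N, ∀ (x : X) (ψ : X → N), (∀ i, x ∈ u i → φ i =ᶠ[𝓝 x] ψ) → Φ =ᶠ[𝓝 x] ψ := by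
  obtain ⟨C, hCc, hC, hClf, hCu⟩ := exists_closed_locallyFinite_refinement u huo hu
  choose i hi using fun x => mem_iUnion.1 (hC ▸ mem_univ x)
  refine ⟨fun x => φ (i x) x, fun x ψ hψ => ?_⟩
  have hC_near : ∀ᶠ y in 𝓝 x, ∀ k, y ∈ C k → x ∈ C k := by
    filter_upwards [hClf.iInter_compl_mem_nhds hCc x] with y hy k hyk
    by_contra hxk
    exact mem_iInter₂.1 hy k hxk hyk
  have hψ_near : ∀ᶠ y in 𝓝 x, ∀ k ∈ {k | x ∈ C k}, φ k y = ψ y :=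
    (eventually_all_finite (hClf.point_finite x)).2 fun k hk => hψ k (hCu k hk)
  filter_upwards [hC_near, hψ_near] with y hCy hψy
  exact hψy _ (hCy _ (hi y))

theorem exists_eventuallyEq_of_coherent {T M N : Type*} [TopologicalSpace T] [TopologicalSpace M]
    [MetrizableSpace M] [Nonempty N] {j : T → M} (hj : IsInducing j) (φ : T → M → N)
    (hφ : ∀ z, ∀ᶠ w in 𝓝 z, φ w =ᶠ[𝓝 (j w)] φ z) :
    ∃ Φ : M → N, ∀ z, Φ =ᶠ[𝓝 (j z)] φ z := by
  have hopen : ∀ z, ∃ O : Set M, IsOpen O ∧ j z ∈ O ∧ ∀ w, j w ∈ O → φ w =ᶠ[𝓝 (j w)] φ z := by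
    intro z
    have h := hφ z
    rw [hj.nhds_eq_comap, eventually_comap] at h
    obtain ⟨O, hO, hOo, hz⟩ := eventually_nhds_iff.1 h
    exact ⟨O, hOo, hz, fun w hw => hO _ hw w rfl⟩
  choose O hOo hzO hO using hopen
  let U : Opens M := ⟨⋃ z, O z, isOpen_iUnion hOo⟩
  let _ := metrizableSpaceMetric M
  obtain ⟨Φ, hΦ⟩ := exists_eventuallyEq_of_open_cover (X := U)
    (u := fun z => Subtype.val ⁻¹' O z) (fun z => (hOo z).preimage continuous_subtype_val)
    (by rw [← preimage_iUnion]; exact Subtype.coe_preimage_self _) (fun z x => φ z x)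
  refine ⟨Function.extend Subtype.val Φ fun _ => Classical.arbitrary N, fun w => ?_⟩
  have hwU : j w ∈ U := mem_iUnion.2 ⟨w, hzO w⟩
  have hval : map (Subtype.val : U → M) (𝓝 ⟨j w, hwU⟩) = 𝓝 (j w) :=
    U.isOpen.isOpenEmbedding_subtypeVal.map_nhds_eq ⟨j w, hwU⟩
  have hΦw : Φ =ᶠ[𝓝 ⟨j w, hwU⟩] fun x => φ w x := by
    refine hΦ ⟨j w, hwU⟩ _ fun z hz => ?_
    have hzw : ∀ᶠ y in 𝓝 (j w), φ z y = φ w y := (hO z w hz).symm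
    exact (continuous_subtype_val.tendsto (⟨j w, hwU⟩ : U)).eventually hzw
  rw [← hval, EventuallyEq, eventually_map]
  filter_upwards [hΦw] with x hx
  rw [Subtype.val_injective.extend_apply, hx]

/-- The supremum of the radii at most `1` of balls on which `Φ` is injective. The truncation at
`1` keeps the supremum finite. -/
noncomputable def injectivityRadius {M N : Type*} [PseudoMetricSpace M] (Φ : M → N) (x : M) : ℝ :=
  sSup {r | r ≤ 1 ∧ InjOn Φ (Metric.ball x r)}

namespace injectivityRadius

variable {M N : Type*} [PseudoMetricSpace M] {Φ : M → N}

theorem le_of_injOn_ball {x : M} {r : ℝ} (hr : r ≤ 1) (hinj : InjOn Φ (Metric.ball x r)) :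
    r ≤ injectivityRadius Φ x :=
  le_csSup ⟨1, fun _ h => h.1⟩ ⟨hr, hinj⟩

theorem nonempty_radii (Φ : M → N) (x : M) : {r | r ≤ 1 ∧ InjOn Φ (Metric.ball x r)}.Nonempty :=
  ⟨0, zero_le_one, by simp⟩

theorem injOn_ball (Φ : M → N) (x : M) : InjOn Φ (Metric.ball x (injectivityRadius Φ x)) := by
  intro y hy z hz hyz
  obtain ⟨r, hr, hlt⟩ := exists_lt_of_lt_csSup (nonempty_radii Φ x) (max_lt hy hz)
  exact hr.2 ((le_max_left _ _).trans_lt hlt) ((le_max_right _ _).trans_lt hlt) hyz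

theorem pos_of_injOn {x : M} {O : Set M} (hO : O ∈ 𝓝 x) (hinj : InjOn Φ O) :
    0 < injectivityRadius Φ x := by
  obtain ⟨ε, hε, hεO⟩ := Metric.mem_nhds_iff.1 hO
  exact (lt_min hε one_pos).trans_le <| le_of_injOn_ball (min_le_right _ _) <|
    hinj.mono ((Metric.ball_subset_ball (min_le_left _ _)).trans hεO)

theorem le_add_dist (Φ : M → N) (x y : M) :
    injectivityRadius Φ y ≤ injectivityRadius Φ x + dist x y := by
  refine csSup_le (nonempty_radii Φ y) fun r hr => ?_
  rw [← sub_le_iff_le_add]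
  exact le_of_injOn_ball ((sub_le_self r dist_nonneg).trans hr.1)
    (hr.2.mono (Metric.ball_subset_ball' (by rw [sub_add_cancel])))

theorem eq_of_dist_lt {x y p q : M} (hpq : dist q p < injectivityRadius Φ p / 3)
    (hx : dist x p < injectivityRadius Φ p / 10) (hy : dist y q < injectivityRadius Φ q / 10)
    (hxy : Φ x = Φ y) : x = y := by
  have hlip := le_add_dist Φ p q
  have htri := dist_triangle y q p
  rw [dist_comm] at hlip
  have hnonneg := dist_nonneg (x := q) (y := p)
  exact injOn_ball Φ p (Metric.mem_ball.2 (by linarith)) (Metric.mem_ball.2 (by linarith)) hxy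

end injectivityRadius

/-- The neighbourhood consists of the points whose distance to some `j z` is small compared to the
injectivity radius at `j z`, and whose image is so close to `Φ (j z)` that points of two such pieces
with the same image come from points `j z`, `j w` which are themselves close. -/
theorem exists_injOn_of_isInducing {T M N : Type*} [TopologicalSpace T] [TopologicalSpace M]
    [MetrizableSpace M] [TopologicalSpace N] [MetrizableSpace N] {j : T → M} {Φ : M → N}
    (hj : Continuous j) (hΦj : IsInducing (Φ ∘ j))
    (hΦ : ∀ z, ContinuousAt Φ (j z)) (hinj : ∀ z, ∃ O ∈ 𝓝 (j z), InjOn Φ O) :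
    ∃ V : Set M, IsOpen V ∧ (∀ z, j z ∈ V) ∧ InjOn Φ V := by
  let _ := metrizableSpaceMetric M
  let _ := metrizableSpaceMetric N
  have hpos : ∀ z, 0 < injectivityRadius Φ (j z) := fun z => by
    obtain ⟨O, hO, hOinj⟩ := hinj z
    exact injectivityRadius.pos_of_injOn hO hOinj
  have hclose : ∀ z, ∃ σ > 0, ∀ w, dist (Φ (j w)) (Φ (j z)) < 2 * σ →
      dist (j w) (j z) < injectivityRadius Φ (j z) / 3 := by
    intro z
    have hnear : ∀ᶠ w in 𝓝 z, dist (j w) (j z) < injectivityRadius Φ (j z) / 3 :=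
      hj.continuousAt.eventually (Metric.ball_mem_nhds _ (div_pos (hpos z) three_pos))
    rw [hΦj.nhds_eq_comap, eventually_comap] at hnear
    obtain ⟨ε, hε, hball⟩ := Metric.eventually_nhds_iff.1 hnear
    exact ⟨ε / 2, half_pos hε, fun w hw =>
      hball (by rwa [mul_div_cancel₀ _ two_ne_zero] at hw) w rfl⟩
  choose σ hσ hclose using hclose
  let W : T → Set M := fun z =>
    Metric.ball (j z) (injectivityRadius Φ (j z) / 10) ∩ {x | dist (Φ x) (Φ (j z)) < σ z}
  have hW : ∀ z w x y, x ∈ W z → y ∈ W w → σ w ≤ σ z → Φ x = Φ y → x = y := by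
    intro z w x y hx hy hle hxy
    refine injectivityRadius.eq_of_dist_lt (hclose z w ?_) hx.1 hy.1 hxy
    have hΦx : dist (Φ x) (Φ (j z)) < σ z := hx.2
    have hΦy : dist (Φ y) (Φ (j w)) < σ w := hy.2
    have htri := dist_triangle_left (Φ (j w)) (Φ (j z)) (Φ x)
    rw [← hxy] at hΦy
    linarith
  refine ⟨⋃ z, interior (W z), isOpen_iUnion fun z => isOpen_interior,
    fun z => mem_iUnion.2 ⟨z, mem_interior_iff_mem_nhds.2 (inter_mem (Metric.ball_mem_nhds _
      (div_pos (hpos z) (by norm_num))) (hΦ z (Metric.ball_mem_nhds _ (hσ z))))⟩, ?_⟩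
  intro x hx y hy hxy
  obtain ⟨z, hz⟩ := mem_iUnion.1 hx
  obtain ⟨w, hw⟩ := mem_iUnion.1 hy
  rcases le_total (σ w) (σ z) with h | h
  · exact hW z w x y (interior_subset hz) (interior_subset hw) h hxy
  · exact (hW w z y x (interior_subset hw) (interior_subset hz) h hxy.symm).symm

end Gluing

/-! ### Germs constructed by successive extension -/

section GermExtension

variable {S M N : Type*} [TopologicalSpace S] [TopologicalSpace M] {i : S → M}
  {φ φ' : S → M → N} {A K : Set S} {P : (M → N) → S → Prop}

/-- The germs of the maps `φ z` at the points `i z`, where `z` runs through `A`, fit together: near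
each point of `A` they are the germs of a single map. -/
def IsCoherentOn (i : S → M) (φ : S → M → N) (A : Set S) : Prop :=
  ∀ z ∈ A, ∀ᶠ w in 𝓝[A] z, φ w =ᶠ[𝓝 (i w)] φ z

/-- Every germ with the property `P` along a compact subset of `K` extends to a coherent family of
germs with this property along `K`. -/
def HasRelativeGermExtension (i : S → M) (P : (M → N) → S → Prop) (K : Set S) : Prop :=
  ∀ A ⊆ K, IsCompact A → ∀ Φ : M → N, (∀ z ∈ A, P Φ z) →
    ∃ θ : S → M → N, (∀ z ∈ K, P (θ z) z) ∧ IsCoherentOn i θ K ∧ ∀ z ∈ A, θ z =ᶠ[𝓝 (i z)] Φ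

namespace IsCoherentOn

theorem congr (hi : Continuous i) (h : IsCoherentOn i φ A)
    (hφ : ∀ z ∈ A, φ' z =ᶠ[𝓝 (i z)] φ z) : IsCoherentOn i φ' A := by
  intro z hz
  filter_upwards [h z hz, self_mem_nhdsWithin,
    (hi.continuousAt.eventually (hφ z hz).eventuallyEq_nhds).filter_mono nhdsWithin_le_nhds]
    with w hw hwA hwz using (hφ w hwA).trans (hw.trans hwz.symm)

theorem union (h : IsCoherentOn i φ A) (h' : IsCoherentOn i φ K) (hA : IsClosed A)
    (hK : IsClosed K) : IsCoherentOn i φ (A ∪ K) := by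
  have hclosed : ∀ {B : Set S}, IsClosed B → IsCoherentOn i φ B → ∀ z,
      ∀ᶠ w in 𝓝[B] z, φ w =ᶠ[𝓝 (i w)] φ z := by
    intro B hB hφB z
    by_cases hz : z ∈ B
    · exact hφB z hz
    · rw [← hB.closure_eq, notMem_closure_iff_nhdsWithin_eq_bot] at hz
      exact hz ▸ eventually_bot
  intro z _
  rw [nhdsWithin_union]
  exact eventually_sup.2 ⟨hclosed hA h z, hclosed hK h' z⟩

theorem exists_eventuallyEq [MetrizableSpace M] [Nonempty N] (hi : IsInducing i)
    (h : IsCoherentOn i φ A) : ∃ Φ : M → N, ∀ z ∈ A, Φ =ᶠ[𝓝 (i z)] φ z := by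
  obtain ⟨Φ, hΦ⟩ := exists_eventuallyEq_of_coherent (hi.comp .subtypeVal) (fun z : A => φ z)
    fun z => (eventually_nhds_subtype_iff A z _).2 (h z z.2)
  exact ⟨Φ, fun z hz => hΦ ⟨z, hz⟩⟩

end IsCoherentOn

namespace HasRelativeGermExtension

variable [MetrizableSpace M] [T2Space S] [Nonempty N]

theorem exists_extension_union (hK : IsCompact K) (hext : HasRelativeGermExtension i P K)
    (hi : IsInducing i) (hP : ∀ Φ Φ' z, P Φ z → Φ =ᶠ[𝓝 (i z)] Φ' → P Φ' z) (hA : IsClosed A)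
    {Φ : M → N} (hΦ : ∀ z ∈ A, P Φ z) :
    ∃ Φ' : M → N, (∀ z ∈ A ∪ K, P Φ' z) ∧ ∀ z ∈ A, Φ' =ᶠ[𝓝 (i z)] Φ := by
  classical
  obtain ⟨θ, hθ, hθK, hθA⟩ := hext (A ∩ K) inter_subset_right (hK.inter_left hA) Φ
    fun z hz => hΦ z hz.1
  let φ : S → M → N := A.piecewise (fun _ => Φ) θ
  have hφA : ∀ z ∈ A, φ z = Φ := fun z hz => A.piecewise_eq_of_mem _ _ hz
  have hφK : ∀ z ∈ K, φ z =ᶠ[𝓝 (i z)] θ z := fun z hzK => by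
    by_cases hzA : z ∈ A
    · exact hφA z hzA ▸ (hθA z ⟨hzA, hzK⟩).symm
    · exact .of_eq (A.piecewise_eq_of_notMem _ _ hzA)
  have hcoherent : IsCoherentOn i φ (A ∪ K) := by
    refine .union (fun z hz => ?_) (hθK.congr hi.continuous hφK) hA hK.isClosed
    filter_upwards [self_mem_nhdsWithin] with w hw
    rw [hφA w hw, hφA z hz]
  obtain ⟨Φ', hΦ'⟩ := hcoherent.exists_eventuallyEq hi
  refine ⟨Φ', fun z hz => ?_, fun z hz => hφA z hz ▸ hΦ' z (.inl hz)⟩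
  rcases hz with hzA | hzK
  · exact hP _ _ z (hΦ z hzA) (hφA z hzA ▸ hΦ' z (.inl hzA)).symm
  · exact hP _ _ z (hθ z hzK) ((hΦ' z (.inr hzK)).trans (hφK z hzK)).symm

theorem exists_seq {K : ℕ → Set S} (hK : ∀ l, IsCompact (K l))
    (hext : ∀ l, HasRelativeGermExtension i P (K l)) (hi : IsInducing i)
    (hP : ∀ Φ Φ' z, P Φ z → Φ =ᶠ[𝓝 (i z)] Φ' → P Φ' z) :
    ∃ Φ : ℕ → M → N, (∀ l, ∀ z ∈ accumulate K l, P (Φ l) z) ∧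
      ∀ l q, l ≤ q → ∀ z ∈ accumulate K l, Φ q =ᶠ[𝓝 (i z)] Φ l := by
  have hclosed : ∀ l, IsClosed (accumulate K l) := fun l =>
    (finite_le_nat l).isClosed_biUnion fun q _ => (hK q).isClosed
  have hnext : ∀ l (Φ : {Φ : M → N // ∀ z ∈ accumulate K l, P Φ z}),
      ∃ Φ' : {Φ : M → N // ∀ z ∈ accumulate K (l + 1), P Φ z},
        ∀ z ∈ accumulate K l, Φ'.1 =ᶠ[𝓝 (i z)] Φ.1 := fun l Φ => by
    obtain ⟨Φ', hΦ', hΦ'Φ⟩ := (hext (l + 1)).exists_extension_union (hK _) hi hP (hclosed l) Φ.2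
    exact ⟨⟨Φ', by rwa [accumulate_succ]⟩, hΦ'Φ⟩
  choose next hnext using hnext
  obtain ⟨Φ₀, hΦ₀, -⟩ := (hext 0).exists_extension_union (hK 0) hi hP isClosed_empty
    (Φ := fun _ => Classical.arbitrary N) (by simp)
  let Φ : ∀ l, {Φ : M → N // ∀ z ∈ accumulate K l, P Φ z} := fun l =>
    Nat.rec ⟨Φ₀, by simpa using hΦ₀⟩ next l
  refine ⟨fun l => (Φ l).1, fun l => (Φ l).2, fun l q hlq => ?_⟩
  induction q, hlq using Nat.le_induction with
  | base => exact fun z _ => .rfl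
  | succ q hlq ih =>
    exact fun z hz => (hnext q (Φ q) z (monotone_accumulate hlq hz)).trans (ih z hz)

theorem exists_forall [SecondCountableTopology S] (hi : IsInducing i)
    (hP : ∀ Φ Φ' z, P Φ z → Φ =ᶠ[𝓝 (i z)] Φ' → P Φ' z)
    (hlocal : ∀ p, ∃ K ∈ 𝓝 p, IsCompact K ∧ HasRelativeGermExtension i P K) :
    ∃ Φ : M → N, ∀ z, P Φ z := by
  rcases isEmpty_or_nonempty S with hS | ⟨⟨z₀⟩⟩
  · exact ⟨fun _ => Classical.arbitrary N, hS.elim⟩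
  choose K hKp hK hext using hlocal
  obtain ⟨s, hs_countable, hs⟩ :=
    TopologicalSpace.countable_cover_nhds fun p => interior_mem_nhds.2 (hKp p)
  have hcover : ∀ z, ∃ q ∈ s, z ∈ interior (K q) := fun z => by
    simpa using (hs ▸ mem_univ z : z ∈ ⋃ q ∈ s, interior (K q))
  obtain ⟨q₀, hq₀, -⟩ := hcover z₀
  obtain ⟨p, rfl⟩ := hs_countable.exists_eq_range ⟨q₀, hq₀⟩
  obtain ⟨Φ, hΦ, hΦΦ⟩ := exists_seq (fun l => hK (p l)) (fun l => hext (p l)) hi hP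
  have hnhds : ∀ z, ∃ l, accumulate (fun l => K (p l)) l ∈ 𝓝 z := fun z => by
    obtain ⟨_, ⟨l, rfl⟩, hl⟩ := hcover z
    exact ⟨l, mem_of_superset (mem_interior_iff_mem_nhds.1 hl)
      (subset_accumulate (s := fun l => K (p l)))⟩
  choose l hl using hnhds
  obtain ⟨Ψ, hΨ⟩ := exists_eventuallyEq_of_coherent hi (fun z => Φ (l z)) fun z => by
    filter_upwards [hl z] with w hw
    exact (hΦΦ _ _ (le_max_left (l w) (l z)) w (mem_of_mem_nhds (hl w))).symm.trans
      (hΦΦ _ _ (le_max_right _ _) w hw)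
  exact ⟨Ψ, fun z => hP _ _ z (hΦ (l z) z (mem_of_mem_nhds (hl z))) (hΨ z).symm⟩

end HasRelativeGermExtension

end GermExtension

/-! ### Flow-outs of contact Hamiltonian vector fields -/

section FlowOut

theorem tendsto_prodMk_zero {T : Type*} [TopologicalSpace T] (x : T) :
    Tendsto (fun y => (y, (0 : ℝ))) (𝓝 x) (𝓝 (x, 0)) :=
  tendsto_id.prodMk_nhds tendsto_const_nhds

theorem exists_smooth_eventually_comp_eq {A E E' : Type*} [NormedAddCommGroup A]
    [NormedSpace ℝ A] [CompleteSpace A] [NormedAddCommGroup E] [NormedSpace ℝ E]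
    [CompleteSpace E] [NormedAddCommGroup E'] [NormedSpace ℝ E']
    {Φ : A → E} {Φ' : A → E'} {p : A} (hΦ : ∀ᶠ z in 𝓝 p, ContDiffAt ℝ ∞ Φ z)
    (hinv : (fderiv ℝ Φ p).IsInvertible) (hΦ' : ∀ᶠ z in 𝓝 p, ContDiffAt ℝ ∞ Φ' z) :
    ∃ ψ : E → E', ∀ᶠ z in 𝓝 p, ContDiffAt ℝ ∞ ψ (Φ z) ∧ ψ (Φ z) = Φ' z := by
  obtain ⟨e, hpe, heΦ, -, hsymm⟩ := exists_openPartialHomeomorph_of_isInvertible_fderiv hΦ hinv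
  refine ⟨fun y => Φ' (e.symm y), ?_⟩
  filter_upwards [e.open_source.mem_nhds hpe, hΦ'] with z hz hΦ'z
  have hleft : e.symm (Φ z) = z := by rw [← heΦ, e.left_inv hz]
  refine ⟨ContDiffAt.comp (g := Φ') (Φ z) (by rwa [hleft]) (hsymm _ ?_), by rw [hleft]⟩
  rw [← heΦ]
  exact e.map_source hz

variable {E E' F : Type*} [NormedAddCommGroup E] [NormedSpace ℝ E]
  [NormedAddCommGroup E'] [NormedSpace ℝ E'] [NormedAddCommGroup F] [NormedSpace ℝ F]

/-- `Φ` is the flow-out of the map `j : F → E` along the vector field `X`, near `(x, 0)`. -/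
structure IsFlowOut (X : E → E) (j : F → E) (Φ : F × ℝ → E) (x : F) : Prop where
  smooth : ∀ᶠ z in 𝓝 (x, (0 : ℝ)), ContDiffAt ℝ ∞ Φ z
  deriv : ∀ᶠ z in 𝓝 (x, (0 : ℝ)), HasDerivAt (fun s => Φ (z.1, s)) (X (Φ z)) z.2
  initial : ∀ᶠ y in 𝓝 x, Φ (y, 0) = j y

/-- The germ of `ψ` at `j x` extends the correspondence `j y ↦ j' y` and maps the vector field
`X` to the vector field `X'`. -/
structure Intertwines (X : E → E) (X' : E' → E') (j : F → E) (j' : F → E') (ψ : E → E') (x : F) :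
    Prop where
  smooth : ∀ᶠ y in 𝓝 (j x), ContDiffAt ℝ ∞ ψ y
  comm : ∀ᶠ y in 𝓝 x, ψ (j y) = j' y
  map_field : ∀ᶠ y in 𝓝 (j x), fderiv ℝ ψ y (X y) = X' (ψ y)

/-- The germ of `ψ` at `j x` is a contactomorphism extending the correspondence `j y ↦ j' y`. -/
structure IsContactGerm (a : E → E →L[ℝ] ℝ) (a' : E' → E' →L[ℝ] ℝ) (j : F → E) (j' : F → E')
    (ψ : E → E') (x : F) : Prop where
  smooth : ∀ᶠ y in 𝓝 (j x), ContDiffAt ℝ ∞ ψ y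
  comm : ∀ᶠ y in 𝓝 x, ψ (j y) = j' y
  invertible : (fderiv ℝ ψ (j x)).IsInvertible
  contact : ∀ᶠ y in 𝓝 (j x), ∀ v, a' (ψ y) (fderiv ℝ ψ y v) = 0 ↔ a y v = 0

theorem exists_isFlowOut [CompleteSpace E] [HasContDiffBump E] {X : E → E} {j : F → E} {x : F}
    (hX : ∀ᶠ y in 𝓝 (j x), ContDiffAt ℝ ∞ X y) (hj : ∀ᶠ y in 𝓝 x, ContDiffAt ℝ ∞ j y) :
    ∃ Φ, IsFlowOut X j Φ x := by
  obtain ⟨θ, hθ, hθ_zero⟩ := exists_smooth_flow hX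
  have hjx : ContinuousAt j x := hj.self_of_nhds.continuousAt
  have hj_time : Tendsto (fun z : F × ℝ => (j z.1, z.2)) (𝓝 (x, 0)) (𝓝 (j x, 0)) :=
    (hjx.tendsto.comp (continuous_fst.tendsto (x, (0 : ℝ)))).prodMk_nhds
      (continuous_snd.tendsto (x, (0 : ℝ)))
  refine ⟨fun z => θ (j z.1, z.2), ?_, (hj_time.eventually hθ).mono fun z hz => hz.2,
    hjx.eventually hθ_zero⟩
  filter_upwards [hj_time.eventually hθ, continuousAt_fst.eventually hj] with z hθz hjz
  exact ContDiffAt.comp (g := θ) z hθz.1 ((hjz.comp z contDiffAt_fst).prodMk contDiffAt_snd)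

namespace IsFlowOut

variable {X : E → E} {j : F → E} {Φ : F × ℝ → E} {x : F}

theorem apply_zero (h : IsFlowOut X j Φ x) : Φ (x, 0) = j x := h.initial.self_of_nhds

theorem fderiv_initial (h : IsFlowOut X j Φ x) :
    ∀ᶠ y in 𝓝 x, ∀ w, fderiv ℝ Φ (y, 0) w = fderiv ℝ j y w.1 + w.2 • X (j y) := by
  filter_upwards [(tendsto_prodMk_zero x).eventually (h.smooth.and h.deriv),
    h.initial.eventually_nhds] with y hy hinit w
  have hdiff : DifferentiableAt ℝ Φ (y, 0) := hy.1.differentiableAt (by simp)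
  have hspace : fderiv ℝ Φ (y, 0) (w.1, 0) = fderiv ℝ j y w.1 := by
    have hslice : HasFDerivAt (fun y => Φ (y, 0)) (fderiv ℝ Φ (y, 0) ∘L .inl ℝ F ℝ) y :=
      hdiff.hasFDerivAt.comp y (hasFDerivAt_prodMk_left y (0 : ℝ))
    rw [← EventuallyEq.fderiv_eq hinit, hslice.fderiv]
    simp
  have htime : fderiv ℝ Φ (y, 0) (0, 1) = X (j y) := by
    rw [fderiv_apply_zero_one_of_hasDerivAt hdiff hy.2, hinit.self_of_nhds]
  have hw : w = (w.1, 0) + w.2 • (0, 1) := by simp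
  conv_lhs => rw [hw, map_add, map_smul, hspace, htime]

theorem isInvertible_fderiv [FiniteDimensional ℝ E] [FiniteDimensional ℝ F]
    (h : IsFlowOut X j Φ x) (hdim : Module.finrank ℝ E = Module.finrank ℝ F + 1)
    (hinj : Function.Injective (fderiv ℝ j x)) (htr : X (j x) ∉ range (fderiv ℝ j x)) :
    (fderiv ℝ Φ (x, 0)).IsInvertible := by
  refine isInvertible_of_injective (by simp [hdim]) ?_
  rw [show ⇑(fderiv ℝ Φ (x, 0)) = fun w : F × ℝ => fderiv ℝ j x w.1 + w.2 • X (j x) from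
    funext h.fderiv_initial.self_of_nhds]
  exact injective_add_smul (L := (fderiv ℝ j x : F →ₗ[ℝ] E)) hinj htr

theorem map_nhds [CompleteSpace E] [CompleteSpace F] (h : IsFlowOut X j Φ x)
    (hinv : (fderiv ℝ Φ (x, 0)).IsInvertible) : map Φ (𝓝 (x, 0)) = 𝓝 (j x) := by
  obtain ⟨A, hA⟩ := hinv
  have hstrict := h.smooth.self_of_nhds.hasStrictFDerivAt (by simp)
  rw [← h.apply_zero]
  exact HasStrictFDerivAt.map_nhds_eq_of_equiv (f' := A) (by rwa [hA])

theorem tendsto (h : IsFlowOut X j Φ x) : Tendsto Φ (𝓝 (x, 0)) (𝓝 (j x)) :=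
  h.apply_zero ▸ h.smooth.self_of_nhds.continuousAt

theorem germ_unique {Ψ : F × ℝ → E} (hΦ : IsFlowOut X j Φ x) (hΨ : IsFlowOut X j Ψ x)
    (hX : ∀ᶠ y in 𝓝 (j x), ContDiffAt ℝ ∞ X y) : Φ =ᶠ[𝓝 (x, 0)] Ψ := by
  obtain ⟨δ, hδ, hnear⟩ := exists_eventually_forall_Ioo
    (hΦ.deriv.and (hΨ.deriv.and (hΦ.tendsto.eventually hX)))
  filter_upwards [hnear, continuousAt_fst.eventually (hΦ.initial.and hΨ.initial)]
  rintro ⟨y, s⟩ ⟨hs, hy⟩ hinit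
  refine eqOn_Ioo_of_hasDerivAt (X := X) (γ := fun r => Φ (y, r)) (η := fun r => Ψ (y, r))
    (t₀ := 0) (fun r hr => (hy r hr).2.2.of_le (by simp)) (fun r hr => (hy r hr).1)
    (fun r hr => (hy r hr).2.1) ⟨neg_lt_zero.2 hδ, hδ⟩ (hinit.1.trans hinit.2.symm) hs

theorem intertwines [CompleteSpace E] [CompleteSpace F] {X' : E' → E'} {j' : F → E'}
    {Φ' : F × ℝ → E'} {ψ : E → E'}
    (hΦ : IsFlowOut X j Φ x) (hinv : (fderiv ℝ Φ (x, 0)).IsInvertible) (hΦ' : IsFlowOut X' j' Φ' x)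
    (hψ : ∀ᶠ z in 𝓝 (x, (0 : ℝ)), ContDiffAt ℝ ∞ ψ (Φ z) ∧ ψ (Φ z) = Φ' z) :
    Intertwines X X' j j' ψ x where
  smooth := by
    rw [← hΦ.map_nhds hinv, eventually_map]
    exact hψ.mono fun z hz => hz.1
  comm := by
    filter_upwards [(tendsto_prodMk_zero x).eventually hψ, hΦ.initial, hΦ'.initial]
      with y hψy hy hy'
    rw [← hy, hψy.2, hy']
  map_field := by
    rw [← hΦ.map_nhds hinv, eventually_map]
    filter_upwards [hψ.eventually_nhds, hΦ.deriv, hΦ'.deriv] with z hψz hdz hdz'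
    have hcurve : (fun s => ψ (Φ (z.1, s))) =ᶠ[𝓝 z.2] fun s => Φ' (z.1, s) :=
      (Continuous.prodMk_right z.1).continuousAt.eventually (hψz.mono fun w hw => hw.2)
    rw [hψz.self_of_nhds.2]
    exact ((hψz.self_of_nhds.1.differentiableAt (by simp)).hasFDerivAt.comp_hasDerivAt
      z.2 hdz).unique (hdz'.congr_of_eventuallyEq hcurve)

end IsFlowOut

namespace Intertwines

variable {X : E → E} {X' : E' → E'} {j : F → E} {j' : F → E'} {ψ ψ' : E → E'} {x : F}

omit [NormedSpace ℝ F] in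
protected theorem eventually (h : Intertwines X X' j j' ψ x) (hj : ContinuousAt j x) :
    ∀ᶠ y in 𝓝 x, Intertwines X X' j j' ψ y := by
  filter_upwards [hj.eventually h.smooth.eventually_nhds, h.comm.eventually_nhds,
    hj.eventually h.map_field.eventually_nhds] with y hsmooth hcomm hmap
  exact ⟨hsmooth, hcomm, hmap⟩

theorem comp_isFlowOut {Φ : F × ℝ → E} (h : Intertwines X X' j j' ψ x)
    (hΦ : IsFlowOut X j Φ x) : IsFlowOut X' j' (ψ ∘ Φ) x where
  smooth := by
    filter_upwards [hΦ.tendsto.eventually h.smooth, hΦ.smooth] with z hψz hz using hψz.comp z hz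
  deriv := by
    filter_upwards [hΦ.tendsto.eventually (h.smooth.and h.map_field), hΦ.deriv] with z hψz hz
    rw [Function.comp_apply, ← hψz.2]
    exact (hψz.1.differentiableAt (by simp)).hasFDerivAt.comp_hasDerivAt z.2 hz
  initial := by
    filter_upwards [h.comm, hΦ.initial] with y hcomm hy
    rw [Function.comp_apply, hy, hcomm]

theorem germ_unique [FiniteDimensional ℝ E] [FiniteDimensional ℝ F]
    (hdim : Module.finrank ℝ E = Module.finrank ℝ F + 1)
    (hψ : Intertwines X X' j j' ψ x) (hψ' : Intertwines X X' j j' ψ' x)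
    (hX : ∀ᶠ y in 𝓝 (j x), ContDiffAt ℝ ∞ X y) (hX' : ∀ᶠ y in 𝓝 (j' x), ContDiffAt ℝ ∞ X' y)
    (hj : ∀ᶠ y in 𝓝 x, ContDiffAt ℝ ∞ j y)
    (hinj : Function.Injective (fderiv ℝ j x)) (htr : X (j x) ∉ range (fderiv ℝ j x)) :
    ψ =ᶠ[𝓝 (j x)] ψ' := by
  have := FiniteDimensional.complete ℝ E
  have := FiniteDimensional.complete ℝ F
  obtain ⟨Φ, hΦ⟩ := exists_isFlowOut hX hj
  rw [EventuallyEq, ← hΦ.map_nhds (hΦ.isInvertible_fderiv hdim hinj htr), eventually_map]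
  exact (hψ.comp_isFlowOut hΦ).germ_unique (hψ'.comp_isFlowOut hΦ) hX'

end Intertwines

variable [FiniteDimensional ℝ E]

theorem IsFlowOut.apply_fderiv_eq_zero_iff {a : E → E →L[ℝ] ℝ} {j : F → E} {H : E → ℝ}
    {Φ : F × ℝ → E} {x : F} (hΦ : IsFlowOut (fun y => (hamPair a H y).1) j Φ x)
    (hj : ContinuousAt j x) (ha : ∀ᶠ y in 𝓝 (j x), IsContactAt a y)
    (hH : ∀ᶠ y in 𝓝 (j x), ContDiffAt ℝ ∞ H y) :
    ∀ᶠ z in 𝓝 (x, (0 : ℝ)), ∀ w, a (Φ z) (fderiv ℝ Φ z w) = 0 ↔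
      a (j z.1) (fderiv ℝ j z.1 w.1) + w.2 * H (j z.1) = 0 := by
  have hflow := apply_fderiv_hamiltonianFlow_eq_zero_iff (a := a) (H := H) (Φ := Φ) (p := x)
    (by rwa [hΦ.apply_zero]) (by rwa [hΦ.apply_zero]) (hΦ.smooth.and hΦ.deriv)
  filter_upwards [hflow, continuousAt_fst.eventually
    (hΦ.fderiv_initial.and (hΦ.initial.and (hj.eventually ha)))] with z hz ⟨hdz, hz0, haz⟩ w
  rw [hz, hdz, hz0, map_add, map_smul, haz.apply_hamPair, smul_eq_mul]

variable [FiniteDimensional ℝ F]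

theorem IsFlowOut.isContactGerm [FiniteDimensional ℝ E'] {a : E → E →L[ℝ] ℝ}
    {a' : E' → E' →L[ℝ] ℝ} {j : F → E} {j' : F → E'} {H : E → ℝ} {H' : E' → ℝ} {f : F → ℝ}
    {x : F} {Φ : F × ℝ → E} {Φ' : F × ℝ → E'} {ψ : E → E'}
    (hΦ : IsFlowOut (fun y => (hamPair a H y).1) j Φ x)
    (hΦ' : IsFlowOut (fun y => (hamPair a' H' y).1) j' Φ' x)
    (hinv : (fderiv ℝ Φ (x, 0)).IsInvertible) (hinv' : (fderiv ℝ Φ' (x, 0)).IsInvertible)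
    (hψ : ∀ᶠ z in 𝓝 (x, (0 : ℝ)), ContDiffAt ℝ ∞ ψ (Φ z) ∧ ψ (Φ z) = Φ' z)
    (hj : ContinuousAt j x) (hj' : ContinuousAt j' x)
    (ha : ∀ᶠ y in 𝓝 (j x), IsContactAt a y) (ha' : ∀ᶠ y in 𝓝 (j' x), IsContactAt a' y)
    (hH : ∀ᶠ y in 𝓝 (j x), ContDiffAt ℝ ∞ H y) (hH' : ∀ᶠ y in 𝓝 (j' x), ContDiffAt ℝ ∞ H' y)
    (hf : ∀ᶠ y in 𝓝 x, f y ≠ 0)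
    (haa' : ∀ᶠ y in 𝓝 x, a' (j' y) ∘L fderiv ℝ j' y = f y • (a (j y) ∘L fderiv ℝ j y))
    (hHH' : ∀ᶠ y in 𝓝 x, H' (j' y) = f y * H (j y)) :
    IsContactGerm a a' j j' ψ x := by
  have := FiniteDimensional.complete ℝ E
  have := FiniteDimensional.complete ℝ F
  have hψ_int := hΦ.intertwines hinv hΦ' hψ
  have hchain : ∀ᶠ z in 𝓝 (x, (0 : ℝ)), fderiv ℝ ψ (Φ z) ∘L fderiv ℝ Φ z = fderiv ℝ Φ' z := by
    filter_upwards [hψ.eventually_nhds, hΦ.smooth] with z hψz hz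
    rw [← fderiv_comp z (hψz.self_of_nhds.1.differentiableAt (by simp))
      (hz.differentiableAt (by simp))]
    exact EventuallyEq.fderiv_eq (hψz.mono fun w hw => hw.2)
  refine ⟨hψ_int.smooth, hψ_int.comm, ?_, ?_⟩
  · obtain ⟨A, hA⟩ := hinv
    rw [← hΦ.apply_zero, ← ContinuousLinearMap.isInvertible_comp_equiv (e := A), hA,
      hchain.self_of_nhds]
    exact hinv'
  · have hinv_near := eventually_isInvertible_fderiv
      (hΦ.smooth.self_of_nhds.of_le (by simp)) hinv
    rw [← hΦ.map_nhds hinv, eventually_map]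
    filter_upwards [hψ, hchain, hΦ.apply_fderiv_eq_zero_iff hj ha hH,
      hΦ'.apply_fderiv_eq_zero_iff hj' ha' hH', hinv_near,
      continuousAt_fst.eventually (haa'.and (hHH'.and hf))]
      with z hψz hcz hz hz' hinvz ⟨haaz, hHHz, hfz⟩ v
    obtain ⟨w, rfl⟩ := hinvz.bijective.surjective v
    have hpull : a' (j' z.1) (fderiv ℝ j' z.1 w.1) = f z.1 * a (j z.1) (fderiv ℝ j z.1 w.1) :=
      DFunLike.congr_fun haaz w.1
    rw [← ContinuousLinearMap.comp_apply (fderiv ℝ ψ (Φ z)), hcz, hψz.2, hz, hz',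
      hpull, hHHz, mul_left_comm, ← mul_add, mul_eq_zero_iff_left hfz]

end FlowOut

/-! ### Conformal factors of germs of contactomorphisms -/

section ConformalFactor

variable {E E' F : Type*} [NormedAddCommGroup E] [NormedSpace ℝ E]
  [NormedAddCommGroup E'] [NormedSpace ℝ E'] [NormedAddCommGroup F]

/-- The conformal factor of a contactomorphism `ψ`, computed as the value of `ψ^* a'` on the Reeb
field of `a`, which is the contact Hamiltonian vector field of the constant `1`. -/
noncomputable def conformalFactor (a : E → E →L[ℝ] ℝ) (a' : E' → E' →L[ℝ] ℝ) (ψ : E → E') (y : E) :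
    ℝ :=
  a' (ψ y) (fderiv ℝ ψ y (hamPair a (fun _ => 1) y).1)

variable {a : E → E →L[ℝ] ℝ} {a' : E' → E' →L[ℝ] ℝ} {j : F → E} {j' : F → E'} {ψ : E → E'}

namespace IsContactAt

variable [FiniteDimensional ℝ E] {y : E}

theorem conformalFactor_ne_zero (ha : IsContactAt a y)
    (h : ∀ v, a' (ψ y) (fderiv ℝ ψ y v) = 0 ↔ a y v = 0) : conformalFactor a a' ψ y ≠ 0 := by
  rw [conformalFactor, Ne, h, ha.apply_hamPair]
  exact one_ne_zero

theorem pullback_eq_conformalFactor_smul (ha : IsContactAt a y)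
    (h : ∀ v, a' (ψ y) (fderiv ℝ ψ y v) = 0 ↔ a y v = 0) :
    a' (ψ y) ∘L fderiv ℝ ψ y = conformalFactor a a' ψ y • a y := by
  have hreeb := ha.apply_hamPair fun _ => 1
  have heq := eq_div_smul_of_ker_le_ker (γ := a' (ψ y) ∘L fderiv ℝ ψ y) (fun v => (h v).2)
    (hreeb.trans_ne one_ne_zero)
  rwa [hreeb, div_one] at heq

theorem contDiffAt_conformalFactor (ha : IsContactAt a y) (ha' : ContDiffAt ℝ ∞ a' (ψ y))
    (hψ : ContDiffAt ℝ ∞ ψ y) : ContDiffAt ℝ ∞ (conformalFactor a a' ψ) y :=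
  (ha'.comp y hψ).clm_apply ((hψ.fderiv_right (by simp)).clm_apply
    (ha.contDiffAt_hamPair contDiffAt_const).fst)

end IsContactAt

namespace IsContactGerm

variable {x : F}

theorem apply_eq (h : IsContactGerm a a' j j' ψ x) : ψ (j x) = j' x := h.comm.self_of_nhds

theorem tendsto (h : IsContactGerm a a' j j' ψ x) : Tendsto ψ (𝓝 (j x)) (𝓝 (j' x)) :=
  h.apply_eq ▸ h.smooth.self_of_nhds.continuousAt

theorem eventually_isInvertible [CompleteSpace E] (h : IsContactGerm a a' j j' ψ x) :
    ∀ᶠ y in 𝓝 (j x), (fderiv ℝ ψ y).IsInvertible :=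
  eventually_isInvertible_fderiv (h.smooth.self_of_nhds.of_le (by simp)) h.invertible

protected theorem eventually [CompleteSpace E] (h : IsContactGerm a a' j j' ψ x)
    (hj : ContinuousAt j x) : ∀ᶠ y in 𝓝 x, IsContactGerm a a' j j' ψ y := by
  filter_upwards [hj.eventually h.smooth.eventually_nhds, h.comm.eventually_nhds,
    hj.eventually h.eventually_isInvertible, hj.eventually h.contact.eventually_nhds]
    with y hsmooth hcomm hinv hcontact using ⟨hsmooth, hcomm, hinv, hcontact⟩

theorem fderiv_comp_eq [NormedSpace ℝ F] (h : IsContactGerm a a' j j' ψ x)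
    (hj : DifferentiableAt ℝ j x) : fderiv ℝ ψ (j x) ∘L fderiv ℝ j x = fderiv ℝ j' x := by
  rw [← fderiv_comp x (h.smooth.self_of_nhds.differentiableAt (by simp)) hj]
  exact EventuallyEq.fderiv_eq h.comm

theorem eventually_contDiffAt_conformalFactor [FiniteDimensional ℝ E]
    (h : IsContactGerm a a' j j' ψ x) (ha : ∀ᶠ y in 𝓝 (j x), IsContactAt a y)
    (ha' : ∀ᶠ y in 𝓝 (j' x), ContDiffAt ℝ ∞ a' y) :
    ∀ᶠ y in 𝓝 (j x), ContDiffAt ℝ ∞ (conformalFactor a a' ψ) y := by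
  filter_upwards [ha, h.tendsto.eventually ha', h.smooth] with y hay ha'y hψy
  exact hay.contDiffAt_conformalFactor ha'y hψy

theorem intertwines [FiniteDimensional ℝ E] [FiniteDimensional ℝ E'] {H : E → ℝ} {H' : E' → ℝ}
    (h : IsContactGerm a a' j j' ψ x) (ha : ∀ᶠ y in 𝓝 (j x), IsContactAt a y)
    (ha' : ∀ᶠ y in 𝓝 (j' x), IsContactAt a' y) (hH : ∀ᶠ y in 𝓝 (j x), ContDiffAt ℝ ∞ H y)
    (hH' : ∀ᶠ y in 𝓝 (j' x), ContDiffAt ℝ ∞ H' y)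
    (hHH' : ∀ᶠ y in 𝓝 (j x), H' (ψ y) = conformalFactor a a' ψ y * H y) :
    Intertwines (fun y => (hamPair a H y).1) (fun y => (hamPair a' H' y).1) j j' ψ x := by
  have := FiniteDimensional.complete ℝ E
  have h0 : (∞ : WithTop ℕ∞) ≠ 0 := by simp
  refine ⟨h.smooth, h.comm, ?_⟩
  filter_upwards [(ha.and h.contact).eventually_nhds, h.tendsto.eventually (ha'.and hH'),
    h.eventually_isInvertible, h.smooth, hH, hHH'.eventually_nhds,
    h.eventually_contDiffAt_conformalFactor ha (ha'.mono fun y hy => hy.contDiffAt)]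
    with y hay ⟨ha'y, hH'y⟩ hinv hψy hHy hHH'y hfactor
  exact fderiv_hamPair_eq hay.self_of_nhds.1 ha'y hψy hinv.surjective
    (hfactor.differentiableAt h0) (hay.self_of_nhds.1.conformalFactor_ne_zero hay.self_of_nhds.2)
    (hHy.differentiableAt h0) (hH'y.differentiableAt h0)
    (hay.mono fun z hz => hz.1.pullback_eq_conformalFactor_smul hz.2) hHH'y

end IsContactGerm

end ConformalFactor

/-! ### Transverse contact Hamiltonians along a hypersurface -/

section TransverseHamiltonian

theorem exists_notMem_range_of_finrank_lt {K V W : Type*} [DivisionRing K] [AddCommGroup V]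
    [Module K V] [FiniteDimensional K V] [AddCommGroup W] [Module K W]
    (h : Module.finrank K V < Module.finrank K W) (L : V →ₗ[K] W) : ∃ w, w ∉ range L := by
  obtain ⟨w, -, hw⟩ := SetLike.exists_of_lt
    (Submodule.lt_top_of_finrank_lt_finrank ((LinearMap.finrank_range_le L).trans_lt h))
  exact ⟨w, hw⟩

theorem eventually_injective_and_notMem_range {T E F : Type*} [TopologicalSpace T]
    [NormedAddCommGroup E] [NormedSpace ℝ E] [NormedAddCommGroup F] [NormedSpace ℝ F]
    [FiniteDimensional ℝ F] {L : T → F →L[ℝ] E} {X : T → E} {p : T} (hL : ContinuousAt L p)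
    (hX : ContinuousAt X p) (hinj : Function.Injective (L p)) (hp : X p ∉ range (L p)) :
    ∀ᶠ y in 𝓝 p, Function.Injective (L y) ∧ X y ∉ range (L y) := by
  let M : T → F × ℝ →L[ℝ] E := fun y =>
    L y ∘L .fst ℝ F ℝ + (ContinuousLinearMap.snd ℝ F ℝ).smulRight (X y)
  have hM : ∀ y w, M y w = L y w.1 + w.2 • X y := fun y w => rfl
  have hM_cont : ContinuousAt M p :=
    (hL.clm_comp continuousAt_const).add
      ((ContinuousLinearMap.smulRightL ℝ (F × ℝ) E (.snd ℝ F ℝ)).continuous.continuousAt.comp hX)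
  have hMp : Function.Injective (M p) := injective_add_smul (L := (L p : F →ₗ[ℝ] E)) hinj hp
  filter_upwards [hM_cont.eventually (ContinuousLinearMap.isOpen_injective.mem_nhds hMp)]
    with y hMy
  refine ⟨fun v w hvw => ?_, ?_⟩
  · have hMvw : M y (v, 0) = M y (w, 0) := by simp [hM, hvw]
    exact (Prod.mk.inj (hMy hMvw)).1
  · rintro ⟨v, hv⟩
    have hMv : M y (-v, 1) = M y (0, 0) := by simp [hM, hv]
    exact one_ne_zero (Prod.mk.inj (hMy hMv)).2

theorem IsContactAt.exists_hamPair_eq {E : Type*} [NormedAddCommGroup E] [NormedSpace ℝ E]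
    [FiniteDimensional ℝ E] {a : E → E →L[ℝ] ℝ} {q : E} (ha : IsContactAt a q) (e : E) :
    ∃ H : E → ℝ, ContDiff ℝ ∞ H ∧ (hamPair a H q).1 = e := by
  let D : E →L[ℝ] ℝ := fderiv ℝ a q e - (fderiv ℝ a q).flip e
  have hD : ∀ v, D v = dOne a q e v := fun v => rfl
  refine ⟨fun y => a q e - D (y - q),
    contDiff_const.sub (D.contDiff.comp (contDiff_id.sub contDiff_const)), ?_⟩
  have hderiv : fderiv ℝ (fun y => a q e - D (y - q)) q = -D := by
    rw [fderiv_const_sub, fderiv_comp_sub (f := D) q, D.fderiv]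
  rw [ha.eq_hamPair (Z := e) (ρ := 0) (by simp) fun v => ?_]
  rw [hderiv, neg_apply, hD]
  ring

variable {E E' F : Type*} [NormedAddCommGroup E] [NormedSpace ℝ E]
  [NormedAddCommGroup E'] [NormedSpace ℝ E'] [NormedAddCommGroup F] [NormedSpace ℝ F]

/-- Data along the germs at `x` of two immersed hypersurfaces `j` and `j'`: contact forms `a` and
`a'` near `j x` and `j' x` whose pullbacks to `F` differ by the nonvanishing factor `f`, and a
Hamiltonian `H` on the side of `a` whose contact vector field is transverse to `j`. -/
structure IsTransversePair (a : E → E →L[ℝ] ℝ) (a' : E' → E' →L[ℝ] ℝ) (j : F → E) (j' : F → E')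
    (f : F → ℝ) (H : E → ℝ) (x : F) : Prop where
  contact : ∀ᶠ y in 𝓝 (j x), IsContactAt a y
  contact' : ∀ᶠ y in 𝓝 (j' x), IsContactAt a' y
  smooth : ∀ᶠ y in 𝓝 x, ContDiffAt ℝ ∞ j y
  smooth' : ∀ᶠ y in 𝓝 x, ContDiffAt ℝ ∞ j' y
  injective : Function.Injective (fderiv ℝ j x)
  injective' : Function.Injective (fderiv ℝ j' x)
  factor : ∀ᶠ y in 𝓝 x, ContDiffAt ℝ ∞ f y ∧ f y ≠ 0 ∧
    a' (j' y) ∘L fderiv ℝ j' y = f y • (a (j y) ∘L fderiv ℝ j y)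
  hamiltonian : ∀ᶠ y in 𝓝 (j x), ContDiffAt ℝ ∞ H y
  transverse : (hamPair a H (j x)).1 ∉ range (fderiv ℝ j x)

theorem eventually_contDiffAt_pullback {a : E → E →L[ℝ] ℝ} {j : F → E} {x : F}
    (ha : ∀ᶠ y in 𝓝 (j x), IsContactAt a y) (hj : ∀ᶠ y in 𝓝 x, ContDiffAt ℝ ∞ j y) :
    ∀ᶠ y in 𝓝 x, ContDiffAt ℝ ∞ (fun y => a (j y) ∘L fderiv ℝ j y) y := by
  filter_upwards [hj.self_of_nhds.continuousAt.eventually ha, hj] with y hay hjy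
  exact (hay.contDiffAt.comp y hjy).clm_comp (hjy.fderiv_right (by simp))

section

variable {a : E → E →L[ℝ] ℝ} {a' : E' → E' →L[ℝ] ℝ} {j : F → E} {j' : F → E'} {f : F → ℝ}
  {H : E → ℝ} {x : F}

theorem IsTransversePair.continuousAt (h : IsTransversePair a a' j j' f H x) : ContinuousAt j x :=
  h.smooth.self_of_nhds.continuousAt

theorem IsTransversePair.continuousAt' (h : IsTransversePair a a' j j' f H x) : ContinuousAt j' x :=
  h.smooth'.self_of_nhds.continuousAt

theorem IsTransversePair.eventually_contDiffAt_factor_mul (h : IsTransversePair a a' j j' f H x) :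
    ∀ᶠ y in 𝓝 x, ContDiffAt ℝ ∞ (fun y => f y * H (j y)) y := by
  filter_upwards [h.factor, h.smooth, h.continuousAt.eventually h.hamiltonian] with y hfy hjy hHy
    using hfy.1.mul (hHy.comp y hjy)

end

variable [FiniteDimensional ℝ E]

theorem eventually_contDiffAt_hamPair {a : E → E →L[ℝ] ℝ} {H : E → ℝ} {q : E}
    (ha : ∀ᶠ y in 𝓝 q, IsContactAt a y) (hH : ∀ᶠ y in 𝓝 q, ContDiffAt ℝ ∞ H y) :
    ∀ᶠ y in 𝓝 q, ContDiffAt ℝ ∞ (fun y => (hamPair a H y).1) y := by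
  filter_upwards [ha, hH] with y hay hHy using (hay.contDiffAt_hamPair hHy).fst

variable [FiniteDimensional ℝ F]

theorem exists_isTransversePair [FiniteDimensional ℝ E']
    (hdim : Module.finrank ℝ E = Module.finrank ℝ F + 1)
    (hdim' : Module.finrank ℝ E' = Module.finrank ℝ F + 1)
    {a : E → E →L[ℝ] ℝ} {a' : E' → E' →L[ℝ] ℝ} {j : F → E} {j' : F → E'} {x : F}
    (ha : ∀ᶠ y in 𝓝 (j x), IsContactAt a y) (ha' : ∀ᶠ y in 𝓝 (j' x), IsContactAt a' y)
    (hj : ∀ᶠ y in 𝓝 x, ContDiffAt ℝ ∞ j y) (hj' : ∀ᶠ y in 𝓝 x, ContDiffAt ℝ ∞ j' y)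
    (hinj : Function.Injective (fderiv ℝ j x)) (hinj' : Function.Injective (fderiv ℝ j' x))
    (hker : ∀ᶠ y in 𝓝 x, ∀ v, a (j y) (fderiv ℝ j y v) = 0 ↔ a' (j' y) (fderiv ℝ j' y v) = 0) :
    ∃ f H, IsTransversePair a a' j j' f H x := by
  have := FiniteDimensional.complete ℝ F
  obtain ⟨f, hf⟩ := exists_smooth_factor (eventually_contDiffAt_pullback ha hj)
    (eventually_contDiffAt_pullback ha' hj')
    (ha.self_of_nhds.nondegenerateZeros_pullback hdim hj.self_of_nhds hinj)
    (ha'.self_of_nhds.nondegenerateZeros_pullback hdim' hj'.self_of_nhds hinj') hker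
  obtain ⟨e, he⟩ := exists_notMem_range_of_finrank_lt (by omega) (fderiv ℝ j x : F →ₗ[ℝ] E)
  obtain ⟨H, hH, rfl⟩ := ha.self_of_nhds.exists_hamPair_eq e
  exact ⟨f, H, ha, ha', hj, hj', hinj, hinj', hf, .of_forall fun _ => hH.contDiffAt, he⟩

namespace IsTransversePair

variable {a : E → E →L[ℝ] ℝ} {a' : E' → E' →L[ℝ] ℝ} {j : F → E} {j' : F → E'} {f : F → ℝ}
  {H : E → ℝ} {x : F}

protected theorem eventually (h : IsTransversePair a a' j j' f H x) :
    ∀ᶠ y in 𝓝 x, IsTransversePair a a' j j' f H y := by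
  have hdj : ContinuousAt (fderiv ℝ j) x :=
    (h.smooth.self_of_nhds.fderiv_right (m := 0) (by simp)).continuousAt
  have hdj' : ContinuousAt (fderiv ℝ j') x :=
    (h.smooth'.self_of_nhds.fderiv_right (m := 0) (by simp)).continuousAt
  have hX : ContinuousAt (fun y => (hamPair a H y).1) (j x) :=
    (eventually_contDiffAt_hamPair h.contact h.hamiltonian).self_of_nhds.continuousAt
  filter_upwards [h.continuousAt.eventually (h.contact.and h.hamiltonian).eventually_nhds,
    h.continuousAt'.eventually h.contact'.eventually_nhds, h.smooth.eventually_nhds,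
    h.smooth'.eventually_nhds, h.factor.eventually_nhds,
    eventually_injective_and_notMem_range hdj
      (ContinuousAt.comp (g := fun y => (hamPair a H y).1) hX h.continuousAt)
      h.injective h.transverse,
    hdj'.eventually (ContinuousLinearMap.isOpen_injective.mem_nhds h.injective')]
    with y haH ha' hj hj' hf htr hinj'
  exact ⟨haH.mono fun z hz => hz.1, ha', hj, hj', htr.1, hinj', hf, haH.mono fun z hz => hz.2,
    htr.2⟩

theorem conformalFactor_eq [Nontrivial F] (hdim : Module.finrank ℝ E = Module.finrank ℝ F + 1)
    {ψ : E → E'} (h : IsTransversePair a a' j j' f H x) (hψ : IsContactGerm a a' j j' ψ x) :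
    conformalFactor a a' ψ (j x) = f x := by
  have := FiniteDimensional.complete ℝ E
  have hfactor : ContinuousAt (conformalFactor a a' ψ) (j x) :=
    (hψ.eventually_contDiffAt_conformalFactor h.contact
      (h.contact'.mono fun y hy => hy.contDiffAt)).self_of_nhds.continuousAt
  refine (h.contact.self_of_nhds.nondegenerateZeros_pullback hdim h.smooth.self_of_nhds
    h.injective).factor_unique (ContinuousAt.comp (g := conformalFactor a a' ψ) hfactor
      h.continuousAt) h.factor.self_of_nhds.1.continuousAt ?_
  filter_upwards [hψ.eventually h.continuousAt, h.smooth, h.factor,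
    h.continuousAt.eventually h.contact] with y hψy hjy hfy hay
  rw [← hfy.2.2, ← hψy.fderiv_comp_eq (hjy.differentiableAt (by simp)), ← hψy.apply_eq,
    ← ContinuousLinearMap.comp_assoc,
    hay.pullback_eq_conformalFactor_smul hψy.contact.self_of_nhds, ContinuousLinearMap.smul_comp]
  rfl

variable [FiniteDimensional ℝ E']

theorem exists_isContactGerm (hdim : Module.finrank ℝ E = Module.finrank ℝ F + 1)
    (hdim' : Module.finrank ℝ E' = Module.finrank ℝ F + 1) {H' : E' → ℝ}
    (h : IsTransversePair a a' j j' f H x) (hH' : ∀ᶠ y in 𝓝 (j' x), ContDiffAt ℝ ∞ H' y)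
    (hHH' : ∀ᶠ y in 𝓝 x, H' (j' y) = f y * H (j y)) :
    ∃ ψ, Intertwines (fun y => (hamPair a H y).1) (fun y => (hamPair a' H' y).1) j j' ψ x ∧
      IsContactGerm a a' j j' ψ x := by
  have := FiniteDimensional.complete ℝ E
  have := FiniteDimensional.complete ℝ E'
  have := FiniteDimensional.complete ℝ F
  have h0 : (∞ : WithTop ℕ∞) ≠ 0 := by simp
  have hf0 : ∀ᶠ y in 𝓝 x, f y ≠ 0 := h.factor.mono fun y hy => hy.2.1
  have haa' := h.factor.mono fun y hy => hy.2.2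
  have htransverse' : (hamPair a' H' (j' x)).1 ∉ range (fderiv ℝ j' x) := fun hmem =>
    h.transverse (hamPair_mem_range_of_mem_range hdim h.contact.self_of_nhds
      h.contact'.self_of_nhds h.smooth.self_of_nhds h.smooth'.self_of_nhds h.injective
      (h.hamiltonian.self_of_nhds.differentiableAt h0) (hH'.self_of_nhds.differentiableAt h0)
      (h.factor.self_of_nhds.1.differentiableAt h0) hf0.self_of_nhds haa' hHH' hmem)
  obtain ⟨Φ, hΦ⟩ := exists_isFlowOut
    (eventually_contDiffAt_hamPair h.contact h.hamiltonian) h.smooth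
  obtain ⟨Φ', hΦ'⟩ := exists_isFlowOut (eventually_contDiffAt_hamPair h.contact' hH') h.smooth'
  have hinv := hΦ.isInvertible_fderiv hdim h.injective h.transverse
  obtain ⟨ψ, hψ⟩ := exists_smooth_eventually_comp_eq hΦ.smooth hinv hΦ'.smooth
  exact ⟨ψ, hΦ.intertwines hinv hΦ' hψ, hΦ.isContactGerm hΦ' hinv
    (hΦ'.isInvertible_fderiv hdim' h.injective' htransverse') hψ h.continuousAt h.continuousAt'
    h.contact h.contact' h.hamiltonian hH' hf0 haa' hHH'⟩

theorem germ_unique (hdim : Module.finrank ℝ E = Module.finrank ℝ F + 1) {H' : E' → ℝ}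
    (h : IsTransversePair a a' j j' f H x) (hH' : ∀ᶠ y in 𝓝 (j' x), ContDiffAt ℝ ∞ H' y)
    {ψ ψ' : E → E'}
    (hψ : Intertwines (fun y => (hamPair a H y).1) (fun y => (hamPair a' H' y).1) j j' ψ x)
    (hψ' : Intertwines (fun y => (hamPair a H y).1) (fun y => (hamPair a' H' y).1) j j' ψ' x) :
    ψ =ᶠ[𝓝 (j x)] ψ' :=
  hψ.germ_unique hdim hψ' (eventually_contDiffAt_hamPair h.contact h.hamiltonian)
    (eventually_contDiffAt_hamPair h.contact' hH') h.smooth h.injective h.transverse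

end IsTransversePair

end TransverseHamiltonian

/-! ### Local extension of germs of contactomorphisms -/

section LocalExtension

theorem exists_smooth_extension_rel {E : Type*} [NormedAddCommGroup E] [NormedSpace ℝ E]
    [FiniteDimensional ℝ E] {A K S : Set E} {v h : E → ℝ} (hA : IsCompact A)
    (hv : ∀ x ∈ K, ∀ᶠ y in 𝓝 x, ContDiffAt ℝ ∞ v y)
    (hh : ∀ x ∈ A, ∀ᶠ y in 𝓝 x, ContDiffAt ℝ ∞ h y)
    (hvh : ∀ x ∈ A, ∀ᶠ y in 𝓝 x, y ∈ S → h y = v y) :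
    ∃ H : E → ℝ, (∀ x ∈ K, ∀ᶠ y in 𝓝 x, ContDiffAt ℝ ∞ H y) ∧ EqOn H v S ∧
      ∀ x ∈ A, H =ᶠ[𝓝 x] h := by
  let O : Set E := {x | ∀ᶠ y in 𝓝 x, ContDiffAt ℝ ∞ h y ∧ (y ∈ S → h y = v y)}
  have hO : IsOpen O := isOpen_iff_mem_nhds.2 fun x hx => hx.eventually_nhds
  obtain ⟨T, hT, hAT, hTO⟩ := exists_compact_between hA hO fun x hx => (hh x hx).and (hvh x hx)
  obtain ⟨χ, hχ_one, hχ_zero, -⟩ := exists_contMDiffMap_one_nhds_of_subset_interior 𝓘(ℝ, E)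
    hA.isClosed hAT (n := ⊤)
  have hχ : ContDiff ℝ ∞ χ := contMDiff_iff_contDiff.1 χ.contMDiff
  have hoff : ∀ x ∉ T, χ x * h x + (1 - χ x) * v x = v x := fun x hx => by
    rw [hχ_zero x hx, zero_mul, sub_zero, one_mul, zero_add]
  refine ⟨fun x => χ x * h x + (1 - χ x) * v x, fun x hx => ?_, fun x hxS => ?_, fun x hx => ?_⟩
  · filter_upwards [hv x hx] with y hvy
    by_cases hyT : y ∈ T
    · exact (hχ.contDiffAt.mul (hTO hyT).self_of_nhds.1).add
        ((contDiffAt_const.sub hχ.contDiffAt).mul hvy)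
    · refine hvy.congr_of_eventuallyEq ?_
      filter_upwards [hT.isClosed.isOpen_compl.mem_nhds hyT] with z hz using hoff z hz
  · by_cases hxT : x ∈ T
    · have hxhv : h x = v x := (hTO hxT).self_of_nhds.2 hxS
      simp only [hxhv]
      ring
    · exact hoff x hxT
  · filter_upwards [hχ_one.filter_mono (nhds_le_nhdsSet hx)] with y hy
    rw [hy, one_mul, sub_self, zero_mul, add_zero]

section Pushforward

variable {T E G V : Type*} [TopologicalSpace T] [NormedAddCommGroup E] [NormedSpace ℝ E]
  [CompleteSpace E] [NormedAddCommGroup G] [NormedSpace ℝ G] [NormedAddCommGroup V]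
  [NormedSpace ℝ V]

theorem exists_smooth_local_inverse {ψ : E → G} {p : E}
    (hψ : ∀ᶠ y in 𝓝 p, ContDiffAt ℝ ∞ ψ y) (hinv : (fderiv ℝ ψ p).IsInvertible) :
    ∃ σ : G → E, (∀ᶠ y in 𝓝 p, σ (ψ y) = y) ∧
      ∀ᶠ q in 𝓝 (ψ p), ContDiffAt ℝ ∞ σ q ∧ ψ (σ q) = q := by
  obtain ⟨e, hp, heψ, -, hsymm⟩ := exists_openPartialHomeomorph_of_isInvertible_fderiv hψ hinv
  obtain rfl : ⇑e = ψ := funext heψ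
  refine ⟨e.symm, e.eventually_left_inverse hp, ?_⟩
  filter_upwards [e.open_target.mem_nhds (e.map_source hp)] with q hq
    using ⟨hsymm q hq, e.right_inv hq⟩

theorem exists_smooth_pushforward {j : T → E} {j' : T → G} {ψ : E → G} {g : E → V}
    (hj : Continuous j) (hj' : IsInducing j')
    (hψ : ∀ x, ∀ᶠ y in 𝓝 (j x), ContDiffAt ℝ ∞ ψ y)
    (hinv : ∀ x, (fderiv ℝ ψ (j x)).IsInvertible) (hcomm : ∀ x, ψ (j x) = j' x)
    (hg : ∀ x, ∀ᶠ y in 𝓝 (j x), ContDiffAt ℝ ∞ g y) :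
    ∃ h : G → V, (∀ x, ∀ᶠ q in 𝓝 (j' x), ContDiffAt ℝ ∞ h q) ∧
      ∀ x, ∀ᶠ y in 𝓝 (j x), h (ψ y) = g y := by
  choose σ hσψ hψσ using fun x => exists_smooth_local_inverse (hψ x) (hinv x)
  simp only [hcomm] at hψσ
  have hψ_tendsto : ∀ x, Tendsto ψ (𝓝 (j x)) (𝓝 (j' x)) := fun x =>
    hcomm x ▸ (hψ x).self_of_nhds.continuousAt
  have hσj' : ∀ x, σ x (j' x) = j x := fun x => hcomm x ▸ (hσψ x).self_of_nhds
  have hσ_tendsto : ∀ x, Tendsto (σ x) (𝓝 (j' x)) (𝓝 (j x)) := fun x =>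
    hσj' x ▸ (hψσ x).self_of_nhds.1.continuousAt
  have hcoherent : ∀ x, ∀ᶠ w in 𝓝 x, g ∘ σ w =ᶠ[𝓝 (j' w)] g ∘ σ x := fun x => by
    filter_upwards [hj.continuousAt.eventually (hσψ x).eventually_nhds] with w hw
    filter_upwards [(hσ_tendsto w).eventually hw, hψσ w] with q hσq hψq
    rw [hψq.2] at hσq
    simp only [Function.comp_apply, hσq]
  obtain ⟨h, hh⟩ := exists_eventuallyEq_of_coherent hj' (fun x => g ∘ σ x) hcoherent
  refine ⟨h, fun x => ?_, fun x => ?_⟩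
  · filter_upwards [(hh x).eventuallyEq_nhds, hψσ x, (hσ_tendsto x).eventually (hg x)]
      with q hhq hσq hgq
    exact (hgq.comp q hσq.1).congr_of_eventuallyEq hhq
  · filter_upwards [(hψ_tendsto x).eventually (hh x), hσψ x] with y hhy hσy
    rw [hhy, Function.comp_apply, hσy]

end Pushforward

variable {E F : Type*} [NormedAddCommGroup E] [NormedSpace ℝ E] [FiniteDimensional ℝ E]
  [NormedAddCommGroup F] [NormedSpace ℝ F] [FiniteDimensional ℝ F]

/-- A given germ `Ψ` of contactomorphisms along `A` determines the Hamiltonian on the target near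
`A × {0}`, and on the hypersurface it is determined by the factor `f`; the assumption on
conformal factors says that the two prescriptions agree. -/
theorem exists_target_hamiltonian {a : E → E →L[ℝ] ℝ} {a' : F × ℝ → F × ℝ →L[ℝ] ℝ} {j : F → E}
    {f : F → ℝ} {H : E → ℝ} {Ψ : E → F × ℝ} {A K : Set F} (hA : IsCompact A) (hAK : A ⊆ K)
    (hpair : ∀ x ∈ K, IsTransversePair a a' j (fun y => (y, 0)) f H x)
    (hΨ : ∀ x ∈ A, IsContactGerm a a' j (fun y => (y, 0)) Ψ x)
    (hfactor : ∀ x ∈ A, ∀ᶠ y in 𝓝 x, conformalFactor a a' Ψ (j y) = f y) :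
    ∃ H' : F × ℝ → ℝ, (∀ x ∈ K, ∀ᶠ q in 𝓝 (x, (0 : ℝ)), ContDiffAt ℝ ∞ H' q) ∧
      (∀ y, H' (y, 0) = f y * H (j y)) ∧
      ∀ x ∈ A, ∀ᶠ y in 𝓝 (j x), H' (Ψ y) = conformalFactor a a' Ψ y * H y := by
  have := FiniteDimensional.complete ℝ E
  have hfst : ∀ x : F, Tendsto Prod.fst (𝓝 (x, (0 : ℝ))) (𝓝 x) := fun x => continuousAt_fst
  have hg : ∀ x ∈ A, ∀ᶠ y in 𝓝 (j x),
      ContDiffAt ℝ ∞ (fun y => conformalFactor a a' Ψ y * H y) y := fun x hx => by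
    have hx_pair := hpair x (hAK hx)
    filter_upwards [(hΨ x hx).eventually_contDiffAt_conformalFactor hx_pair.contact
      (hx_pair.contact'.mono fun y hy => hy.contDiffAt), hx_pair.hamiltonian] with y hcy hHy
      using hcy.mul hHy
  obtain ⟨h, hh, hhΨ⟩ := exists_smooth_pushforward (T := A) (j := fun x => j x)
    (j' := fun x => ((x : F), (0 : ℝ)))
    (continuous_iff_continuousAt.2 fun x => (hpair x (hAK x.2)).continuousAt.comp
      continuousAt_subtype_val)
    ((isEmbedding_prodMkLeft (0 : ℝ)).isInducing.comp IsInducing.subtypeVal)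
    (fun x => (hΨ x x.2).smooth) (fun x => (hΨ x x.2).invertible)
    (fun x => (hΨ x x.2).apply_eq) (fun x => hg x x.2)
  have hhv : ∀ x ∈ A, ∀ᶠ y in 𝓝 x, h (y, 0) = f y * H (j y) := fun x hx => by
    filter_upwards [(hpair x (hAK hx)).continuousAt.eventually (hhΨ ⟨x, hx⟩), (hΨ x hx).comm,
      hfactor x hx] with y hhy hcomm hcy
    rw [← hcomm, hhy, hcy]
  obtain ⟨H', hH', hH'v, hH'h⟩ := exists_smooth_extension_rel (A := A ×ˢ {(0 : ℝ)})
    (K := K ×ˢ {(0 : ℝ)}) (S := {q | q.2 = 0}) (v := fun q => f q.1 * H (j q.1)) (h := h)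
    (hA.prod isCompact_singleton)
    (by
      rintro ⟨x, _⟩ ⟨hx, rfl⟩
      filter_upwards [(hfst x).eventually (hpair x hx).eventually_contDiffAt_factor_mul] with q hq
        using hq.comp q contDiffAt_fst)
    (by
      rintro ⟨x, _⟩ ⟨hx, rfl⟩
      exact hh ⟨x, hx⟩)
    (by
      rintro ⟨x, _⟩ ⟨hx, rfl⟩
      filter_upwards [(hfst x).eventually (hhv x hx)]
      rintro ⟨y, _⟩ hy rfl
      exact hy)
  refine ⟨H', fun x hx => hH' (x, 0) ⟨hx, rfl⟩, fun y => hH'v (x := (y, 0)) rfl, fun x hx => ?_⟩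
  filter_upwards [(hΨ x hx).tendsto.eventually (hH'h (x, 0) ⟨hx, rfl⟩), hhΨ ⟨x, hx⟩]
    with y hH'y hhy
  rw [hH'y, hhy]

theorem IsTransversePair.exists_coherent_isContactGerm {E' : Type*} [NormedAddCommGroup E']
    [NormedSpace ℝ E'] [FiniteDimensional ℝ E']
    (hdim : Module.finrank ℝ E = Module.finrank ℝ F + 1)
    (hdim' : Module.finrank ℝ E' = Module.finrank ℝ F + 1)
    {a : E → E →L[ℝ] ℝ} {a' : E' → E' →L[ℝ] ℝ} {j : F → E} {j' : F → E'} {f : F → ℝ}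
    {H : E → ℝ} {H' : E' → ℝ} {K : Set F} (hpair : ∀ x ∈ K, IsTransversePair a a' j j' f H x)
    (hH' : ∀ x ∈ K, ∀ᶠ y in 𝓝 (j' x), ContDiffAt ℝ ∞ H' y)
    (hHH' : ∀ y, H' (j' y) = f y * H (j y)) :
    ∃ ψ : F → E → E', ∀ x ∈ K, IsContactGerm a a' j j' (ψ x) x ∧
      (∀ᶠ y in 𝓝[K] x, ψ y =ᶠ[𝓝 (j y)] ψ x) ∧
      ∀ Ψ, Intertwines (fun y => (hamPair a H y).1) (fun y => (hamPair a' H' y).1) j j' Ψ x →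
        ψ x =ᶠ[𝓝 (j x)] Ψ := by
  choose! ψ hψ using fun x (hx : x ∈ K) =>
    (hpair x hx).exists_isContactGerm hdim hdim' (hH' x hx) (.of_forall hHH')
  refine ⟨ψ, fun x hx => ⟨(hψ x hx).2, ?_, fun Ψ hΨ =>
    (hpair x hx).germ_unique hdim (hH' x hx) (hψ x hx).1 hΨ⟩⟩
  filter_upwards [((hψ x hx).1.eventually (hpair x hx).continuousAt).filter_mono
    nhdsWithin_le_nhds, self_mem_nhdsWithin] with y hxy hy
  exact (hpair y hy).germ_unique hdim (hH' y hy) (hψ y hy).1 hxy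

theorem hasRelativeGermExtension_of_isTransversePair
    (hdim : Module.finrank ℝ E = Module.finrank ℝ F + 1)
    {a : E → E →L[ℝ] ℝ} {a' : F × ℝ → F × ℝ →L[ℝ] ℝ} {j : F → E} {f : F → ℝ} {H : E → ℝ}
    {K : Set F} (hpair : ∀ x ∈ K, IsTransversePair a a' j (fun y => (y, 0)) f H x) :
    HasRelativeGermExtension j (IsContactGerm a a' j fun y => (y, 0)) K := by
  intro A hAK hA Ψ hΨ
  have := FiniteDimensional.complete ℝ E
  -- On a point the two conformal factors need not agree, but there a single germ suffices.
  by_cases hpoint : Subsingleton F ∧ A.Nonempty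
  · obtain ⟨hF, x₀, hx₀⟩ := hpoint
    exact ⟨fun _ => Ψ, fun x _ => Subsingleton.elim x₀ x ▸ hΨ x₀ hx₀,
      fun x _ => .of_forall fun _ => .rfl, fun _ _ => .rfl⟩
  have hfactor : ∀ x ∈ A, ∀ᶠ y in 𝓝 x, conformalFactor a a' Ψ (j y) = f y := fun x hx => by
    have : Nontrivial F := (subsingleton_or_nontrivial F).resolve_left fun h => hpoint ⟨h, x, hx⟩
    filter_upwards [(hpair x (hAK hx)).eventually,
      (hΨ x hx).eventually (hpair x (hAK hx)).continuousAt] with y hy hΨy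
    exact hy.conformalFactor_eq hdim hΨy
  obtain ⟨H', hH', hHH', hH'Ψ⟩ := exists_target_hamiltonian hA hAK hpair hΨ hfactor
  obtain ⟨ψ, hψ⟩ := IsTransversePair.exists_coherent_isContactGerm hdim (by simp) hpair hH' hHH'
  refine ⟨ψ, fun x hx => (hψ x hx).1, fun x hx => (hψ x hx).2.1, fun x hx => ?_⟩
  have hx_pair := hpair x (hAK hx)
  exact (hψ x (hAK hx)).2.2 Ψ ((hΨ x hx).intertwines hx_pair.contact hx_pair.contact'
    hx_pair.hamiltonian (hH' x (hAK hx)) (hH'Ψ x hx))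

theorem exists_hasRelativeGermExtension (hdim : Module.finrank ℝ E = Module.finrank ℝ F + 1)
    {a : E → E →L[ℝ] ℝ} {a' : F × ℝ → F × ℝ →L[ℝ] ℝ} {j : F → E} {p : F}
    (ha : ∀ᶠ y in 𝓝 (j p), IsContactAt a y) (ha' : ∀ᶠ q in 𝓝 (p, (0 : ℝ)), IsContactAt a' q)
    (hj : ∀ᶠ y in 𝓝 p, ContDiffAt ℝ ∞ j y) (hinj : Function.Injective (fderiv ℝ j p))
    (hker : ∀ᶠ y in 𝓝 p, ∀ v, a (j y) (fderiv ℝ j y v) = 0 ↔ a' (y, 0) (v, 0) = 0)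
    {V : Set F} (hV : V ∈ 𝓝 p) :
    ∃ K ∈ 𝓝 p, IsCompact K ∧ K ⊆ V ∧
      HasRelativeGermExtension j (IsContactGerm a a' j fun y => (y, 0)) K := by
  have := FiniteDimensional.proper ℝ F
  have hj' : ContDiff ℝ ∞ fun y : F => (y, (0 : ℝ)) := contDiff_id.prodMk contDiff_const
  have hj'_fderiv : ∀ y : F, fderiv ℝ (fun y => (y, (0 : ℝ))) y = .inl ℝ F ℝ := fun y =>
    (hasFDerivAt_prodMk_left y (0 : ℝ)).fderiv
  obtain ⟨f, H, hpair⟩ := exists_isTransversePair hdim (by simp) ha ha' hj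
    (.of_forall fun y => hj'.contDiffAt) hinj
    (by rw [hj'_fderiv]; exact Prod.mk_left_injective 0)
    (by simpa only [hj'_fderiv, ContinuousLinearMap.inl_apply] using hker)
  obtain ⟨K, hKp, hK_sub, hK⟩ := local_compact_nhds (inter_mem hV hpair.eventually)
  exact ⟨K, hKp, hK, fun x hx => (hK_sub hx).1,
    hasRelativeGermExtension_of_isTransversePair hdim fun x hx => (hK_sub hx).2⟩

end LocalExtension

/-! ### Partial diffeomorphisms and germs of maps preserving distributions -/

section DistributionGerm

variable {E : Type*} [NormedAddCommGroup E] [NormedSpace ℝ E]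
  {H : Type*} [TopologicalSpace H] {I : ModelWithCorners ℝ E H}
  {M : Type*} [TopologicalSpace M] [ChartedSpace H M]
  {E' : Type*} [NormedAddCommGroup E'] [NormedSpace ℝ E']
  {H' : Type*} [TopologicalSpace H'] {I' : ModelWithCorners ℝ E' H'}
  {M' : Type*} [TopologicalSpace M'] [ChartedSpace H' M']
  {E'' : Type*} [NormedAddCommGroup E''] [NormedSpace ℝ E'']
  {H'' : Type*} [TopologicalSpace H''] {I'' : ModelWithCorners ℝ E'' H''}
  {M'' : Type*} [TopologicalSpace M''] [ChartedSpace H'' M'']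
  {T : Type*} [TopologicalSpace T]

/-- The manifold derivative of `f` at `x`. Its type mentions the model spaces rather than the
tangent spaces, so that derivatives at points which are only propositionally equal compose. -/
noncomputable def modelDeriv (I : ModelWithCorners ℝ E H) (I' : ModelWithCorners ℝ E' H')
    (f : M → M') (x : M) : E →L[ℝ] E' :=
  mfderiv I I' f x

theorem modelDeriv_comp {g : M' → M''} {f : M → M'} {x : M}
    (hg : ContMDiffAt I' I'' ∞ g (f x)) (hf : ContMDiffAt I I' ∞ f x) :
    modelDeriv I I'' (g ∘ f) x = modelDeriv I' I'' g (f x) ∘L modelDeriv I I' f x :=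
  mfderiv_comp x (hg.mdifferentiableAt (by simp)) (hf.mdifferentiableAt (by simp))

theorem modelDeriv_congr {f g : M → M'} {x : M} (h : f =ᶠ[𝓝 x] g) :
    modelDeriv I I' f x = modelDeriv I I' g x :=
  h.mfderiv_eq

theorem modelDeriv_of_eventuallyEq_id {f : M → M} {x : M} (h : f =ᶠ[𝓝 x] id) :
    modelDeriv I I f x = .id ℝ E :=
  h.mfderiv_eq.trans mfderiv_id

theorem modelDeriv_eq_fderiv (f : E → E') (x : E) :
    modelDeriv 𝓘(ℝ, E) 𝓘(ℝ, E') f x = fderiv ℝ f x :=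
  mfderiv_eq_fderiv

/-- The partial homeomorphism `e` is smooth with smooth inverse. Mathlib's `PartialDiffeomorph` is
the bundled version; the predicate gives access to the API of `OpenPartialHomeomorph`. -/
structure IsPartialDiffeomorph (I : ModelWithCorners ℝ E H) (I' : ModelWithCorners ℝ E' H')
    (e : OpenPartialHomeomorph M M') : Prop where
  contMDiffOn : ContMDiffOn I I' ∞ e e.source
  contMDiffOn_symm : ContMDiffOn I' I ∞ e.symm e.target

namespace IsPartialDiffeomorph

variable {e : OpenPartialHomeomorph M M'}

theorem symm (he : IsPartialDiffeomorph I I' e) : IsPartialDiffeomorph I' I e.symm :=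
  ⟨he.contMDiffOn_symm, he.contMDiffOn⟩

theorem trans (he : IsPartialDiffeomorph I I' e) {e' : OpenPartialHomeomorph M' M''}
    (he' : IsPartialDiffeomorph I' I'' e') : IsPartialDiffeomorph I I'' (e.trans e') :=
  ⟨he'.contMDiffOn.comp (he.contMDiffOn.mono inter_subset_left) inter_subset_right,
    he.contMDiffOn_symm.comp (he'.contMDiffOn_symm.mono inter_subset_left) inter_subset_right⟩

theorem contMDiffAt (he : IsPartialDiffeomorph I I' e) {x : M} (hx : x ∈ e.source) :
    ContMDiffAt I I' ∞ e x :=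
  he.contMDiffOn.contMDiffAt (e.open_source.mem_nhds hx)

theorem contMDiffAt_symm (he : IsPartialDiffeomorph I I' e) {y : M'} (hy : y ∈ e.target) :
    ContMDiffAt I' I ∞ e.symm y :=
  he.symm.contMDiffAt hy

theorem modelDeriv_symm_comp (he : IsPartialDiffeomorph I I' e) {x : M} (hx : x ∈ e.source) :
    modelDeriv I' I e.symm (e x) ∘L modelDeriv I I' e x = .id ℝ E := by
  rw [← modelDeriv_comp (he.contMDiffAt_symm (e.map_source hx)) (he.contMDiffAt hx)]
  exact modelDeriv_of_eventuallyEq_id (e.eventually_left_inverse hx)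

theorem modelDeriv_symm_apply (he : IsPartialDiffeomorph I I' e) {x : M} (hx : x ∈ e.source)
    (v : E) : modelDeriv I' I e.symm (e x) (modelDeriv I I' e x v) = v :=
  DFunLike.congr_fun (he.modelDeriv_symm_comp hx) v

theorem modelDeriv_apply_symm (he : IsPartialDiffeomorph I I' e) {x : M} (hx : x ∈ e.source)
    (w : E') : modelDeriv I I' e x (modelDeriv I' I e.symm (e x) w) = w := by
  have := he.symm.modelDeriv_symm_apply (e.map_source hx) w
  simpa only [OpenPartialHomeomorph.symm_symm, e.left_inv hx] using this

theorem restrOpen (he : IsPartialDiffeomorph I I' e) {U : Set M} (hU : IsOpen U) :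
    IsPartialDiffeomorph I I' (e.restrOpen U hU) where
  contMDiffOn := by
    rw [e.restrOpen_source]
    exact he.contMDiffOn.mono inter_subset_left
  contMDiffOn_symm := he.contMDiffOn_symm.mono inter_subset_left

theorem isInvertible_modelDeriv (he : IsPartialDiffeomorph I I' e) {x : M} (hx : x ∈ e.source) :
    (modelDeriv I I' e x).IsInvertible :=
  ⟨.equivOfInverse _ _ (he.modelDeriv_symm_apply hx) (he.modelDeriv_apply_symm hx), rfl⟩

end IsPartialDiffeomorph

/-- Near `i z`, the map `Φ` is a local diffeomorphism which carries the distribution `ξ` to `η`,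
and it carries the germ of `i` at `z` to the germ of `i'`. -/
structure IsDistributionGerm (I : ModelWithCorners ℝ E H) (I' : ModelWithCorners ℝ E' H')
    (ξ : M → Submodule ℝ E) (η : M' → Submodule ℝ E') (i : T → M) (i' : T → M') (Φ : M → M')
    (z : T) : Prop where
  smooth : ∀ᶠ y in 𝓝 (i z), ContMDiffAt I I' ∞ Φ y
  comm : ∀ᶠ w in 𝓝 z, Φ (i w) = i' w
  invertible : (modelDeriv I I' Φ (i z)).IsInvertible
  mem_iff : ∀ᶠ y in 𝓝 (i z), ∀ v, modelDeriv I I' Φ y v ∈ η (Φ y) ↔ v ∈ ξ y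

namespace IsDistributionGerm

variable {ξ : M → Submodule ℝ E} {η : M' → Submodule ℝ E'} {ζ : M'' → Submodule ℝ E''}
  {i : T → M} {i' : T → M'} {i'' : T → M''} {Φ : M → M'} {Ψ : M' → M''} {z : T}

theorem map_eq (h : IsDistributionGerm I I' ξ η i i' Φ z) : Φ (i z) = i' z :=
  h.comm.self_of_nhds

theorem continuousAt (h : IsDistributionGerm I I' ξ η i i' Φ z) : ContinuousAt Φ (i z) :=
  h.smooth.self_of_nhds.continuousAt

theorem tendsto (h : IsDistributionGerm I I' ξ η i i' Φ z) : Tendsto Φ (𝓝 (i z)) (𝓝 (i' z)) :=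
  h.map_eq ▸ h.continuousAt

theorem comp (hΨ : IsDistributionGerm I' I'' η ζ i' i'' Ψ z)
    (hΦ : IsDistributionGerm I I' ξ η i i' Φ z) :
    IsDistributionGerm I I'' ξ ζ i i'' (Ψ ∘ Φ) z where
  smooth := by
    filter_upwards [hΦ.smooth, hΦ.tendsto.eventually hΨ.smooth] with y hΦy hΨy
      using hΨy.comp y hΦy
  comm := by
    filter_upwards [hΦ.comm, hΨ.comm] with w hΦw hΨw
    rw [Function.comp_apply, hΦw, hΨw]
  invertible := by
    have hΨ_smooth := hΦ.tendsto.eventually hΨ.smooth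
    rw [modelDeriv_comp hΨ_smooth.self_of_nhds hΦ.smooth.self_of_nhds, hΦ.map_eq]
    exact hΨ.invertible.comp hΦ.invertible
  mem_iff := by
    filter_upwards [hΦ.smooth, hΦ.tendsto.eventually hΨ.smooth, hΦ.mem_iff,
      hΦ.tendsto.eventually hΨ.mem_iff] with y hΦy hΨy hmemΦ hmemΨ v
    rw [modelDeriv_comp hΨy hΦy, ← hmemΦ, ← hmemΨ]
    rfl

theorem comp_param {T' : Type*} [TopologicalSpace T'] {c : T' → T} {w : T'}
    (h : IsDistributionGerm I I' ξ η i i' Φ (c w)) (hc : ContinuousAt c w) :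
    IsDistributionGerm I I' ξ η (i ∘ c) (i' ∘ c) Φ w where
  smooth := h.smooth
  comm := hc.eventually h.comm
  invertible := h.invertible
  mem_iff := h.mem_iff

theorem congr_left {k : T → M} {k' : T → M'} (h : IsDistributionGerm I I' ξ η i i' Φ z)
    (hk : i =ᶠ[𝓝 z] k) (hk' : i' =ᶠ[𝓝 z] k') : IsDistributionGerm I I' ξ η k k' Φ z := by
  have hz : i z = k z := hk.self_of_nhds
  refine ⟨hz ▸ h.smooth, ?_, hz ▸ h.invertible, hz ▸ h.mem_iff⟩
  filter_upwards [h.comm, hk, hk'] with w hcomm hkw hk'w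
  rw [← hkw, ← hk'w, hcomm]

theorem congr {Φ' : M → M'} (hi : ContinuousAt i z) (h : IsDistributionGerm I I' ξ η i i' Φ z)
    (hΦ : Φ =ᶠ[𝓝 (i z)] Φ') : IsDistributionGerm I I' ξ η i i' Φ' z where
  smooth := by
    filter_upwards [h.smooth, hΦ.eventuallyEq_nhds] with y hy hΦy
      using hy.congr_of_eventuallyEq hΦy.symm
  comm := by
    filter_upwards [h.comm, hi.eventually hΦ] with w hcomm hΦw
    rw [← hΦw, hcomm]
  invertible := modelDeriv_congr (I := I) (I' := I') hΦ ▸ h.invertible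
  mem_iff := by
    filter_upwards [h.mem_iff, hΦ.eventuallyEq_nhds] with y hmem hΦy v
    rw [← modelDeriv_congr hΦy, ← hmem, hΦy.self_of_nhds]

end IsDistributionGerm

/-- The `1`-form `α` read in the chart `e`, that is, its pullback under `e.symm`. It is meaningful
on the target of `e`. -/
noncomputable def chartForm (I : ModelWithCorners ℝ E H) (I' : ModelWithCorners ℝ E' H')
    (α : M → E →L[ℝ] ℝ) (e : OpenPartialHomeomorph M M') (y : M') : E' →L[ℝ] ℝ :=
  α (e.symm y) ∘L modelDeriv I' I e.symm y

section ChartForm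

variable {e : OpenPartialHomeomorph M M'} {α : M → E →L[ℝ] ℝ} {ξ : M → Submodule ℝ E} {i : T → M}
  {z : T}

theorem IsPartialDiffeomorph.chartForm_modelDeriv (he : IsPartialDiffeomorph I I' e) {x : M}
    (hx : x ∈ e.source) (v : E) : chartForm I I' α e (e x) (modelDeriv I I' e x v) = α x v := by
  rw [chartForm, ContinuousLinearMap.comp_apply, he.modelDeriv_symm_apply hx, e.left_inv hx]

theorem IsPartialDiffeomorph.chartForm_eventuallyEq (he : IsPartialDiffeomorph I I' e)
    {e' : OpenPartialHomeomorph M M''} (he' : IsPartialDiffeomorph I I'' e') {x : M}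
    (hx : x ∈ e.source) (hx' : x ∈ e'.source) :
    chartForm I I' α e =ᶠ[𝓝 (e x)] fun y =>
      chartForm I I'' α e' ((e' ∘ e.symm) y) ∘L modelDeriv I' I'' (e' ∘ e.symm) y := by
  filter_upwards [e.open_target.mem_nhds (e.map_source hx),
    (e.tendsto_symm hx).eventually (e'.open_source.mem_nhds hx')] with y hy hy'
  rw [modelDeriv_comp (he'.contMDiffAt hy') (he.contMDiffAt_symm hy)]
  ext v
  exact (he'.chartForm_modelDeriv hy' _).symm

theorem IsPartialDiffeomorph.isDistributionGerm_symm (he : IsPartialDiffeomorph I I' e)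
    (hi : ContinuousAt i z) (hz : i z ∈ e.source)
    (hξ : ∀ᶠ x in 𝓝 (i z), ξ x = LinearMap.ker (α x).toLinearMap) :
    IsDistributionGerm I' I (fun y => LinearMap.ker (chartForm I I' α e y).toLinearMap) ξ
      (e ∘ i) i e.symm z where
  smooth := by
    filter_upwards [e.open_target.mem_nhds (e.map_source hz)] with y hy
      using he.contMDiffAt_symm hy
  comm := by
    filter_upwards [hi.eventually (e.open_source.mem_nhds hz)] with w hw using e.left_inv hw
  invertible := he.symm.isInvertible_modelDeriv (e.map_source hz)
  mem_iff := by
    filter_upwards [(e.tendsto_symm hz).eventually hξ] with y hy v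
    rw [hy]
    rfl

theorem IsPartialDiffeomorph.isDistributionGerm (he : IsPartialDiffeomorph I I' e)
    (hz : i z ∈ e.source) (hξ : ∀ᶠ x in 𝓝 (i z), ξ x = LinearMap.ker (α x).toLinearMap) :
    IsDistributionGerm I I' ξ (fun y => LinearMap.ker (chartForm I I' α e y).toLinearMap)
      i (e ∘ i) e z where
  smooth := by
    filter_upwards [e.open_source.mem_nhds hz] with y hy using he.contMDiffAt hy
  comm := .of_forall fun _ => rfl
  invertible := he.isInvertible_modelDeriv hz
  mem_iff := by
    filter_upwards [hξ, e.open_source.mem_nhds hz] with y hy hye v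
    rw [hy, LinearMap.mem_ker, LinearMap.mem_ker]
    exact (he.chartForm_modelDeriv hye v).congr_left

end ChartForm

theorem isDistributionGerm_ker_iff {F : Type*} [NormedAddCommGroup F]
    {a : E → E →L[ℝ] ℝ} {a' : E' → E' →L[ℝ] ℝ} {j : F → E} {j' : F → E'} {ψ : E → E'} {x : F} :
    IsDistributionGerm 𝓘(ℝ, E) 𝓘(ℝ, E') (fun y => LinearMap.ker (a y).toLinearMap)
      (fun y => LinearMap.ker (a' y).toLinearMap) j j' ψ x ↔ IsContactGerm a a' j j' ψ x := by
  constructor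
  · rintro ⟨hsmooth, hcomm, hinv, hmem⟩
    simp only [modelDeriv_eq_fderiv] at hinv hmem
    exact ⟨hsmooth.mono fun y hy => hy.contDiffAt, hcomm, hinv, hmem⟩
  · rintro ⟨hsmooth, hcomm, hinv, hcontact⟩
    rw [← modelDeriv_eq_fderiv] at hinv
    simp only [← modelDeriv_eq_fderiv] at hcontact
    exact ⟨hsmooth.mono fun y hy => hy.contMDiffAt, hcomm, hinv, hcontact⟩

section Coordinates

variable {F X : Type*} [NormedAddCommGroup F] [NormedSpace ℝ F]
  [NormedAddCommGroup X] [NormedSpace ℝ X]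
  {c : OpenPartialHomeomorph M F} {e : OpenPartialHomeomorph M' X} {i : M → M'} {z : M}

theorem contDiffAt_comp_comp_symm (hc : IsPartialDiffeomorph I 𝓘(ℝ, F) c)
    (he : IsPartialDiffeomorph I' 𝓘(ℝ, X) e) (hz : z ∈ c.source) (hiz : i z ∈ e.source)
    (hi : ContMDiffAt I I' ∞ i z) : ContDiffAt ℝ ∞ (e ∘ i ∘ c.symm) (c z) := by
  rw [← c.left_inv hz] at hi hiz
  have hic : ContMDiffAt 𝓘(ℝ, F) I' ∞ (i ∘ c.symm) (c z) :=
    hi.comp _ (hc.contMDiffAt_symm (c.map_source hz))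
  exact (ContMDiffAt.comp (g := e) (c z) (he.contMDiffAt hiz) hic).contDiffAt

theorem fderiv_comp_comp_symm (hc : IsPartialDiffeomorph I 𝓘(ℝ, F) c)
    (he : IsPartialDiffeomorph I' 𝓘(ℝ, X) e) (hz : z ∈ c.source) (hiz : i z ∈ e.source)
    (hi : ContMDiffAt I I' ∞ i z) (v : E) :
    fderiv ℝ (e ∘ i ∘ c.symm) (c z) (modelDeriv I 𝓘(ℝ, F) c z v) =
      modelDeriv I' 𝓘(ℝ, X) e (i z) (modelDeriv I I' i z v) := by
  have hcoord : (e ∘ i ∘ c.symm) ∘ c =ᶠ[𝓝 z] e ∘ i := by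
    filter_upwards [c.open_source.mem_nhds hz] with w hw
    simp only [Function.comp_apply, c.left_inv hw]
  have hderiv := modelDeriv_congr (I := I) (I' := 𝓘(ℝ, X)) hcoord
  rw [modelDeriv_comp (contDiffAt_comp_comp_symm hc he hz hiz hi).contMDiffAt (hc.contMDiffAt hz),
    modelDeriv_comp (he.contMDiffAt hiz) hi, modelDeriv_eq_fderiv] at hderiv
  exact DFunLike.congr_fun hderiv v

theorem injective_fderiv_comp_comp_symm (hc : IsPartialDiffeomorph I 𝓘(ℝ, F) c)
    (he : IsPartialDiffeomorph I' 𝓘(ℝ, X) e) (hz : z ∈ c.source) (hiz : i z ∈ e.source)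
    (hi : ContMDiffAt I I' ∞ i z) :
    Function.Injective (fderiv ℝ (e ∘ i ∘ c.symm) (c z)) ↔
      Function.Injective (modelDeriv I I' i z) := by
  rw [← Function.Injective.of_comp_iff' _ (hc.isInvertible_modelDeriv hz).bijective,
    ← (he.isInvertible_modelDeriv hiz).injective.of_comp_iff]
  exact iff_of_eq (congrArg _ (funext (fderiv_comp_comp_symm hc he hz hiz hi)))

theorem isInvertible_fderiv_comp_comp_symm (hc : IsPartialDiffeomorph I 𝓘(ℝ, F) c)
    (he : IsPartialDiffeomorph I' 𝓘(ℝ, X) e) (hz : z ∈ c.source) (hiz : i z ∈ e.source)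
    (hi : ContMDiffAt I I' ∞ i z) :
    (fderiv ℝ (e ∘ i ∘ c.symm) (c z)).IsInvertible ↔ (modelDeriv I I' i z).IsInvertible := by
  obtain ⟨A, hA⟩ := hc.isInvertible_modelDeriv hz
  obtain ⟨B, hB⟩ := he.isInvertible_modelDeriv hiz
  have hcomp : fderiv ℝ (e ∘ i ∘ c.symm) (c z) ∘L (A : E →L[ℝ] F) =
      (B : E' →L[ℝ] X) ∘L modelDeriv I I' i z := by
    rw [hA, hB]
    exact ContinuousLinearMap.ext (fderiv_comp_comp_symm hc he hz hiz hi)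
  rw [← ContinuousLinearMap.isInvertible_comp_equiv (e := A), hcomp,
    ContinuousLinearMap.isInvertible_equiv_comp]

end Coordinates

end DistributionGerm

section ManifoldForms

variable {X : Type*} [NormedAddCommGroup X] [NormedSpace ℝ X] {m : ℕ}
  {M : Type*} [TopologicalSpace M] [ChartedSpace (EuclideanSpace ℝ (Fin m)) M]
  [IsManifold (𝓡 m) ∞ M] {α : OneForm m M} {U : Set M} {x : M}

omit [IsManifold (𝓡 m) ∞ M] in
theorem isPartialDiffeomorph_of_mem_maximalAtlas
    {c : OpenPartialHomeomorph M (EuclideanSpace ℝ (Fin m))}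
    (hc : c ∈ IsManifold.maximalAtlas (𝓡 m) ∞ M) : IsPartialDiffeomorph (𝓡 m) (𝓡 m) c :=
  ⟨contMDiffOn_of_mem_maximalAtlas hc, contMDiffOn_symm_of_mem_maximalAtlas hc⟩

theorem isPartialDiffeomorph_chartAt (x : M) :
    IsPartialDiffeomorph (𝓡 m) (𝓡 m) (chartAt (EuclideanSpace ℝ (Fin m)) x) :=
  isPartialDiffeomorph_of_mem_maximalAtlas (IsManifold.chart_mem_maximalAtlas x)

theorem contMDiff_tangentBundle_const (v : X) :
    ContMDiff 𝓘(ℝ, X) (𝓘(ℝ, X).prod 𝓘(ℝ, X)) ∞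
      (fun y : X => (⟨y, v⟩ : TangentBundle 𝓘(ℝ, X) X)) := fun y => by
  rw [contMDiffAt_totalSpace]
  refine ⟨contMDiffAt_id, ?_⟩
  simp only [mfld_simps]
  exact contMDiffAt_const

theorem IsPartialDiffeomorph.contMDiffOn_modelDeriv_symm {e : OpenPartialHomeomorph M X}
    (he : IsPartialDiffeomorph (𝓡 m) 𝓘(ℝ, X) e) (v : X) :
    ContMDiffOn 𝓘(ℝ, X) ((𝓡 m).prod (𝓡 m)) ∞
      (fun y => (⟨e.symm y, modelDeriv 𝓘(ℝ, X) (𝓡 m) e.symm y v⟩ : TangentBundle (𝓡 m) M))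
      e.target := by
  have htangent := he.contMDiffOn_symm.contMDiffOn_tangentMapWithin (m := ∞) (by simp)
    e.open_target.uniqueMDiffOn
  refine (htangent.comp (contMDiff_tangentBundle_const v).contMDiffOn (s := e.target)
    fun y hy => hy).congr fun y hy => ?_
  simp only [Function.comp_apply, tangentMapWithin, mfderivWithin_of_isOpen e.open_target hy]
  rfl

theorem extDeriv_ofSubsingleton_apply {b : X → X →L[ℝ] ℝ} {y : X} (hb : DifferentiableAt ℝ b y)
    (u v : X) :
    extDeriv (fun z => ContinuousAlternatingMap.ofSubsingleton ℝ X ℝ (0 : Fin 1) (b z)) y ![u, v]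
      = dOne b y u v := by
  let L := ContinuousAlternatingMap.ofSubsingletonLIE (𝕜 := ℝ) (E := X) (F := ℝ) (0 : Fin 1)
  have hLb : DifferentiableAt ℝ
      (fun z => ContinuousAlternatingMap.ofSubsingleton ℝ X ℝ (0 : Fin 1) (b z)) y :=
    (L.toContinuousLinearEquiv.differentiableAt (x := b y)).comp y hb
  have hfderiv : ∀ w w', fderiv ℝ (fun z => b z w) y w' = fderiv ℝ b y w' w := fun w w' => by
    rw [fderiv_clm_apply hb (differentiableAt_const w)]
    simp
  rw [extDeriv_apply hLb]
  simp [dOne, Fin.sum_univ_two, Fin.removeNth, hfderiv, sub_eq_add_neg]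

section FiniteDimensional

variable [FiniteDimensional ℝ X] {e : OpenPartialHomeomorph M X}

theorem OneForm.SmoothOn.contDiffOn_chartForm (hα : α.SmoothOn U)
    (he : IsPartialDiffeomorph (𝓡 m) 𝓘(ℝ, X) e) :
    ContDiffOn ℝ ∞ (chartForm (𝓡 m) 𝓘(ℝ, X) α e) (e.target ∩ e.symm ⁻¹' U) := by
  rw [contDiffOn_clm_apply]
  intro v
  rw [← contMDiffOn_iff_contDiffOn]
  have hform : ContMDiffOn 𝓘(ℝ, X) ((𝓡 m).prod 𝓘(ℝ, EuclideanSpace ℝ (Fin m) →L[ℝ] ℝ)) ∞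
      (fun y => (⟨e.symm y, α (e.symm y)⟩ : TotalSpace (EuclideanSpace ℝ (Fin m) →L[ℝ] ℝ)
        (fun x : M => TangentSpace (𝓡 m) x →L[ℝ] Bundle.Trivial M ℝ x)))
      (e.target ∩ e.symm ⁻¹' U) :=
    ContMDiffOn.comp hα (he.contMDiffOn_symm.mono inter_subset_left) fun y hy => hy.2
  have hvector := (he.contMDiffOn_modelDeriv_symm v).mono
    (inter_subset_left : e.target ∩ e.symm ⁻¹' U ⊆ e.target)
  have happly := ContMDiffOn.clm_bundle_apply (F₂ := ℝ) (E₂ := Bundle.Trivial M ℝ) hform hvector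
  exact fun y hy => (contMDiffWithinAt_totalSpace.1 (happly y hy)).2

theorem OneForm.SmoothOn.eventually_contDiffAt_chartForm (hα : α.SmoothOn U) (hU : IsOpen U)
    (he : IsPartialDiffeomorph (𝓡 m) 𝓘(ℝ, X) e) (hx : x ∈ e.source) (hxU : x ∈ U) :
    ∀ᶠ y in 𝓝 (e x), ContDiffAt ℝ ∞ (chartForm (𝓡 m) 𝓘(ℝ, X) α e) y := by
  have hO : IsOpen (e.target ∩ e.symm ⁻¹' U) := e.symm.isOpen_inter_preimage hU
  have hxO : e x ∈ e.target ∩ e.symm ⁻¹' U :=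
    ⟨e.map_source hx, by rwa [mem_preimage, e.left_inv hx]⟩
  filter_upwards [hO.mem_nhds hxO] with y hy
    using (hα.contDiffOn_chartForm he).contDiffAt (hO.mem_nhds hy)

theorem OneForm.SmoothOn.differentiableAt_chartForm (hα : α.SmoothOn U) (hU : IsOpen U)
    (he : IsPartialDiffeomorph (𝓡 m) 𝓘(ℝ, X) e) (hx : x ∈ e.source) (hxU : x ∈ U) :
    DifferentiableAt ℝ (chartForm (𝓡 m) 𝓘(ℝ, X) α e) (e x) :=
  (hα.eventually_contDiffAt_chartForm hU he hx hxU).self_of_nhds.differentiableAt (by simp)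

theorem OneForm.SmoothOn.d_eq_dOne_chartAt (hα : α.SmoothOn U) (hU : IsOpen U) (hxU : x ∈ U)
    (u v : EuclideanSpace ℝ (Fin m)) :
    α.d x u v = dOne (chartForm (𝓡 m) (𝓡 m) α (chartAt _ x)) (chartAt _ x x)
      (modelDeriv (𝓡 m) (𝓡 m) (chartAt (EuclideanSpace ℝ (Fin m)) x) x u)
      (modelDeriv (𝓡 m) (𝓡 m) (chartAt (EuclideanSpace ℝ (Fin m)) x) x v) :=
  extDeriv_ofSubsingleton_apply (hα.differentiableAt_chartForm hU (isPartialDiffeomorph_chartAt x)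
    (mem_chart_source _ x) hxU) _ _

omit [FiniteDimensional ℝ X] in
theorem OneForm.SmoothOn.d_eq_dOne_chartForm (hα : α.SmoothOn U) (hU : IsOpen U)
    (he : IsPartialDiffeomorph (𝓡 m) 𝓘(ℝ, X) e) (hx : x ∈ e.source) (hxU : x ∈ U)
    (u v : EuclideanSpace ℝ (Fin m)) :
    α.d x u v = dOne (chartForm (𝓡 m) 𝓘(ℝ, X) α e) (e x)
      (modelDeriv (𝓡 m) 𝓘(ℝ, X) e x u) (modelDeriv (𝓡 m) 𝓘(ℝ, X) e x v) := by
  let c := chartAt (EuclideanSpace ℝ (Fin m)) x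
  have hc : IsPartialDiffeomorph (𝓡 m) (𝓡 m) c := isPartialDiffeomorph_chartAt x
  have hxc : x ∈ c.source := mem_chart_source _ x
  have hexc : e.symm (e x) = x := e.left_inv hx
  have htransition : ContMDiffAt 𝓘(ℝ, X) (𝓡 m) ∞ (c ∘ e.symm) (e x) :=
    (hexc.symm ▸ hc.contMDiffAt hxc).comp _ (he.contMDiffAt_symm (e.map_source hx))
  have hderiv : ∀ w, fderiv ℝ (c ∘ e.symm) (e x) (modelDeriv (𝓡 m) 𝓘(ℝ, X) e x w) =
      modelDeriv (𝓡 m) (𝓡 m) c x w := fun w => by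
    rw [← modelDeriv_eq_fderiv, modelDeriv_comp (hexc.symm ▸ hc.contMDiffAt hxc)
      (he.contMDiffAt_symm (e.map_source hx)), ContinuousLinearMap.comp_apply,
      he.modelDeriv_symm_apply hx, hexc]
  have hc_diff : DifferentiableAt ℝ (chartForm (𝓡 m) (𝓡 m) α c) ((c ∘ e.symm) (e x)) := by
    rw [Function.comp_apply, hexc]
    exact hα.differentiableAt_chartForm hU hc hxc hxU
  have hpullback := he.chartForm_eventuallyEq (α := α) hc hx hxc
  simp only [modelDeriv_eq_fderiv] at hpullback
  rw [dOne_congr hpullback, dOne_pullback (f := c ∘ e.symm) hc_diff htransition.contDiffAt, hderiv,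
    hderiv, Function.comp_apply, hexc]
  exact hα.d_eq_dOne_chartAt hU hxU u v

theorem OneForm.IsContactOn.isContactAt_chartForm (hα : α.IsContactOn U) (hU : IsOpen U)
    (he : IsPartialDiffeomorph (𝓡 m) 𝓘(ℝ, X) e) (hx : x ∈ e.source) (hxU : x ∈ U) :
    IsContactAt (chartForm (𝓡 m) 𝓘(ℝ, X) α e) (e x) where
  smooth := hα.smoothOn.eventually_contDiffAt_chartForm hU he hx hxU
  ne_zero := fun hzero => hα.ne_zero x hxU <| ContinuousLinearMap.ext fun v => by
    have := he.chartForm_modelDeriv (α := α) hx v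
    rw [hzero] at this
    exact this.symm
  nondegenerate := fun u hu hdu => by
    obtain ⟨u, rfl⟩ := (he.isInvertible_modelDeriv hx).bijective.2 u
    have hαu : α x u = 0 := (he.chartForm_modelDeriv hx u).symm.trans hu
    have hu_zero : u = 0 := hα.nondegenerate x hxU u hαu fun v hv =>
      (hα.smoothOn.d_eq_dOne_chartForm hU he hx hxU u v).trans
        (hdu _ ((he.chartForm_modelDeriv hx v).trans hv))
    rw [hu_zero, map_zero]

theorem OneForm.IsContactOn.eventually_isContactAt_chartForm (hα : α.IsContactOn U)
    (hU : IsOpen U) (he : IsPartialDiffeomorph (𝓡 m) 𝓘(ℝ, X) e) (hx : x ∈ e.source)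
    (hxU : x ∈ U) : ∀ᶠ y in 𝓝 (e x), IsContactAt (chartForm (𝓡 m) 𝓘(ℝ, X) α e) y := by
  filter_upwards [e.open_target.mem_nhds (e.map_source hx),
    (e.tendsto_symm hx).eventually (hU.mem_nhds hxU)] with y hy hyU
  rw [← e.right_inv hy]
  exact hα.isContactAt_chartForm hU he (e.map_target hy) hyU

end FiniteDimensional

end ManifoldForms

theorem eventuallyEq_comp_symm {T F X : Type*} [TopologicalSpace T] [TopologicalSpace F]
    {c : OpenPartialHomeomorph T F} {z : T} (hz : z ∈ c.source) {f : T → X} {g : F → X}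
    (h : g ∘ c =ᶠ[𝓝 z] f) : f ∘ c.symm =ᶠ[𝓝 (c z)] g := by
  filter_upwards [(c.tendsto_symm hz).eventually h, c.eventually_right_inverse' hz] with y hy hyc
  rw [Function.comp_apply, ← hy, Function.comp_apply, hyc]

theorem symm_comp_conj_comp_eventuallyEq {M M' X X' : Type*} [TopologicalSpace M]
    [TopologicalSpace M'] [TopologicalSpace X] [TopologicalSpace X']
    {e : OpenPartialHomeomorph M X} {e' : OpenPartialHomeomorph M' X'} {Φ : M → M'} {x : M}
    (hx : x ∈ e.source) (hΦx : Φ x ∈ e'.source) (hΦ : ContinuousAt Φ x) :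
    e'.symm ∘ (e' ∘ Φ ∘ e.symm) ∘ e =ᶠ[𝓝 x] Φ := by
  filter_upwards [e.eventually_left_inverse hx,
    hΦ.eventually (e'.eventually_left_inverse hΦx)] with y hy hΦy
  simp only [Function.comp_apply, hy, hΦy]

/-! ### Contact charts -/

section ContactChart

variable {X : Type*} [NormedAddCommGroup X] [NormedSpace ℝ X] {m : ℕ}
  {M : Type*} [TopologicalSpace M] [ChartedSpace (EuclideanSpace ℝ (Fin m)) M]
  [IsManifold (𝓡 m) ∞ M] {ξ : TangentDistribution m M} {α : OneForm m M}
  {e : OpenPartialHomeomorph M X}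

/-- The partial diffeomorphism `e` is a chart on the domain of which the distribution `ξ` is the
kernel of the contact form `α`. -/
structure IsContactChart (ξ : TangentDistribution m M) (e : OpenPartialHomeomorph M X)
    (α : OneForm m M) : Prop where
  isPartialDiffeomorph : IsPartialDiffeomorph (𝓡 m) 𝓘(ℝ, X) e
  isContactOn : α.IsContactOn e.source
  eq_ker : ∀ x ∈ e.source, ξ x = LinearMap.ker (α x).toLinearMap

theorem OneForm.IsContactOn.mono {U V : Set M} (hα : α.IsContactOn U) (hVU : V ⊆ U) :
    α.IsContactOn V :=
  ⟨ContMDiffOn.mono hα.smoothOn hVU, fun x hx => hα.ne_zero x (hVU hx),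
    fun x hx => hα.nondegenerate x (hVU hx)⟩

theorem IsContactStructure.exists_isContactChart (hξ : IsContactStructure ξ)
    (he : IsPartialDiffeomorph (𝓡 m) 𝓘(ℝ, X) e) {x : M} (hx : x ∈ e.source) :
    ∃ e' α, IsContactChart ξ e' α ∧ x ∈ e'.source ∧ e'.source ⊆ e.source ∧ ⇑e' = e := by
  obtain ⟨U, hU, hxU, α, hα, hker⟩ := hξ x
  have hsource := e.restrOpen_source U hU
  refine ⟨e.restrOpen U hU, α, ⟨he.restrOpen hU, hα.mono ?_, fun y hy => hker y ?_⟩, ?_, ?_, rfl⟩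
  · rw [hsource]
    exact inter_subset_right
  · rw [hsource] at hy
    exact hy.2
  · rw [hsource]
    exact ⟨hx, hxU⟩
  · rw [hsource]
    exact inter_subset_left

namespace IsContactChart

theorem eventually_isContactAt [FiniteDimensional ℝ X] (h : IsContactChart ξ e α) {x : M}
    (hx : x ∈ e.source) : ∀ᶠ y in 𝓝 (e x), IsContactAt (chartForm (𝓡 m) 𝓘(ℝ, X) α e) y :=
  h.isContactOn.eventually_isContactAt_chartForm e.open_source h.isPartialDiffeomorph hx hx

theorem eventually_eq_ker (h : IsContactChart ξ e α) {x : M} (hx : x ∈ e.source) :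
    ∀ᶠ y in 𝓝 x, ξ y = LinearMap.ker (α y).toLinearMap := by
  filter_upwards [e.open_source.mem_nhds hx] with y hy using h.eq_ker y hy

theorem chartForm_modelDeriv_eq_zero_iff (h : IsContactChart ξ e α) {x : M} (hx : x ∈ e.source)
    (v : EuclideanSpace ℝ (Fin m)) :
    chartForm (𝓡 m) 𝓘(ℝ, X) α e (e x) (modelDeriv (𝓡 m) 𝓘(ℝ, X) e x v) = 0 ↔ v ∈ ξ x := by
  rw [h.eq_ker x hx]
  exact (h.isPartialDiffeomorph.chartForm_modelDeriv hx v).congr_left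

theorem chartForm_fderiv_eq_zero_iff {E H T F : Type*} [NormedAddCommGroup E] [NormedSpace ℝ E]
    [TopologicalSpace H] {I : ModelWithCorners ℝ E H} [TopologicalSpace T] [ChartedSpace H T]
    [NormedAddCommGroup F] [NormedSpace ℝ F] {c : OpenPartialHomeomorph T F} {i : T → M} {z : T}
    (h : IsContactChart ξ e α) (hc : IsPartialDiffeomorph I 𝓘(ℝ, F) c) (hz : z ∈ c.source)
    (hiz : i z ∈ e.source) (hi : ContMDiffAt I (𝓡 m) ∞ i z) (v : E) :
    chartForm (𝓡 m) 𝓘(ℝ, X) α e (e (i z))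
      (fderiv ℝ (e ∘ i ∘ c.symm) (c z) (modelDeriv I 𝓘(ℝ, F) c z v)) = 0 ↔
        modelDeriv I (𝓡 m) i z v ∈ ξ (i z) := by
  rw [fderiv_comp_comp_symm hc h.isPartialDiffeomorph hz hiz hi,
    h.chartForm_modelDeriv_eq_zero_iff hiz]

section Germs

variable {X' : Type*} [NormedAddCommGroup X'] [NormedSpace ℝ X'] {m' : ℕ}
  {M' : Type*} [TopologicalSpace M'] [ChartedSpace (EuclideanSpace ℝ (Fin m')) M']
  [IsManifold (𝓡 m') ∞ M'] {ξ' : TangentDistribution m' M'} {α' : OneForm m' M'}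
  {e' : OpenPartialHomeomorph M' X'} {T F : Type*} [TopologicalSpace T] [NormedAddCommGroup F]
  {c : OpenPartialHomeomorph T F} {i : T → M} {i' : T → M'} {j : F → X} {j' : F → X'} {z : T}

theorem isContactGerm (h : IsContactChart ξ e α) (h' : IsContactChart ξ' e' α')
    (hz : z ∈ c.source) (hiz : i z ∈ e.source) (hiz' : i' z ∈ e'.source) (hi : ContinuousAt i z)
    (hj : j ∘ c =ᶠ[𝓝 z] e ∘ i) (hj' : j' ∘ c =ᶠ[𝓝 z] e' ∘ i') {Φ : M → M'}
    (hΦ : IsDistributionGerm (𝓡 m) (𝓡 m') ξ ξ' i i' Φ z) :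
    IsContactGerm (chartForm (𝓡 m) 𝓘(ℝ, X) α e) (chartForm (𝓡 m') 𝓘(ℝ, X') α' e') j j'
      (e' ∘ Φ ∘ e.symm) (c z) := by
  have hread := (h'.isPartialDiffeomorph.isDistributionGerm hiz' (h'.eventually_eq_ker hiz')).comp
    (hΦ.comp (h.isPartialDiffeomorph.isDistributionGerm_symm hi hiz (h.eventually_eq_ker hiz)))
  rw [← c.left_inv hz] at hread
  exact isDistributionGerm_ker_iff.1 <|
    (hread.comp_param (c.continuousAt_symm (c.map_source hz))).congr_left
      (eventuallyEq_comp_symm hz hj) (eventuallyEq_comp_symm hz hj')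

theorem isDistributionGerm (h : IsContactChart ξ e α) (h' : IsContactChart ξ' e' α')
    (hz : z ∈ c.source) (hiz : i z ∈ e.source) (hiz' : i' z ∈ e'.source)
    (hi' : ContinuousAt i' z) (hj : j ∘ c =ᶠ[𝓝 z] e ∘ i) (hj' : j' ∘ c =ᶠ[𝓝 z] e' ∘ i')
    {ψ : X → X'} (hψ : IsContactGerm (chartForm (𝓡 m) 𝓘(ℝ, X) α e)
      (chartForm (𝓡 m') 𝓘(ℝ, X') α' e') j j' ψ (c z)) :
    IsDistributionGerm (𝓡 m) (𝓡 m') ξ ξ' i i' (e'.symm ∘ ψ ∘ e) z := by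
  have hψ_param := (isDistributionGerm_ker_iff.2 hψ).comp_param (c.continuousAt hz)
  exact (h'.isPartialDiffeomorph.isDistributionGerm_symm hi' hiz' (h'.eventually_eq_ker hiz')).comp
    ((hψ_param.congr_left hj hj').comp
      (h.isPartialDiffeomorph.isDistributionGerm hiz (h.eventually_eq_ker hiz)))

theorem hasRelativeGermExtension (h : IsContactChart ξ e α) (h' : IsContactChart ξ' e' α')
    {K : Set T} (hK : K ⊆ c.source) (hi : Continuous i) (hi' : Continuous i')
    (hiK : MapsTo i K e.source) (hiK' : MapsTo i' K e'.source)
    (hj : ∀ z ∈ K, j ∘ c =ᶠ[𝓝 z] e ∘ i) (hj' : ∀ z ∈ K, j' ∘ c =ᶠ[𝓝 z] e' ∘ i')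
    (hext : HasRelativeGermExtension j (IsContactGerm (chartForm (𝓡 m) 𝓘(ℝ, X) α e)
      (chartForm (𝓡 m') 𝓘(ℝ, X') α' e') j j') (c '' K)) :
    HasRelativeGermExtension i (IsDistributionGerm (𝓡 m) (𝓡 m') ξ ξ' i i') K := by
  intro A hAK hA Φ hΦ
  obtain ⟨ψ, hψ, hψK, hψA⟩ := hext (c '' A) (image_mono hAK)
    (hA.image_of_continuousOn (c.continuousOn.mono (hAK.trans hK))) (e' ∘ Φ ∘ e.symm) <|
    forall_mem_image.2 fun z hz => h.isContactGerm h' (hK (hAK hz)) (hiK (hAK hz))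
      (hiK' (hAK hz)) hi.continuousAt (hj z (hAK hz)) (hj' z (hAK hz)) (hΦ z hz)
  have he_tendsto : ∀ z ∈ K, Tendsto e (𝓝 (i z)) (𝓝 (j (c z))) := fun z hz => by
    rw [show j (c z) = e (i z) from (hj z hz).self_of_nhds]
    exact e.continuousAt (hiK hz)
  refine ⟨fun z => e'.symm ∘ ψ (c z) ∘ e, fun z hz => ?_, fun z hz => ?_, fun z hz => ?_⟩
  · exact h.isDistributionGerm h' (hK hz) (hiK hz) (hiK' hz) hi'.continuousAt (hj z hz) (hj' z hz)
      (hψ _ (mem_image_of_mem c hz))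
  · have hc_tendsto : Tendsto c (𝓝[K] z) (𝓝[c '' K] (c z)) :=
      (c.continuousAt (hK hz)).continuousWithinAt.tendsto_nhdsWithin_image
    filter_upwards [hc_tendsto.eventually (hψK _ (mem_image_of_mem c hz)), self_mem_nhdsWithin]
      with w hw hwK
    exact (hw.comp_tendsto (he_tendsto w hwK)).fun_comp e'.symm
  · have hzK := hAK hz
    have hψΦ := (hψA _ (mem_image_of_mem c hz)).comp_tendsto (he_tendsto z hzK)
    exact (hψΦ.fun_comp e'.symm).trans (symm_comp_conj_comp_eventuallyEq (hiK hzK)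
      ((hΦ z hz).map_eq ▸ hiK' hzK) (hΦ z hz).continuousAt)

end Germs

end IsContactChart

end ContactChart

/-! ### Extension of germs near a point of a hypersurface -/

section Hypersurface

variable {k : ℕ}
  {M : Type*} [TopologicalSpace M] [ChartedSpace (EuclideanSpace ℝ (Fin (k + 1))) M]
  {S : Type*} [TopologicalSpace S] [ChartedSpace (EuclideanSpace ℝ (Fin k)) S]

theorem exists_continuousLinearEquiv_prod_real {E E' F : Type*}
    [NormedAddCommGroup E] [NormedSpace ℝ E] [NormedAddCommGroup E'] [NormedSpace ℝ E']
    [FiniteDimensional ℝ E'] [NormedAddCommGroup F] [NormedSpace ℝ F] (L : (E × F) ≃L[ℝ] E')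
    (hdim : Module.finrank ℝ E' = Module.finrank ℝ E + 1) :
    ∃ L' : E' ≃L[ℝ] E × ℝ, ∀ v, L' (L (v, 0)) = (v, 0) := by
  have : FiniteDimensional ℝ (E × F) := L.symm.toLinearEquiv.finiteDimensional
  have : FiniteDimensional ℝ E :=
    .of_surjective (LinearMap.fst ℝ E F) LinearMap.fst_surjective
  have : FiniteDimensional ℝ F :=
    .of_surjective (LinearMap.snd ℝ E F) LinearMap.snd_surjective
  have hF : Module.finrank ℝ F = Module.finrank ℝ ℝ := by
    have := L.toLinearEquiv.finrank_eq
    rw [Module.finrank_prod, hdim] at this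
    rw [Module.finrank_self]
    omega
  refine ⟨L.symm.trans ((ContinuousLinearEquiv.refl ℝ E).prodCongr
    (ContinuousLinearEquiv.ofFinrankEq hF)), fun v => ?_⟩
  simp

theorem exists_isPartialDiffeomorph_of_isImmersionAt {i : S → M} {p : S}
    (hi : Manifold.IsImmersionAt (𝓡 k) (𝓡 (k + 1)) ∞ i p) :
    ∃ (c : OpenPartialHomeomorph S (EuclideanSpace ℝ (Fin k)))
      (e : OpenPartialHomeomorph M (EuclideanSpace ℝ (Fin k) × ℝ)),
      IsPartialDiffeomorph (𝓡 k) (𝓡 k) c ∧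
      IsPartialDiffeomorph (𝓡 (k + 1)) 𝓘(ℝ, EuclideanSpace ℝ (Fin k) × ℝ) e ∧ p ∈ c.source ∧
      (∀ z ∈ c.source, i z ∈ e.source) ∧ ∀ z ∈ c.source, e (i z) = (c z, 0) := by
  obtain ⟨F, _, _, h⟩ := hi
  obtain ⟨L, hL⟩ := exists_continuousLinearEquiv_prod_real h.equiv (by simp)
  have hL_diffeo : IsPartialDiffeomorph (𝓡 (k + 1)) 𝓘(ℝ, EuclideanSpace ℝ (Fin k) × ℝ)
      L.toHomeomorph.toOpenPartialHomeomorph :=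
    ⟨L.contDiff.contMDiff.contMDiffOn, L.symm.contDiff.contMDiff.contMDiffOn⟩
  let e : OpenPartialHomeomorph M (EuclideanSpace ℝ (Fin (k + 1))) := h.codChart
  have he : IsPartialDiffeomorph (𝓡 (k + 1)) (𝓡 (k + 1)) e :=
    isPartialDiffeomorph_of_mem_maximalAtlas h.codChart_mem_maximalAtlas
  refine ⟨h.domChart, e.trans L.toHomeomorph.toOpenPartialHomeomorph,
    isPartialDiffeomorph_of_mem_maximalAtlas h.domChart_mem_maximalAtlas, he.trans hL_diffeo,
    h.mem_domChart_source, fun z hz => ?_, fun z hz => ?_⟩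
  · simpa using h.source_subset_preimage_source hz
  · have hz_target : h.domChart z ∈ (h.domChart.extend (𝓡 k)).target := by
      simpa using h.domChart.map_source hz
    have hiz : h.codChart (i z) = h.equiv (h.domChart z, 0) := by
      simpa [h.domChart.left_inv hz] using h.writtenInCharts hz_target
    change L (h.codChart (i z)) = (h.domChart z, 0)
    rw [hiz, hL]

theorem injective_modelDeriv_of_isImmersionAt {i : S → M} {p : S}
    (hi : Manifold.IsImmersionAt (𝓡 k) (𝓡 (k + 1)) ∞ i p) :
    Function.Injective (modelDeriv (𝓡 k) (𝓡 (k + 1)) i p) := by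
  obtain ⟨c, e, hc, he, hp, hce, hstraight⟩ := exists_isPartialDiffeomorph_of_isImmersionAt hi
  have hcoord : (fun y => (y, (0 : ℝ))) ∘ c =ᶠ[𝓝 p] e ∘ i := by
    filter_upwards [c.open_source.mem_nhds hp] with z hz using (hstraight z hz).symm
  rw [← injective_fderiv_comp_comp_symm hc he hp (hce p hp) hi.contMDiffAt, ← Function.comp_assoc,
    (eventuallyEq_comp_symm hp hcoord).fderiv_eq,
    (hasFDerivAt_prodMk_left (c p) (0 : ℝ)).fderiv]
  exact Prod.mk_left_injective 0

section LocalExtension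

variable {M₀ : Type*} [TopologicalSpace M₀] [ChartedSpace (EuclideanSpace ℝ (Fin (k + 1))) M₀]
  [IsManifold (𝓡 (k + 1)) ∞ M₀] {M₁ : Type*} [TopologicalSpace M₁]
  [ChartedSpace (EuclideanSpace ℝ (Fin (k + 1))) M₁] [IsManifold (𝓡 (k + 1)) ∞ M₁]
  {ξ₀ : TangentDistribution (k + 1) M₀} {ξ₁ : TangentDistribution (k + 1) M₁}
  {α₀ : OneForm (k + 1) M₀} {α₁ : OneForm (k + 1) M₁} {ι₀ : S → M₀} {ι₁ : S → M₁}
  {c : OpenPartialHomeomorph S (EuclideanSpace ℝ (Fin k))}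
  {e₀ : OpenPartialHomeomorph M₀ (EuclideanSpace ℝ (Fin (k + 1)))}
  {e₁ : OpenPartialHomeomorph M₁ (EuclideanSpace ℝ (Fin k) × ℝ)}

theorem IsContactChart.chartForm_fderiv_eq_zero_iff_of_straight (h₀ : IsContactChart ξ₀ e₀ α₀)
    (h₁ : IsContactChart ξ₁ e₁ α₁) (hc : IsPartialDiffeomorph (𝓡 k) (𝓡 k) c) {z : S}
    (hz : z ∈ c.source) (hz₀ : ι₀ z ∈ e₀.source) (hz₁ : ι₁ z ∈ e₁.source)
    (hι₀ : ContMDiffAt (𝓡 k) (𝓡 (k + 1)) ∞ ι₀ z) (hι₁ : ContMDiffAt (𝓡 k) (𝓡 (k + 1)) ∞ ι₁ z)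
    (hstraight : (fun y => (y, (0 : ℝ))) ∘ c =ᶠ[𝓝 z] e₁ ∘ ι₁)
    (hD : ∀ v, modelDeriv (𝓡 k) (𝓡 (k + 1)) ι₀ z v ∈ ξ₀ (ι₀ z) ↔
      modelDeriv (𝓡 k) (𝓡 (k + 1)) ι₁ z v ∈ ξ₁ (ι₁ z)) (v : EuclideanSpace ℝ (Fin k)) :
    chartForm (𝓡 (k + 1)) (𝓡 (k + 1)) α₀ e₀ (e₀ (ι₀ z))
      (fderiv ℝ (e₀ ∘ ι₀ ∘ c.symm) (c z) v) = 0 ↔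
    chartForm (𝓡 (k + 1)) 𝓘(ℝ, EuclideanSpace ℝ (Fin k) × ℝ) α₁ e₁ (c z, 0) (v, 0) = 0 := by
  obtain ⟨v, rfl⟩ := (hc.isInvertible_modelDeriv hz).surjective v
  have hderiv : fderiv ℝ (e₁ ∘ ι₁ ∘ c.symm) (c z) = .inl ℝ (EuclideanSpace ℝ (Fin k)) ℝ :=
    (eventuallyEq_comp_symm hz hstraight).fderiv_eq.trans
      (hasFDerivAt_prodMk_left (c z) (0 : ℝ)).fderiv
  have hker₁ := h₁.chartForm_fderiv_eq_zero_iff hc hz hz₁ hι₁ v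
  rw [hderiv, ← Function.comp_apply (f := e₁), ← hstraight.self_of_nhds] at hker₁
  rw [h₀.chartForm_fderiv_eq_zero_iff hc hz hz₀ hι₀, hD]
  exact hker₁.symm

theorem IsContactChart.exists_hasRelativeGermExtension_of_straight
    (h₀ : IsContactChart ξ₀ e₀ α₀) (h₁ : IsContactChart ξ₁ e₁ α₁)
    (hc : IsPartialDiffeomorph (𝓡 k) (𝓡 k) c) {p : S} (hp : p ∈ c.source)
    (hp₀ : ι₀ p ∈ e₀.source) (hp₁ : ι₁ p ∈ e₁.source)
    (hι₀ : ContMDiff (𝓡 k) (𝓡 (k + 1)) ∞ ι₀) (hι₁ : ContMDiff (𝓡 k) (𝓡 (k + 1)) ∞ ι₁)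
    (hinj : Function.Injective (modelDeriv (𝓡 k) (𝓡 (k + 1)) ι₀ p))
    (hstraight : ∀ z ∈ c.source, (fun y => (y, (0 : ℝ))) ∘ c =ᶠ[𝓝 z] e₁ ∘ ι₁)
    (hD : ∀ z v, modelDeriv (𝓡 k) (𝓡 (k + 1)) ι₀ z v ∈ ξ₀ (ι₀ z) ↔
      modelDeriv (𝓡 k) (𝓡 (k + 1)) ι₁ z v ∈ ξ₁ (ι₁ z)) :
    ∃ L ∈ 𝓝 (c p), IsCompact L ∧
      L ⊆ c.target ∩ c.symm ⁻¹' (ι₀ ⁻¹' e₀.source ∩ ι₁ ⁻¹' e₁.source) ∧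
      HasRelativeGermExtension (e₀ ∘ ι₀ ∘ c.symm)
        (IsContactGerm (chartForm (𝓡 (k + 1)) (𝓡 (k + 1)) α₀ e₀)
          (chartForm (𝓡 (k + 1)) 𝓘(ℝ, EuclideanSpace ℝ (Fin k) × ℝ) α₁ e₁)
          (e₀ ∘ ι₀ ∘ c.symm) fun y => (y, 0)) L := by
  have hV : c.target ∩ c.symm ⁻¹' (ι₀ ⁻¹' e₀.source ∩ ι₁ ⁻¹' e₁.source) ∈ 𝓝 (c p) :=
    (c.symm.isOpen_inter_preimage ((e₀.open_source.preimage hι₀.continuous).inter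
      (e₁.open_source.preimage hι₁.continuous))).mem_nhds
        ⟨c.map_source hp, by rw [mem_preimage, c.left_inv hp]; exact ⟨hp₀, hp₁⟩⟩
  have hjp : (e₀ ∘ ι₀ ∘ c.symm) (c p) = e₀ (ι₀ p) := by
    simp only [Function.comp_apply, c.left_inv hp]
  have hp_straight : (c p, (0 : ℝ)) = e₁ (ι₁ p) := (hstraight p hp).self_of_nhds
  refine exists_hasRelativeGermExtension (by simp) (hjp ▸ h₀.eventually_isContactAt hp₀)
    (hp_straight ▸ h₁.eventually_isContactAt hp₁) ?_
    ((injective_fderiv_comp_comp_symm hc h₀.isPartialDiffeomorph hp hp₀ (hι₀ p)).2 hinj) ?_ hV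
  · filter_upwards [hV] with y ⟨hy, hy₀, _⟩
    have := contDiffAt_comp_comp_symm hc h₀.isPartialDiffeomorph (c.map_target hy) hy₀ (hι₀ _)
    rwa [c.right_inv hy] at this
  · filter_upwards [hV] with y ⟨hy, hy₀, hy₁⟩
    have := h₀.chartForm_fderiv_eq_zero_iff_of_straight h₁ hc (c.map_target hy) hy₀ hy₁ (hι₀ _)
      (hι₁ _) (hstraight _ (c.map_target hy)) (hD _)
    rwa [c.right_inv hy] at this

theorem exists_hasRelativeGermExtension_isDistributionGerm (hξ₀ : IsContactStructure ξ₀)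
    (hξ₁ : IsContactStructure ξ₁) (hι₀ : Manifold.IsImmersion (𝓡 k) (𝓡 (k + 1)) ∞ ι₀)
    (hι₁ : Manifold.IsImmersion (𝓡 k) (𝓡 (k + 1)) ∞ ι₁)
    (hD : ∀ z v, modelDeriv (𝓡 k) (𝓡 (k + 1)) ι₀ z v ∈ ξ₀ (ι₀ z) ↔
      modelDeriv (𝓡 k) (𝓡 (k + 1)) ι₁ z v ∈ ξ₁ (ι₁ z)) (p : S) :
    ∃ K ∈ 𝓝 p, IsCompact K ∧ HasRelativeGermExtension ι₀
      (IsDistributionGerm (𝓡 (k + 1)) (𝓡 (k + 1)) ξ₀ ξ₁ ι₀ ι₁) K := by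
  obtain ⟨c, e, hc, he, hp, hce, hstraight⟩ :=
    exists_isPartialDiffeomorph_of_isImmersionAt (hι₁.isImmersionAt p)
  obtain ⟨e₁, α₁, h₁, hp₁, -, he₁⟩ := hξ₁.exists_isContactChart he (hce p hp)
  obtain ⟨e₀, α₀, h₀, hp₀, -⟩ := hξ₀.exists_isContactChart (isPartialDiffeomorph_chartAt (ι₀ p))
    (mem_chart_source _ (ι₀ p))
  have hstraight₁ : ∀ z ∈ c.source, (fun y => (y, (0 : ℝ))) ∘ c =ᶠ[𝓝 z] e₁ ∘ ι₁ := fun z hz => by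
    filter_upwards [c.open_source.mem_nhds hz] with w hw
    rw [Function.comp_apply, Function.comp_apply, he₁, hstraight w hw]
  obtain ⟨L, hLp, hL, hL_sub, hext⟩ := h₀.exists_hasRelativeGermExtension_of_straight h₁ hc hp hp₀
    hp₁ hι₀.contMDiff hι₁.contMDiff
    (injective_modelDeriv_of_isImmersionAt (hι₀.isImmersionAt p)) hstraight₁ hD
  have hL_target : L ⊆ c.target := fun y hy => (hL_sub hy).1
  have hK : c.symm '' L ⊆ c.source := image_subset_iff.2 fun y hy => c.map_target (hL_target hy)
  refine ⟨c.symm '' L, ?_, hL.image_of_continuousOn (c.continuousOn_symm.mono hL_target),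
    h₀.hasRelativeGermExtension h₁ (j := e₀ ∘ ι₀ ∘ c.symm) hK hι₀.contMDiff.continuous
      hι₁.contMDiff.continuous (forall_mem_image.2 fun y hy => (hL_sub hy).2.1)
      (forall_mem_image.2 fun y hy => (hL_sub hy).2.2) (fun z hz => ?_)
      (fun z hz => hstraight₁ z (hK hz)) ?_⟩
  · exact c.symm_map_nhds_eq hp ▸ image_mem_map hLp
  · filter_upwards [c.eventually_left_inverse (hK hz)] with w hw
    simp only [Function.comp_apply, hw]
  · exact (c.toPartialEquiv.image_symm_image_of_subset_target hL_target).symm ▸ hext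

end LocalExtension

end Hypersurface

/-! ### From germs to contactomorphisms -/

section Globalization

variable {m : ℕ}
  {M : Type*} [TopologicalSpace M] [ChartedSpace (EuclideanSpace ℝ (Fin m)) M]
  {N : Type*} [TopologicalSpace N] [ChartedSpace (EuclideanSpace ℝ (Fin m)) N]

theorem IsPartialDiffeomorph.isLocalDiffeomorphAt {e : OpenPartialHomeomorph M N}
    (he : IsPartialDiffeomorph (𝓡 m) (𝓡 m) e) {x : M} (hx : x ∈ e.source) {Φ : M → N}
    (h : Φ =ᶠ[𝓝 x] e) : IsLocalDiffeomorphAt (𝓡 m) (𝓡 m) ∞ Φ x := by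
  obtain ⟨O, hOe, hO, hxO⟩ := mem_nhds_iff.1 h
  have hrestr := he.restrOpen hO
  refine ⟨⟨(e.restrOpen O hO).toPartialEquiv, (e.restrOpen O hO).open_source,
    (e.restrOpen O hO).open_target, hrestr.contMDiffOn, hrestr.contMDiffOn_symm⟩, ?_, ?_⟩
  · exact ⟨hx, hxO⟩
  · exact fun y hy => hOe hy.2

theorem isLocalDiffeomorphAt_of_isInvertible_modelDeriv [IsManifold (𝓡 m) ∞ M]
    [IsManifold (𝓡 m) ∞ N] {Φ : M → N} {x : M}
    (hΦ : ∀ᶠ y in 𝓝 x, ContMDiffAt (𝓡 m) (𝓡 m) ∞ Φ y)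
    (hinv : (modelDeriv (𝓡 m) (𝓡 m) Φ x).IsInvertible) :
    IsLocalDiffeomorphAt (𝓡 m) (𝓡 m) ∞ Φ x := by
  have he := isPartialDiffeomorph_chartAt (m := m) x
  have he' := isPartialDiffeomorph_chartAt (m := m) (Φ x)
  set e := chartAt (EuclideanSpace ℝ (Fin m)) x
  set e' := chartAt (EuclideanSpace ℝ (Fin m)) (Φ x)
  have hx : x ∈ e.source := mem_chart_source _ x
  have hx' : Φ x ∈ e'.source := mem_chart_source _ (Φ x)
  have hΦe : ∀ᶠ y in 𝓝 x, y ∈ e.source ∧ Φ y ∈ e'.source :=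
    (e.open_source.eventually_mem hx).and
      (hΦ.self_of_nhds.continuousAt.eventually (e'.open_source.mem_nhds hx'))
  have hsmooth : ∀ᶠ y in 𝓝 (e x), ContDiffAt ℝ ∞ (e' ∘ Φ ∘ e.symm) y := by
    rw [← e.map_nhds_eq hx, eventually_map]
    filter_upwards [hΦ, hΦe] with y hy hye
    exact contDiffAt_comp_comp_symm he he' hye.1 hye.2 hy
  obtain ⟨G, hxG, hG, hG_smooth, hG_symm⟩ := exists_openPartialHomeomorph_of_isInvertible_fderiv
    hsmooth ((isInvertible_fderiv_comp_comp_symm he he' hx hx' hΦ.self_of_nhds).2 hinv)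
  have hG_diffeo : IsPartialDiffeomorph (𝓡 m) (𝓡 m) G :=
    ⟨fun y hy => funext hG ▸ (hG_smooth y hy).1.contMDiffAt.contMDiffWithinAt,
      fun y hy => (hG_symm y hy).contMDiffAt.contMDiffWithinAt⟩
  have hGe : ∀ y ∈ e.source, G (e y) = e' (Φ y) := fun y hy => by
    rw [hG, Function.comp_apply, Function.comp_apply, e.left_inv hy]
  refine ((he.trans hG_diffeo).trans he'.symm).isLocalDiffeomorphAt ⟨⟨hx, hxG⟩, ?_⟩ ?_
  · change G (e x) ∈ e'.target
    exact hGe x hx ▸ e'.map_source hx'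
  · filter_upwards [hΦe] with y ⟨hy, hy'⟩
    exact ((congrArg e'.symm (hGe y hy)).trans (e'.left_inv hy')).symm

theorem exists_diffeomorph_opens_of_injOn {Φ : M → N} (U : Opens M) (hinj : InjOn Φ U)
    (hΦ : ∀ x ∈ U, IsLocalDiffeomorphAt (𝓡 m) (𝓡 m) ∞ Φ x) :
    ∃ (U' : Opens N) (Ψ : U ≃ₘ^∞⟮𝓡 m, 𝓡 m⟯ U'), ∀ x : U, (Ψ x : N) = Φ x := by
  have hopen : IsOpen (Φ '' U) := isOpen_iff_mem_nhds.2 <| forall_mem_image.2 fun x hx => by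
    rw [← IsLocalHomeomorphOn.map_nhds_eq
      (IsLocalDiffeomorphOn.isLocalHomeomorphOn fun x : U => hΦ x x.2) hx]
    exact image_mem_map (U.isOpen.mem_nhds hx)
  let U' : Opens N := ⟨Φ '' U, hopen⟩
  let Ψ : U ≃ U' := Equiv.Set.imageOfInjOn Φ U hinj
  refine ⟨U', ⟨Ψ, fun x => ?_, fun y => ?_⟩, fun _ => rfl⟩
  · exact (ContMDiffAt.subtypeVal_comp_iff ..).1 (contMDiffAt_subtype_iff.2 (hΦ x x.2).contMDiffAt)
  · obtain ⟨x, rfl⟩ := Ψ.surjective y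
    have hx := hΦ x x.2
    refine (ContMDiffAt.subtypeVal_comp_iff ..).1 <| (contMDiffAt_subtype_iff (U := U')
      (x := Ψ x).2 hx.localInverse_contMDiffAt).congr_of_eventuallyEq ?_
    have hU : ∀ᶠ w in 𝓝 (Φ x), hx.localInverse w ∈ U :=
      hx.localInverse_contMDiffAt.continuousAt.eventually <| U.isOpen.mem_nhds <| by
        rw [hx.localInverse_left_inv hx.localInverse_mem_target]
        exact x.2
    filter_upwards [(continuous_subtype_val.tendsto (Ψ x)).eventually
      (hU.and hx.localInverse_eventuallyEq_right)] with w ⟨hwU, hw⟩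
    exact congrArg Subtype.val
      (Ψ.symm_apply_eq.2 (Subtype.ext hw.symm) : Ψ.symm w = ⟨hx.localInverse w, hwU⟩)

theorem isContactomorphism_restrict {ξ : TangentDistribution m M} {η : TangentDistribution m N}
    {Φ : M → N} {U : Opens M} {U' : Opens N} {Ψ : U ≃ₘ^∞⟮𝓡 m, 𝓡 m⟯ U'}
    (hΨ : ∀ x : U, (Ψ x : N) = Φ x) (hΦ : ∀ x ∈ U, ContMDiffAt (𝓡 m) (𝓡 m) ∞ Φ x)
    (h : ∀ x ∈ U, ∀ v, modelDeriv (𝓡 m) (𝓡 m) Φ x v ∈ η (Φ x) ↔ v ∈ ξ x) :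
    IsContactomorphism (ξ.restrict U) (η.restrict U') Ψ := by
  intro x
  have hchain : modelDeriv (𝓡 m) (𝓡 m) ((↑) : U' → N) (Ψ x) ∘L modelDeriv (𝓡 m) (𝓡 m) Ψ x =
      modelDeriv (𝓡 m) (𝓡 m) Φ x ∘L modelDeriv (𝓡 m) (𝓡 m) ((↑) : U → M) x := by
    rw [← modelDeriv_comp contMDiff_subtype_val.contMDiffAt Ψ.contMDiff.contMDiffAt,
      show ((↑) : U' → N) ∘ Ψ = Φ ∘ ((↑) : U → M) from funext hΨ,
      modelDeriv_comp (hΦ x x.2) contMDiff_subtype_val.contMDiffAt]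
  have hmem : ∀ v, modelDeriv (𝓡 m) (𝓡 m) Ψ x v ∈ η.restrict U' (Ψ x) ↔ v ∈ ξ.restrict U x :=
    fun v => by
      refine Iff.trans ?_ (h x x.2 (modelDeriv (𝓡 m) (𝓡 m) ((↑) : U → M) x v))
      rw [← hΨ x]
      exact (congrArg (· ∈ η (Ψ x : N)) (DFunLike.congr_fun hchain v)).to_iff
  refine Submodule.ext fun w => ⟨?_, fun hw => ?_⟩
  · rintro ⟨v, hv, rfl⟩
    exact (hmem v).2 hv
  · obtain ⟨v, rfl⟩ := (Ψ.mfderivToContinuousLinearEquiv (by simp) x).surjective w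
    exact ⟨v, (hmem v).1 hw, rfl⟩

theorem exists_isContactomorphism_of_forall_isDistributionGerm {T : Type*} [TopologicalSpace T]
    [MetrizableSpace M] [MetrizableSpace N] [IsManifold (𝓡 m) ∞ M] [IsManifold (𝓡 m) ∞ N]
    {ξ : TangentDistribution m M} {η : TangentDistribution m N} {i : T → M} {i' : T → N}
    (hi : Continuous i) (hi' : IsInducing i') {Φ : M → N}
    (hΦ : ∀ z, IsDistributionGerm (𝓡 m) (𝓡 m) ξ η i i' Φ z) :
    ∃ (U : Opens M) (U' : Opens N) (h : ∀ z, i z ∈ U) (h' : ∀ z, i' z ∈ U')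
      (Ψ : U ≃ₘ^∞⟮𝓡 m, 𝓡 m⟯ U'), IsContactomorphism (ξ.restrict U) (η.restrict U') Ψ ∧
        ∀ z, Ψ ⟨i z, h z⟩ = ⟨i' z, h' z⟩ := by
  have hΦi : Φ ∘ i = i' := funext fun z => (hΦ z).map_eq
  have hloc z : IsLocalDiffeomorphAt (𝓡 m) (𝓡 m) ∞ Φ (i z) :=
    isLocalDiffeomorphAt_of_isInvertible_modelDeriv (hΦ z).smooth (hΦ z).invertible
  obtain ⟨V, hV, hiV, hinj⟩ := exists_injOn_of_isInducing hi (hΦi ▸ hi')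
    (fun z => (hΦ z).continuousAt) fun z =>
      let ⟨g, hz, hg⟩ := hloc z
      ⟨g.source, g.open_source.mem_nhds hz, g.injOn.congr hg.symm⟩
  let W : Set M := {x | IsLocalDiffeomorphAt (𝓡 m) (𝓡 m) ∞ Φ x ∧
    ∀ v, modelDeriv (𝓡 m) (𝓡 m) Φ x v ∈ η (Φ x) ↔ v ∈ ξ x}
  have hiW : ∀ z, i z ∈ interior W := fun z => by
    obtain ⟨g, hz, hg⟩ := hloc z
    rw [mem_interior_iff_mem_nhds]
    filter_upwards [g.open_source.mem_nhds hz, (hΦ z).mem_iff] with x hx hmem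
      using ⟨⟨g, hx, hg⟩, hmem⟩
  let U : Opens M := ⟨V ∩ interior W, hV.inter isOpen_interior⟩
  have hU : ∀ x ∈ U, x ∈ W := fun x hx => interior_subset hx.2
  obtain ⟨U', Ψ, hΨ⟩ := exists_diffeomorph_opens_of_injOn U (hinj.mono inter_subset_left)
    fun x hx => (hU x hx).1
  have hiU : ∀ z, i z ∈ U := fun z => ⟨hiV z, hiW z⟩
  have hΨi : ∀ z, (Ψ ⟨i z, hiU z⟩ : N) = i' z := fun z => (hΨ _).trans (hΦ z).map_eq
  exact ⟨U, U', hiU, fun z => hΨi z ▸ (Ψ ⟨i z, hiU z⟩).2, Ψ,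
    isContactomorphism_restrict hΨ (fun x hx => (hU x hx).1.contMDiffAt) fun x hx => (hU x hx).2,
    fun z => Subtype.ext (hΨi z)⟩

theorem exists_isContactomorphism_of_isEmpty {T : Type*} [IsEmpty T] (ξ : TangentDistribution m M)
    (η : TangentDistribution m N) (i : T → M) (i' : T → N) :
    ∃ (U : Opens M) (U' : Opens N) (h : ∀ z, i z ∈ U) (h' : ∀ z, i' z ∈ U')
      (Ψ : U ≃ₘ^∞⟮𝓡 m, 𝓡 m⟯ U'), IsContactomorphism (ξ.restrict U) (η.restrict U') Ψ ∧
        ∀ z, Ψ ⟨i z, h z⟩ = ⟨i' z, h' z⟩ :=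
  have hM : IsEmpty (⊥ : Opens M) := ⟨fun x => x.2⟩
  have hN : IsEmpty (⊥ : Opens N) := ⟨fun x => x.2⟩
  ⟨⊥, ⊥, isEmptyElim, isEmptyElim, ⟨Equiv.equivOfIsEmpty _ _, hM.elim, hN.elim⟩, hM.elim,
    isEmptyElim⟩

theorem metrizableSpace_of_chartedSpace_euclideanSpace (m : ℕ) (M : Type*) [TopologicalSpace M]
    [T2Space M] [SecondCountableTopology M] [ChartedSpace (EuclideanSpace ℝ (Fin m)) M] :
    MetrizableSpace M :=
  have := ChartedSpace.locallyCompactSpace (EuclideanSpace ℝ (Fin m)) M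
  Manifold.metrizableSpace (𝓡 m) M

end Globalization

end ContactGeometry

theorem mainTheorem6 (n : ℕ)
    {M₀ : Type*} [TopologicalSpace M₀] [T2Space M₀] [SecondCountableTopology M₀]
    [ChartedSpace (EuclideanSpace ℝ (Fin (2 * n + 1))) M₀] [IsManifold (𝓡 (2 * n + 1)) ∞ M₀]
    {M₁ : Type*} [TopologicalSpace M₁] [T2Space M₁] [SecondCountableTopology M₁]
    [ChartedSpace (EuclideanSpace ℝ (Fin (2 * n + 1))) M₁] [IsManifold (𝓡 (2 * n + 1)) ∞ M₁]
    {S : Type*} [TopologicalSpace S] [T2Space S] [SecondCountableTopology S]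
    [ChartedSpace (EuclideanSpace ℝ (Fin (2 * n))) S] [IsManifold (𝓡 (2 * n)) ∞ S]
    (ξ₀ : ContactGeometry.TangentDistribution (2 * n + 1) M₀)
    (hξ₀ : ContactGeometry.IsContactStructure ξ₀)
    (ξ₁ : ContactGeometry.TangentDistribution (2 * n + 1) M₁)
    (hξ₁ : ContactGeometry.IsContactStructure ξ₁)
    (ι₀ : S → M₀) (hι₀ : Manifold.IsSmoothEmbedding (𝓡 (2 * n)) (𝓡 (2 * n + 1)) ∞ ι₀)
    (ι₁ : S → M₁) (hι₁ : Manifold.IsSmoothEmbedding (𝓡 (2 * n)) (𝓡 (2 * n + 1)) ∞ ι₁)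
    (hD : ContactGeometry.TangentDistribution.pullback (m := 2 * n) ι₀ ξ₀ =
      ContactGeometry.TangentDistribution.pullback (m := 2 * n) ι₁ ξ₁) :
    ∃ (U₀ : TopologicalSpace.Opens M₀) (U₁ : TopologicalSpace.Opens M₁)
      (h₀ : ∀ p, ι₀ p ∈ U₀) (h₁ : ∀ p, ι₁ p ∈ U₁)
      (Φ : U₀ ≃ₘ^∞⟮𝓡 (2 * n + 1), 𝓡 (2 * n + 1)⟯ U₁),
      ContactGeometry.IsContactomorphism (ξ₀.restrict U₀) (ξ₁.restrict U₁) Φ ∧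
        ∀ p, Φ ⟨ι₀ p, h₀ p⟩ = ⟨ι₁ p, h₁ p⟩ := by
  have := ContactGeometry.metrizableSpace_of_chartedSpace_euclideanSpace (2 * n + 1) M₀
  have := ContactGeometry.metrizableSpace_of_chartedSpace_euclideanSpace (2 * n + 1) M₁
  obtain hS | ⟨⟨p⟩⟩ := isEmpty_or_nonempty S
  · exact ContactGeometry.exists_isContactomorphism_of_isEmpty ξ₀ ξ₁ ι₀ ι₁
  have : Nonempty M₁ := ⟨ι₁ p⟩
  have hD_iff : ∀ p v,
      ContactGeometry.modelDeriv (𝓡 (2 * n)) (𝓡 (2 * n + 1)) ι₀ p v ∈ ξ₀ (ι₀ p) ↔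
        ContactGeometry.modelDeriv (𝓡 (2 * n)) (𝓡 (2 * n + 1)) ι₁ p v ∈ ξ₁ (ι₁ p) :=
    fun p => SetLike.ext_iff.1 (congrFun hD p)
  obtain ⟨Φ, hΦ⟩ := ContactGeometry.HasRelativeGermExtension.exists_forall
    hι₀.isEmbedding.isInducing
    (fun _ _ _ h hΦ => h.congr hι₀.isEmbedding.continuous.continuousAt hΦ)
    (ContactGeometry.exists_hasRelativeGermExtension_isDistributionGerm hξ₀ hξ₁
      hι₀.isImmersion hι₁.isImmersion hD_iff)
  exact ContactGeometry.exists_isContactomorphism_of_forall_isDistributionGerm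
    hι₀.isEmbedding.continuous hι₁.isEmbedding.isInducing hΦ
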